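/- Let $p$ be a prime, $K$ a finite extension of $\mathbb{Q}_p$, $\overline K$ an algebraic closure of $K$, and $v$ the extension to $\overline K$ of the $p$-adic valuation, normalized by $v(p)=1$. Let $\mathcal{O}_K$ and $\mathcal{O}_{\overline K}$ be the rings of integers, let $\Omega^1:=\Omega^1_{\mathcal{O}_{\overline K}/\mathcal{O}_K}$ be the module of Kähler differentials, with universal derivation $d:\mathcal{O}_{\overline K}\to\Omega^1$, and let $\mathbb{C}_K$ be the completion of $\overline K$. Let $\mu_{p^\infty}$ be the torsion $\mathbb{Z}_p$-module of roots of unity of $p$-power order in $\overline K$, and $\mathbb{Z}_p(1)=\varprojlim_r\mu_{p^r}$. For a $\mathbb{Z}_p$-module $A$ put $T_p(A)=\varprojlim_r A[p^r]$, where the transition maps are multiplication by $p$, and $V_p(A)=T_p(A)\otimes_{\mathbb{Z}_p}\mathbb{Q}_p$. The logarithmic derivative $\mathrm{dlog}:\mu_{p^\infty}\to\Omega^1$, $\zeta\mapsto d\zeta/\zeta$, extends to an $\mathcal{O}_{\overline K}$-linear map $\mathcal{O}_{\overline K}\otimes_{\mathbb{Z}_p}\mu_{p^\infty}\to\Omega^1$;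 composing it with the canonical map $(\overline K/\mathcal{O}_{\overline K})\otimes_{\mathbb{Z}_p}\mathbb{Z}_p(1)\to\mathcal{O}_{\overline K}\otimes_{\mathbb{Z}_p}\mu_{p^\infty}$, $\overline{p^{-r}a}\otimes(\varepsilon_s)_s\mapsto a\otimes\varepsilon_r$ for $a\in\mathcal{O}_{\overline K}$, one obtains $$\mathrm{dlog}:(\overline K/\mathcal{O}_{\overline K})\otimes_{\mathbb{Z}_p}\mathbb{Z}_p(1)\to\Omega^1 .$$ **Theorem (Fontaine).** Let $K_0$ be the maximal unramified subextension of $K|\mathbb{Q}_p$, let $D_{K/K_0}$ be the different of $K|K_0$, let $v(D_{K/K_0})$ be the minimum of $v$ on this ideal, and set $$I_K:=\{a\in\overline K:\ v(a)\ge -v(D_{K/K_0})-1/(p-1)\}\supseteq\mathcal{O}_{\overline K}.$$ 1. The map $\mathrm{dlog}$ induces an isomorphism of $\mathcal{O}_{\overline K}$-modules $(\overline K/I_K)\otimes_{\mathbb{Z}_p}\mathbb{Z}_p(1)\xrightarrow{\ \sim\ }\Omega^1$; that is, $\mathrm{dlog}$ is the composite of this isomorphism with the projection from $(\overline K/\mathcal{O}_{\overline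 K})\otimes_{\mathbb{Z}_p}\mathbb{Z}_p(1)$. 2. The map $\mathrm{dlog}$ induces a $\mathrm{Gal}(\overline K|K)$-equivariant isomorphism of $\mathbb{Z}_p$-modules $\mathbb{C}_K(1):=\mathbb{C}_K\otimes_{\mathbb{Z}_p}\mathbb{Z}_p(1)\xrightarrow{\ \sim\ }V_p(\Omega^1)$. For $\varepsilon=(\varepsilon_r)_r\in\mathbb{Z}_p(1)$, $c\in\mathbb{C}_K$ and $a_r\in\mathcal{O}_{\overline K}$ with $v(c-a_r)\ge r$ for all $r\ge 0$, it sends $c\otimes\varepsilon$ to $(a_r\,\mathrm{dlog}\,\varepsilon_r)_r\otimes 1$, where $(a_r\,\mathrm{dlog}\,\varepsilon_r)_r\in T_p(\Omega^1)$. 3. $\Omega^1$ is $p$-primary torsion: every element is killed by a power of $p$. 4. $\Omega^1$ is $p$-divisible: $p\,\Omega^1=\Omega^1$. 5. The derivation $d:\mathcal{O}_{\overline K}\to\Omega^1$ is surjective. -/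

import Mathlib

open scoped TensorProduct

noncomputable section

namespace FontaineDifferentials

/-! ### Rings of integers of algebraic extensions of `ℚ_p` -/

section RingsOfIntegers

variable (p : ℕ) [Fact p.Prime]

/-- The ring of integers `𝒪_L` of an algebraic extension `L` of `ℚ_p`: the integral closure of
`ℤ_p` in `L`. -/
def RingInt (L : Type*) [Field L] [Algebra ℤ_[p] L] : Type _ := ↥(integralClosure ℤ_[p] L)

section

variable (L : Type*) [Field L] [Algebra ℤ_[p] L]

instance : CommRing (RingInt p L) := inferInstanceAs (CommRing ↥(integralClosure ℤ_[p] L))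

instance : IsDomain (RingInt p L) := inferInstanceAs (IsDomain ↥(integralClosure ℤ_[p] L))

instance : Algebra ℤ_[p] (RingInt p L) :=
  inferInstanceAs (Algebra ℤ_[p] ↥(integralClosure ℤ_[p] L))

instance : Algebra (RingInt p L) L := inferInstanceAs (Algebra ↥(integralClosure ℤ_[p] L) L)

instance : IsScalarTower ℤ_[p] (RingInt p L) L :=
  inferInstanceAs (IsScalarTower ℤ_[p] ↥(integralClosure ℤ_[p] L) L)

instance : IsIntegralClosure (RingInt p L) ℤ_[p] L :=
  inferInstanceAs (IsIntegralClosure ↥(integralClosure ℤ_[p] L) ℤ_[p] L)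

variable {p L}

instance : CoeOut (RingInt p L) L := ⟨algebraMap (RingInt p L) L⟩

/-- An element of `L` that is integral over `ℤ_p`, as an element of `𝒪_L`. -/
def RingInt.mk (x : L) (hx : IsIntegral ℤ_[p] x) : RingInt p L :=
  (⟨x, hx⟩ : ↥(integralClosure ℤ_[p] L))

@[simp] theorem RingInt.coe_mk (x : L) (hx : IsIntegral ℤ_[p] x) : (RingInt.mk x hx : L) = x := rfl

theorem RingInt.isIntegral (x : RingInt p L) : IsIntegral ℤ_[p] (x : L) :=
  Subtype.property (p := fun y => y ∈ integralClosure ℤ_[p] L) x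

theorem RingInt.ext {x y : RingInt p L} (h : (x : L) = y) : x = y :=
  IsIntegralClosure.algebraMap_injective (RingInt p L) ℤ_[p] L h

end

variable {p}

/-- In a tower `E / F / ℚ_p`, the `ℤ_p`-algebra structures are compatible. -/
instance isScalarTower_padicInt (F E : Type*) [Field F] [Field E] [Algebra ℚ_[p] F]
    [Algebra ℤ_[p] F] [IsScalarTower ℤ_[p] ℚ_[p] F] [Algebra ℚ_[p] E] [Algebra ℤ_[p] E]
    [IsScalarTower ℤ_[p] ℚ_[p] E] [Algebra F E] [IsScalarTower ℚ_[p] F E] :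
    IsScalarTower ℤ_[p] F E :=
  IsScalarTower.of_algebraMap_eq fun x => by
    rw [IsScalarTower.algebraMap_apply ℤ_[p] ℚ_[p] E, IsScalarTower.algebraMap_apply ℚ_[p] F E,
      IsScalarTower.algebraMap_apply ℤ_[p] ℚ_[p] F]

variable (F E : Type*) [Field F] [Field E] [Algebra ℤ_[p] F] [Algebra ℤ_[p] E] [Algebra F E]
  [IsScalarTower ℤ_[p] F E]

/-- For `E / F`, the inclusion `𝒪_F → 𝒪_E`. -/
instance (priority := 50) algebraRingInt : Algebra (RingInt p F) (RingInt p E) :=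
  RingHom.toAlgebra
    { toFun := fun x => RingInt.mk (algebraMap F E x) x.isIntegral.algebraMap
      map_one' := RingInt.ext (by simp)
      map_mul' := fun x y => RingInt.ext (by simp)
      map_zero' := RingInt.ext (by simp)
      map_add' := fun x y => RingInt.ext (by simp) }

theorem coe_algebraMap_ringInt (x : RingInt p F) :
    ((algebraMap (RingInt p F) (RingInt p E) x : RingInt p E) : E) = algebraMap F E x := rfl

instance isScalarTower_ringInt : IsScalarTower ℤ_[p] (RingInt p F) (RingInt p E) :=
  IsScalarTower.of_algebraMap_eq fun x => RingInt.ext (by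
    rw [coe_algebraMap_ringInt, ← IsScalarTower.algebraMap_apply ℤ_[p] (RingInt p F) F,
      ← IsScalarTower.algebraMap_apply ℤ_[p] (RingInt p E) E,
      ← IsScalarTower.algebraMap_apply ℤ_[p] F E])

instance smulCommClass_ringInt : SMulCommClass (RingInt p F) ℤ_[p] (RingInt p E) :=
  IsScalarTower.to_smulCommClass'

instance isTorsionFree_ringInt : Module.IsTorsionFree (RingInt p F) (RingInt p E) :=
  Module.isTorsionFree_iff_algebraMap_injective.2 fun _ _ h => RingInt.ext
    ((algebraMap F E).injective (congrArg (algebraMap (RingInt p E) E) h))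

instance isDedekindDomain_ringInt (L : Type*) [Field L] [Algebra ℚ_[p] L]
    [FiniteDimensional ℚ_[p] L] [Algebra ℤ_[p] L] [IsScalarTower ℤ_[p] ℚ_[p] L] :
    IsDedekindDomain (RingInt p L) :=
  integralClosure.isDedekindDomain ℤ_[p] ℚ_[p] L

end RingsOfIntegers

/-! ### The different of `K` over its maximal unramified subextension -/

section Different

variable (p : ℕ) [Fact p.Prime] (K : Type*) [Field K] [Algebra ℚ_[p] K] [FiniteDimensional ℚ_[p] K]
  [Algebra ℤ_[p] K] [IsScalarTower ℤ_[p] ℚ_[p] K]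

/-- The maximal unramified subextension `K₀` of `K / ℚ_p`: the compositum of all subextensions
`L / ℚ_p` such that `𝒪_L` is unramified over `ℤ_p`. -/
def maxUnramified : IntermediateField ℚ_[p] K :=
  sSup {L | Algebra.FormallyUnramified ℤ_[p] (RingInt p L)}

/-- The different `D_{K/K₀}`, an ideal of `𝒪_K`. -/
def different : Ideal (RingInt p K) :=
  differentIdeal (RingInt p (maxUnramified p K)) (RingInt p K)

end Different

/-! ### The valuation and the fractional ideal `I_K` -/

section Valuation

variable (p : ℕ) [Fact p.Prime] {Kbar : Type*} [NormedField Kbar]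

/-- The additive valuation `v` with `v 0 = ∞` and `p ^ (-v a) = ‖a‖` for `a ≠ 0`. Since the norm of
`Kbar` extends the `p`-adic norm of `ℚ_p`, this `v` extends the `p`-adic valuation of `ℚ_p`. -/
def val (a : Kbar) : EReal :=
  open Classical in if a = 0 then ⊤ else ((-Real.logb p ‖a‖ : ℝ) : EReal)

theorem le_val_iff {c : EReal} {a b : Kbar} (h : ‖a‖ ≤ ‖b‖) (hc : c ≤ val p b) : c ≤ val p a := by
  have hp : (1 : ℝ) < p := by exact_mod_cast (Fact.out : p.Prime).one_lt
  unfold val at *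
  split_ifs with ha
  · exact le_top
  · have ha' : 0 < ‖a‖ := norm_pos_iff.2 ha
    have hb : b ≠ 0 := norm_pos_iff.1 (ha'.trans_le h)
    rw [if_neg hb] at hc
    refine hc.trans (EReal.coe_le_coe_iff.2 (neg_le_neg ?_))
    exact Real.logb_le_logb_of_le hp ha' h

variable [NormedAlgebra ℚ_[p] Kbar] [Algebra ℤ_[p] Kbar] [IsScalarTower ℤ_[p] ℚ_[p] Kbar]

theorem norm_ringInt_le_one (x : RingInt p Kbar) : ‖(x : Kbar)‖ ≤ 1 := by
  have : IsUltrametricDist Kbar := IsUltrametricDist.of_normedAlgebra ℚ_[p]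
  let w : Valuation Kbar NNReal := NormedField.valuation
  have hw : w.Integers w.integer := Valuation.integer.integers w
  have key : ∀ z : ℤ_[p], ‖algebraMap ℤ_[p] Kbar z‖ ≤ 1 := fun z => by
    rw [IsScalarTower.algebraMap_apply ℤ_[p] ℚ_[p] Kbar, norm_algebraMap']
    exact z.2
  let f : ℤ_[p] →+* w.integer := (algebraMap ℤ_[p] Kbar).codRestrict w.integer fun z => key z
  have hx : IsIntegral w.integer (x : Kbar) := by
    obtain ⟨q, hq, hq0⟩ := x.isIntegral
    refine ⟨q.map f, hq.map f, ?_⟩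
    rw [Polynomial.eval₂_map]
    exact hq0
  exact hw.mem_of_integral hx

/-- The `𝒪_Kbar`-submodule `{a | c ≤ v a}` of `Kbar`. -/
def valSubmodule (c : EReal) : Submodule (RingInt p Kbar) Kbar where
  carrier := {a | c ≤ val p a}
  zero_mem' := by simp [val]
  add_mem' {a b} ha hb := by
    have : IsUltrametricDist Kbar := IsUltrametricDist.of_normedAlgebra ℚ_[p]
    rcases le_max_iff.1 (IsUltrametricDist.norm_add_le_max a b) with h | h
    · exact le_val_iff p h ha
    · exact le_val_iff p h hb
  smul_mem' s a ha := by
    refine le_val_iff p ?_ ha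
    rw [Algebra.smul_def, norm_mul]
    exact mul_le_of_le_one_left (norm_nonneg _) (norm_ringInt_le_one p s)

variable (Kbar)

/-- `𝒪_Kbar`, as an `𝒪_Kbar`-submodule of `Kbar`. -/
def intSubmodule : Submodule (RingInt p Kbar) Kbar :=
  LinearMap.range (Algebra.linearMap (RingInt p Kbar) Kbar)

variable (K : Type*) [Field K] [Algebra ℚ_[p] K] [FiniteDimensional ℚ_[p] K]
  [Algebra ℤ_[p] K] [IsScalarTower ℤ_[p] ℚ_[p] K] [Algebra K Kbar]

/-- `v(D_{K/K₀})`, the minimum of the valuations of the elements of `D_{K/K₀}`. -/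
def valDifferent : EReal :=
  ⨅ x ∈ different p K, val p (algebraMap K Kbar (x : K))

/-- `I_K = {a ∈ Kbar | v(a) ≥ -v(D_{K/K₀}) - 1/(p-1)}`. -/
def fracIdeal : Submodule (RingInt p Kbar) Kbar :=
  valSubmodule p (-(valDifferent p Kbar K) - ((1 / ((p : ℝ) - 1) : ℝ) : EReal))

theorem zero_le_val_ringInt (x : RingInt p Kbar) : 0 ≤ val p (x : Kbar) := by
  refine le_val_iff p (b := (1 : Kbar)) ?_ ?_
  · simpa using norm_ringInt_le_one p x
  · simp [val]

theorem intSubmodule_le_fracIdeal [IsScalarTower ℚ_[p] K Kbar] :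
    intSubmodule p Kbar ≤ fracIdeal p Kbar K := by
  rintro _ ⟨x, rfl⟩
  have h0 : 0 ≤ valDifferent p Kbar K :=
    le_iInf₂ fun y _ => zero_le_val_ringInt p Kbar (algebraMap (RingInt p K) (RingInt p Kbar) y)
  have h1 : (0 : EReal) ≤ ((1 / ((p : ℝ) - 1) : ℝ) : EReal) := by
    have hp : (1 : ℝ) < p := by exact_mod_cast (Fact.out : p.Prime).one_lt
    exact EReal.coe_nonneg.2 (one_div_nonneg.2 (by linarith))
  refine le_trans ?_ (zero_le_val_ringInt p Kbar x)
  rw [sub_eq_add_neg]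
  exact add_nonpos (by simpa using h0) (by simpa using h1)

end Valuation

/-! ### The `ℤ_p`-module of `p`-power roots of unity -/

section Mu

variable (p : ℕ) [Fact p.Prime] (L : Type*) [Field L]

/-- `μ_{p^∞}`: the group of all roots of unity of `p`-power order in `L`, written additively. -/
def Mu : Type _ := Additive (CommGroup.primaryComponent Lˣ p)

instance : AddCommGroup (Mu p L) :=
  inferInstanceAs (AddCommGroup (Additive (CommGroup.primaryComponent Lˣ p)))

variable {p L}

/-- An element of `μ_{p^∞}`, as a unit of `L`. -/
def Mu.unit (x : Mu p L) : Lˣ := ((Additive.toMul x : CommGroup.primaryComponent Lˣ p) : Lˣ)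

theorem Mu.exists_smul_eq_zero (x : Mu p L) : ∃ n : ℕ, p ^ n • x = 0 := by
  obtain ⟨n, hn⟩ := (Additive.toMul x : CommGroup.primaryComponent Lˣ p).2
  refine ⟨n, ?_⟩
  change (Additive.toMul x : CommGroup.primaryComponent Lˣ p) ^ (p ^ n) = 1
  exact Subtype.ext hn

/-- An element `z` of `ℤ_p` acts on `x` with `p ^ n • x = 0` through its residue modulo `p ^ n`. -/
instance : SMul ℤ_[p] (Mu p L) :=
  ⟨fun z x => z.appr (Classical.choose x.exists_smul_eq_zero) • x⟩

theorem nsmul_eq_of_sub_mem {A : Type*} [AddCommGroup A] {x : A} {n : ℕ} (hx : p ^ n • x = 0)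
    {a b : ℕ} (h : (a : ℤ_[p]) - b ∈ Ideal.span {(p : ℤ_[p]) ^ n}) : a • x = b • x := by
  have h' : ((p : ℤ) ^ n) ∣ ((a : ℤ) - b) := by
    have h2 : ‖(((a : ℤ) - b : ℤ) : ℤ_[p])‖ ≤ (p : ℝ) ^ (-n : ℤ) := by
      rw [PadicInt.norm_le_pow_iff_mem_span_pow]
      simpa using h
    exact_mod_cast PadicInt.norm_int_le_pow_iff_dvd.1 h2
  obtain ⟨c, hc⟩ := h'
  have h3 : ((a : ℤ) - b) • x = 0 := by
    rw [hc, mul_comm, mul_smul]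
    have : ((p : ℤ) ^ n) • x = 0 := by exact_mod_cast hx
    rw [this, smul_zero]
  rw [sub_smul, sub_eq_zero] at h3
  exact_mod_cast h3

theorem Mu.smul_eq {x : Mu p L} {n : ℕ} (hx : p ^ n • x = 0) {z : ℤ_[p]} {m : ℕ}
    (h : z - m ∈ Ideal.span {(p : ℤ_[p]) ^ n}) : z • x = m • x := by
  change z.appr (Classical.choose x.exists_smul_eq_zero) • x = m • x
  set k := Classical.choose x.exists_smul_eq_zero with hk
  have hkx : p ^ k • x = 0 := Classical.choose_spec x.exists_smul_eq_zero
  have h1 : z - (z.appr k : ℤ_[p]) ∈ Ideal.span {(p : ℤ_[p]) ^ k} := PadicInt.appr_spec k z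
  rcases le_total k n with hkn | hkn
  · refine nsmul_eq_of_sub_mem hkx ?_
    have h2 : z - m ∈ Ideal.span {(p : ℤ_[p]) ^ k} :=
      Ideal.span_singleton_le_span_singleton.2 (pow_dvd_pow _ hkn) h
    simpa using Ideal.sub_mem _ h2 h1
  · refine nsmul_eq_of_sub_mem hx ?_
    have h2 : z - (z.appr k : ℤ_[p]) ∈ Ideal.span {(p : ℤ_[p]) ^ n} :=
      Ideal.span_singleton_le_span_singleton.2 (pow_dvd_pow _ hkn) h1
    simpa using Ideal.sub_mem _ h h2

theorem Mu.exists_smul_eq (x : Mu p L) (z : ℤ_[p]) :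
    ∃ n m : ℕ, p ^ n • x = 0 ∧ z - m ∈ Ideal.span {(p : ℤ_[p]) ^ n} ∧ z • x = m • x := by
  obtain ⟨n, hn⟩ := x.exists_smul_eq_zero
  exact ⟨n, z.appr n, hn, PadicInt.appr_spec n z, Mu.smul_eq hn (PadicInt.appr_spec n z)⟩

/-- The `ℤ_p`-module structure of `μ_{p^∞}`. -/
instance : Module ℤ_[p] (Mu p L) where
  one_smul x := by
    obtain ⟨n, hn⟩ := x.exists_smul_eq_zero
    rw [Mu.smul_eq hn (m := 1) (by simp), one_smul]
  mul_smul z w x := by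
    obtain ⟨n, hn⟩ := x.exists_smul_eq_zero
    have hz := PadicInt.appr_spec n z
    have hw := PadicInt.appr_spec n w
    have h : z * w - ((z.appr n * w.appr n : ℕ) : ℤ_[p]) ∈ Ideal.span {(p : ℤ_[p]) ^ n} := by
      have : z * w - ((z.appr n * w.appr n : ℕ) : ℤ_[p])
          = w * (z - z.appr n) + z.appr n * (w - w.appr n) := by push_cast; ring
      rw [this]
      exact Ideal.add_mem _ (Ideal.mul_mem_left _ _ hz) (Ideal.mul_mem_left _ _ hw)
    rw [Mu.smul_eq hn h, Mu.smul_eq hn hw, mul_smul]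
    refine (Mu.smul_eq (n := n) ?_ hz).symm
    rw [smul_comm, hn, smul_zero]
  smul_zero z := by
    rw [Mu.smul_eq (n := 0) (m := 0) (by simp) (by simp), smul_zero]
  smul_add z x y := by
    obtain ⟨a, ha⟩ := x.exists_smul_eq_zero
    obtain ⟨b, hb⟩ := y.exists_smul_eq_zero
    have hx : p ^ (a + b) • x = 0 := by rw [pow_add, mul_comm, mul_smul, ha, smul_zero]
    have hy : p ^ (a + b) • y = 0 := by rw [pow_add, mul_smul, hb, smul_zero]
    have hz := PadicInt.appr_spec (a + b) z
    rw [Mu.smul_eq hx hz, Mu.smul_eq hy hz, ← smul_add]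
    exact Mu.smul_eq (by rw [smul_add, hx, hy, add_zero]) hz
  add_smul z w x := by
    obtain ⟨n, hn⟩ := x.exists_smul_eq_zero
    have hz := PadicInt.appr_spec n z
    have hw := PadicInt.appr_spec n w
    have h : z + w - ((z.appr n + w.appr n : ℕ) : ℤ_[p]) ∈ Ideal.span {(p : ℤ_[p]) ^ n} := by
      have : z + w - ((z.appr n + w.appr n : ℕ) : ℤ_[p])
          = (z - z.appr n) + (w - w.appr n) := by push_cast; ring
      rw [this]
      exact Ideal.add_mem _ hz hw
    rw [Mu.smul_eq hn h, Mu.smul_eq hn hz, Mu.smul_eq hn hw, add_smul]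
  zero_smul x := by
    obtain ⟨n, hn⟩ := x.exists_smul_eq_zero
    rw [Mu.smul_eq hn (m := 0) (by simp), zero_smul]

/-- Additive maps from `μ_{p^∞}` to a `ℤ_p`-module are `ℤ_p`-linear. -/
def Mu.toLinearMap {A : Type*} [AddCommGroup A] [Module ℤ_[p] A] (f : Mu p L →+ A) :
    Mu p L →ₗ[ℤ_[p]] A where
  toFun := f
  map_add' := f.map_add
  map_smul' z x := by
    obtain ⟨n, m, hn, hm, h⟩ := x.exists_smul_eq z
    obtain ⟨c, hc⟩ := Ideal.mem_span_singleton.1 hm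
    have hz : z = m + c * (p : ℤ_[p]) ^ n := by rw [mul_comm, ← hc]; ring
    have h0 : ((p : ℤ_[p]) ^ n) • f x = 0 := by
      have := congrArg f hn
      rw [map_nsmul, map_zero, ← Nat.cast_smul_eq_nsmul ℤ_[p]] at this
      exact_mod_cast this
    rw [h, map_nsmul, RingHom.id_apply, hz, add_smul, mul_smul, h0, smul_zero, add_zero,
      Nat.cast_smul_eq_nsmul]

end Mu

/-! ### Tate modules -/

section Tate

variable (p : ℕ) [Fact p.Prime]

/-- The Tate module `T_p(A)`, the inverse limit of the `p ^ r`-torsion submodules of `A` along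
multiplication by `p`. -/
def TateModule (A : Type*) [AddCommGroup A] [Module ℤ_[p] A] : Submodule ℤ_[p] (ℕ → A) where
  carrier := {x | (∀ r, (p : ℤ_[p]) ^ r • x r = 0) ∧ ∀ r, (p : ℤ_[p]) • x (r + 1) = x r}
  zero_mem' := by simp
  add_mem' {x y} hx hy :=
    ⟨fun r => by simp [hx.1 r, hy.1 r], fun r => by simp [hx.2 r, hy.2 r]⟩
  smul_mem' c x hx :=
    ⟨fun r => by rw [Pi.smul_apply, smul_comm, hx.1 r, smul_zero],
      fun r => by rw [Pi.smul_apply, Pi.smul_apply, smul_comm, hx.2 r]⟩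

/-- `V_p(A) = T_p(A) ⊗ ℚ_p`. -/
abbrev VTate (A : Type*) [AddCommGroup A] [Module ℤ_[p] A] : Type _ :=
  ↥(TateModule p A) ⊗[ℤ_[p]] ℚ_[p]

/-- `ℤ_p(1)`, the inverse limit of the groups `μ_{p^r}(L)`. -/
abbrev Zp1 (L : Type*) [Field L] : Type _ := ↥(TateModule p (Mu p L))

variable {p}

theorem TateModule.pow_smul {A : Type*} [AddCommGroup A] [Module ℤ_[p] A] (x : TateModule p A)
    (r k : ℕ) : (p : ℤ_[p]) ^ k • x.1 (r + k) = x.1 r := by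
  induction k with
  | zero => simp
  | succ k ih => rw [pow_succ, mul_smul, ← add_assoc, x.2.2 (r + k), ih]

/-- Functoriality of the Tate module. -/
def TateModule.map {A B : Type*} [AddCommGroup A] [Module ℤ_[p] A] [AddCommGroup B]
    [Module ℤ_[p] B] (f : A →ₗ[ℤ_[p]] B) : TateModule p A →ₗ[ℤ_[p]] TateModule p B where
  toFun x := ⟨fun r => f (x.1 r), fun r => by rw [← map_smul, x.2.1 r, map_zero],
    fun r => by rw [← map_smul, x.2.2 r]⟩
  map_add' x y := Subtype.ext (funext fun r => map_add f _ _)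
  map_smul' c x := Subtype.ext (funext fun r => map_smul f _ _)

end Tate

/-! ### The dlog map -/

section Dlog

/-- The logarithmic derivative `u ↦ du / u` on the units of an `R`-algebra `S`. -/
def dlogUnits (R S : Type*) [CommRing R] [CommRing S] [Algebra R S] :
    Additive Sˣ →+ Ω[S⁄R] where
  toFun u := ((Additive.toMul u)⁻¹ : Sˣ).1 • KaehlerDifferential.D R S (Additive.toMul u).1
  map_zero' := by simp
  map_add' u v := by
    have h1 : ∀ a b : Sˣ, ((a * b)⁻¹ : Sˣ).1 * a.1 = (b⁻¹ : Sˣ).1 := fun a b => by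
      rw [← Units.val_mul]; congr 1; group
    have h2 : ∀ a b : Sˣ, ((a * b)⁻¹ : Sˣ).1 * b.1 = (a⁻¹ : Sˣ).1 := fun a b => by
      rw [mul_comm a b]; exact h1 b a
    rw [toMul_add, Units.val_mul, Derivation.leibniz, smul_add, smul_smul, smul_smul, h1, h2,
      add_comm]

variable (p : ℕ) [hp : Fact p.Prime] (L : Type*) [Field L] [Algebra ℤ_[p] L]

theorem isIntegral_of_mem_primaryComponent (x : CommGroup.primaryComponent Lˣ p) :
    IsIntegral ℤ_[p] ((x : Lˣ) : L) := by
  obtain ⟨n, hn⟩ := x.2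
  refine IsIntegral.of_pow (n := p ^ n) (pow_pos hp.out.pos n) ?_
  rw [← Units.val_pow_eq_pow_val, hn]
  exact isIntegral_one

/-- Roots of unity are units of the ring of integers. -/
def muToUnits : CommGroup.primaryComponent Lˣ p →* (RingInt p L)ˣ where
  toFun x := ⟨RingInt.mk ((x : Lˣ) : L) (isIntegral_of_mem_primaryComponent p L x),
    RingInt.mk ((x⁻¹ : CommGroup.primaryComponent Lˣ p) : Lˣ)
      (isIntegral_of_mem_primaryComponent p L x⁻¹),
    RingInt.ext (by simp), RingInt.ext (by simp)⟩
  map_one' := Units.ext (RingInt.ext (by simp))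
  map_mul' x y := Units.ext (RingInt.ext (by simp))

variable (K : Type*) [Field K] [Algebra ℤ_[p] K] [Algebra K L] [IsScalarTower ℤ_[p] K L]

/-- `Ω¹_{𝒪_L/𝒪_K}`, the module of Kähler differentials. -/
abbrev Omega : Type _ := Ω[RingInt p L⁄RingInt p K]

/-- `dlog : μ_{p^∞} → Ω¹`, `ζ ↦ dζ / ζ`. -/
def dlogMu : Mu p L →ₗ[ℤ_[p]] Omega p L K :=
  Mu.toLinearMap ((dlogUnits (RingInt p K) (RingInt p L)).comp
    (MonoidHom.toAdditive (muToUnits p L)))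

/-- The `𝒪_L`-linear extension `dlog : 𝒪_L ⊗ μ_{p^∞} → Ω¹`. -/
def dlogTensor : RingInt p L ⊗[ℤ_[p]] Mu p L →ₗ[RingInt p L] Omega p L K :=
  (dlogMu p L K).liftBaseChange (RingInt p L)

end Dlog

/-! ### The dlog map on `(Kbar / 𝒪_Kbar) ⊗ ℤ_p(1)` -/

section Divis

variable (p : ℕ) [hp : Fact p.Prime] (L : Type*) [NormedField L] [NormedAlgebra ℚ_[p] L]
  [Algebra ℤ_[p] L] [IsScalarTower ℤ_[p] ℚ_[p] L] [Algebra.IsAlgebraic ℚ_[p] L]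

variable {L} in
theorem exists_ringInt_eq (x : L) : ∃ ra : ℕ × RingInt p L, (ra.2 : L) = (p : L) ^ ra.1 * x := by
  have hx : IsAlgebraic ℤ_[p] x :=
    (IsFractionRing.isAlgebraic_iff ℤ_[p] ℚ_[p] L).2 (Algebra.IsAlgebraic.isAlgebraic x)
  obtain ⟨z, hz, hi⟩ := hx.exists_integral_multiple
  have hu := PadicInt.unitCoeff_spec hz
  refine ⟨⟨z.valuation, RingInt.mk ((p : L) ^ z.valuation * x) ?_⟩, rfl⟩
  have h : (p : L) ^ z.valuation * x
      = ((((PadicInt.unitCoeff hz)⁻¹ : ℤ_[p]ˣ) : ℤ_[p]) • (z • x)) := by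
    rw [smul_smul]
    nth_rw 3 [hu]
    rw [← mul_assoc, Units.inv_mul, one_mul, Algebra.smul_def, map_pow, map_natCast]
  rw [h]
  exact hi.smul _

variable {L} in
theorem tmul_eq_tmul {x : L} (e : Zp1 p L) {r s : ℕ} {a b : RingInt p L}
    (ha : (a : L) = (p : L) ^ r * x) (hb : (b : L) = (p : L) ^ s * x) :
    a ⊗ₜ[ℤ_[p]] e.1 r = b ⊗ₜ[ℤ_[p]] e.1 s := by
  wlog h : r ≤ s generalizing r s a b
  · exact (this hb ha (le_of_not_ge h)).symm
  obtain ⟨k, rfl⟩ := Nat.exists_eq_add_of_le h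
  have hab : b = ((p : ℤ_[p]) ^ k) • a := RingInt.ext (by
    rw [hb, Algebra.smul_def, map_mul, ← IsScalarTower.algebraMap_apply, map_pow, map_natCast, ha, pow_add]; ring)
  rw [hab, TensorProduct.smul_tmul, TateModule.pow_smul]

variable {L} in
/-- For `x ∈ Kbar` with `a = p ^ r * x ∈ 𝒪_Kbar` and `ε ∈ ℤ_p(1)`, the element `a ⊗ ε_r`. -/
def divisFun (x : L) (e : Zp1 p L) : RingInt p L ⊗[ℤ_[p]] Mu p L :=
  (Classical.choose (exists_ringInt_eq p x)).2 ⊗ₜ e.1 (Classical.choose (exists_ringInt_eq p x)).1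

variable {L} in
/-- The value of `divisFun` does not depend on the choice of `r`. -/
theorem divisFun_eq {x : L} (e : Zp1 p L) {r : ℕ} {a : RingInt p L}
    (ha : (a : L) = (p : L) ^ r * x) : divisFun p x e = a ⊗ₜ e.1 r :=
  tmul_eq_tmul p e (Classical.choose_spec (exists_ringInt_eq p x)) ha

/-- The pairing `(a / p ^ r, ε) ↦ a ⊗ ε_r`. -/
def divisPairing : L →ₗ[RingInt p L] Zp1 p L →ₗ[ℤ_[p]] RingInt p L ⊗[ℤ_[p]] Mu p L where
  toFun x :=
    { toFun := divisFun p x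
      map_add' := fun e f => by
        obtain ⟨⟨r, a⟩, h⟩ := exists_ringInt_eq p x
        rw [divisFun_eq p e h, divisFun_eq p f h, divisFun_eq p (e + f) h, ← TensorProduct.tmul_add]
        rfl
      map_smul' := fun z e => by
        obtain ⟨⟨r, a⟩, h⟩ := exists_ringInt_eq p x
        rw [divisFun_eq p e h, divisFun_eq p (z • e) h, RingHom.id_apply, ← TensorProduct.tmul_smul]
        rfl }
  map_add' x y := LinearMap.ext fun e => by
    obtain ⟨⟨r, a⟩, ha⟩ := exists_ringInt_eq p x
    obtain ⟨⟨s, b⟩, hb⟩ := exists_ringInt_eq p y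
    have ha' : ((((p : RingInt p L) ^ s * a : RingInt p L)) : L) = (p : L) ^ (r + s) * x := by
      rw [map_mul, map_pow, map_natCast, ha, pow_add]; ring
    have hb' : ((((p : RingInt p L) ^ r * b : RingInt p L)) : L) = (p : L) ^ (r + s) * y := by
      rw [map_mul, map_pow, map_natCast, hb, pow_add]; ring
    have hab : (((p : RingInt p L) ^ s * a + (p : RingInt p L) ^ r * b : RingInt p L) : L)
        = (p : L) ^ (r + s) * (x + y) := by
      rw [mul_add, ← ha', ← hb', map_add]
    change divisFun p (x + y) e = divisFun p x e + divisFun p y e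
    rw [divisFun_eq p e ha', divisFun_eq p e hb', divisFun_eq p e hab, TensorProduct.add_tmul]
  map_smul' c x := LinearMap.ext fun e => by
    obtain ⟨⟨r, a⟩, ha⟩ := exists_ringInt_eq p x
    have hc : ((c * a : RingInt p L) : L) = (p : L) ^ r * (c • x) := by
      rw [Algebra.smul_def, map_mul, ha]; ring
    change divisFun p (c • x) e = c • divisFun p x e
    rw [divisFun_eq p e ha, divisFun_eq p e hc]
    rfl

theorem intSubmodule_le_ker : intSubmodule p L ≤ LinearMap.ker (divisPairing p L) := by
  rintro _ ⟨x, rfl⟩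
  refine LinearMap.mem_ker.2 (LinearMap.ext fun e => ?_)
  change divisFun p (x : L) e = 0
  have h0 : e.1 0 = 0 := by simpa using e.2.1 0
  rw [divisFun_eq p e (r := 0) (a := x) (by simp), h0, TensorProduct.tmul_zero]

/-- The pairing `divisPairing` on `Kbar / 𝒪_Kbar`. -/
def divisQuot : (L ⧸ intSubmodule p L) →ₗ[RingInt p L]
    Zp1 p L →ₗ[ℤ_[p]] RingInt p L ⊗[ℤ_[p]] Mu p L :=
  Submodule.liftQ (R₂ := RingInt p L) (τ₁₂ := RingHom.id (RingInt p L))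
    (M₂ := Zp1 p L →ₗ[ℤ_[p]] RingInt p L ⊗[ℤ_[p]] Mu p L)
    (intSubmodule p L) (divisPairing p L) (intSubmodule_le_ker p L)

/-- The canonical map `(Kbar / 𝒪_Kbar) ⊗ ℤ_p(1) → 𝒪_Kbar ⊗ μ_{p^∞}`, sending the class of
`(a / p ^ r) ⊗ ε` to `a ⊗ ε_r` for `a ∈ 𝒪_Kbar`. -/
def divis : (L ⧸ intSubmodule p L) ⊗[ℤ_[p]] Zp1 p L →ₗ[RingInt p L]
    RingInt p L ⊗[ℤ_[p]] Mu p L :=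
  TensorProduct.AlgebraTensorModule.lift (divisQuot p L)

end Divis

section DlogBar

variable (p : ℕ) [Fact p.Prime] (Kbar : Type*) [NormedField Kbar] [NormedAlgebra ℚ_[p] Kbar]
  [Algebra ℤ_[p] Kbar] [IsScalarTower ℤ_[p] ℚ_[p] Kbar]
  (K : Type*) [Field K] [Algebra ℚ_[p] K] [FiniteDimensional ℚ_[p] K]
  [Algebra ℤ_[p] K] [IsScalarTower ℤ_[p] ℚ_[p] K] [Algebra K Kbar] [IsScalarTower ℚ_[p] K Kbar]

/-- The map `dlog : (Kbar / 𝒪_Kbar) ⊗ ℤ_p(1) → Ω¹`. -/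
def dlog [IsAlgClosure K Kbar] :
    (Kbar ⧸ intSubmodule p Kbar) ⊗[ℤ_[p]] Zp1 p Kbar →ₗ[RingInt p Kbar] Omega p Kbar K :=
  haveI : Algebra.IsAlgebraic K Kbar := IsAlgClosure.isAlgebraic
  haveI : Algebra.IsAlgebraic ℚ_[p] Kbar := Algebra.IsAlgebraic.trans ℚ_[p] K Kbar
  dlogTensor p Kbar K ∘ₗ divis p Kbar

/-- The projection `(Kbar / 𝒪_Kbar) ⊗ ℤ_p(1) → (Kbar / I_K) ⊗ ℤ_p(1)`. -/
def projFracIdeal : (Kbar ⧸ intSubmodule p Kbar) ⊗[ℤ_[p]] Zp1 p Kbar →ₗ[RingInt p Kbar]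
    (Kbar ⧸ fracIdeal p Kbar K) ⊗[ℤ_[p]] Zp1 p Kbar :=
  TensorProduct.AlgebraTensorModule.map
    (Submodule.factor (intSubmodule_le_fracIdeal p Kbar K)) LinearMap.id

/-- `ℂ_K`, the completion of `Kbar`. -/
abbrev CK (L : Type*) [NormedField L] : Type _ := UniformSpace.Completion L

variable {p} in
instance uniformContinuousConstSMul_padicInt : UniformContinuousConstSMul ℤ_[p] Kbar :=
  ⟨fun c => by
    have : (fun x : Kbar => c • x) = fun x => algebraMap ℤ_[p] Kbar c • x :=
      funext fun x => by rw [smul_eq_mul, Algebra.smul_def]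
    change UniformContinuous (fun x : Kbar => c • x)
    rw [this]
    exact uniformContinuous_const_smul _⟩

/-- `ℂ_K(1) = ℂ_K ⊗ ℤ_p(1)`. -/
abbrev CK1 : Type _ := CK Kbar ⊗[ℤ_[p]] Zp1 p Kbar

end DlogBar

/-! ### Galois actions -/

section Galois

variable (p : ℕ) [Fact p.Prime] {Kbar : Type*} [Field Kbar]
  [Algebra ℤ_[p] Kbar] {K : Type*} [Field K] [Algebra ℤ_[p] K] [Algebra K Kbar]
  [IsScalarTower ℤ_[p] K Kbar]

/-- The action of `σ ∈ Gal(Kbar / K)` on `μ_{p^∞}`. -/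
def galMu (σ : Kbar ≃ₐ[K] Kbar) : Mu p Kbar →ₗ[ℤ_[p]] Mu p Kbar :=
  Mu.toLinearMap <| MonoidHom.toAdditive <|
    ((Units.map (σ : Kbar →* Kbar)).comp (CommGroup.primaryComponent Kbarˣ p).subtype).codRestrict
      (CommGroup.primaryComponent Kbarˣ p) fun x => by
        obtain ⟨n, hn⟩ := x.2
        refine ⟨n, ?_⟩
        change (Units.map (σ : Kbar →* Kbar) (x : Kbarˣ)) ^ p ^ n = 1
        rw [← map_pow, hn, map_one]

/-- The action of `σ ∈ Gal(Kbar / K)` on `ℤ_p(1)`. -/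
def galZp1 (σ : Kbar ≃ₐ[K] Kbar) : Zp1 p Kbar →ₗ[ℤ_[p]] Zp1 p Kbar :=
  TateModule.map (galMu p σ)

theorem isIntegral_map (σ : Kbar ≃ₐ[K] Kbar) (x : RingInt p Kbar) :
    IsIntegral ℤ_[p] (σ (x : Kbar)) :=
  x.isIntegral.map (σ.toAlgHom.restrictScalars ℤ_[p])

/-- The restriction of `σ ∈ Gal(Kbar / K)` to `𝒪_Kbar`. -/
def galInt (σ : Kbar ≃ₐ[K] Kbar) : RingInt p Kbar →ₐ[RingInt p K] RingInt p Kbar where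
  toFun x := RingInt.mk (σ x) (isIntegral_map p σ x)
  map_one' := RingInt.ext (by simp)
  map_mul' x y := RingInt.ext (by simp)
  map_zero' := RingInt.ext (by simp)
  map_add' x y := RingInt.ext (by simp)
  commutes' x := RingInt.ext (σ.commutes (x : K))

/-- `Ω¹`, with `𝒪_Kbar` acting through `σ`. -/
def OmegaTwist (_σ : Kbar ≃ₐ[K] Kbar) : Type _ := Omega p Kbar K

instance (σ : Kbar ≃ₐ[K] Kbar) : AddCommGroup (OmegaTwist p σ) :=
  inferInstanceAs (AddCommGroup (Omega p Kbar K))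

instance (σ : Kbar ≃ₐ[K] Kbar) : Module (RingInt p K) (OmegaTwist p σ) :=
  inferInstanceAs (Module (RingInt p K) (Omega p Kbar K))

instance (σ : Kbar ≃ₐ[K] Kbar) : Module (RingInt p Kbar) (OmegaTwist p σ) :=
  Module.compHom (Omega p Kbar K) (galInt p σ : RingInt p Kbar →+* RingInt p Kbar)

/-- The identity map, from the twisted module to `Ω¹`. -/
def OmegaTwist.equiv (σ : Kbar ≃ₐ[K] Kbar) : OmegaTwist p σ ≃ₗ[RingInt p K] Omega p Kbar K :=
  LinearEquiv.refl _ _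

theorem OmegaTwist.equiv_smul (σ : Kbar ≃ₐ[K] Kbar) (a : RingInt p Kbar) (ω : OmegaTwist p σ) :
    OmegaTwist.equiv p σ (a • ω) = galInt p σ a • OmegaTwist.equiv p σ ω := rfl

instance (σ : Kbar ≃ₐ[K] Kbar) : IsScalarTower (RingInt p K) (RingInt p Kbar) (OmegaTwist p σ) :=
  ⟨fun a b ω => (OmegaTwist.equiv p σ).injective <| by
    rw [OmegaTwist.equiv_smul, (galInt p σ).map_smul_of_tower, smul_assoc,
      (OmegaTwist.equiv p σ).map_smul, OmegaTwist.equiv_smul]⟩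

/-- The derivation `b ↦ d(σ b)` into the twisted module. -/
def galDerivation (σ : Kbar ≃ₐ[K] Kbar) :
    Derivation (RingInt p K) (RingInt p Kbar) (OmegaTwist p σ) :=
  Derivation.mk' ((OmegaTwist.equiv p σ).symm.toLinearMap ∘ₗ
      (KaehlerDifferential.D (RingInt p K) (RingInt p Kbar)).toLinearMap ∘ₗ
      (galInt p σ).toLinearMap) fun a b => (OmegaTwist.equiv p σ).injective <| by
    rw [map_add, OmegaTwist.equiv_smul, OmegaTwist.equiv_smul]
    simp

/-- The action of `σ ∈ Gal(Kbar / K)` on `Ω¹`, given by `σ (a • db) = σ a • d(σ b)`. -/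
def galOmega (σ : Kbar ≃ₐ[K] Kbar) : Omega p Kbar K →ₗ[ℤ_[p]] Omega p Kbar K :=
  ((OmegaTwist.equiv p σ).toLinearMap ∘ₗ
    ((galDerivation p σ).liftKaehlerDifferential.restrictScalars (RingInt p K))).restrictScalars
      ℤ_[p]

theorem galOmega_smul_D (σ : Kbar ≃ₐ[K] Kbar) (a b : RingInt p Kbar) :
    galOmega p σ (a • KaehlerDifferential.D (RingInt p K) (RingInt p Kbar) b) =
      galInt p σ a • KaehlerDifferential.D (RingInt p K) (RingInt p Kbar) (galInt p σ b) := by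
  change OmegaTwist.equiv p σ ((galDerivation p σ).liftKaehlerDifferential _) = _
  rw [map_smul, Derivation.liftKaehlerDifferential_comp_D, OmegaTwist.equiv_smul]
  rfl

/-- The action of `σ ∈ Gal(Kbar / K)` on `V_p(Ω¹)`. -/
def galVOmega (σ : Kbar ≃ₐ[K] Kbar) : VTate p (Omega p Kbar K) →ₗ[ℤ_[p]] VTate p (Omega p Kbar K) :=
  (TateModule.map (galOmega p σ)).rTensor ℚ_[p]

end Galois

end FontaineDifferentials

end

open FontaineDifferentials

/-!
The module `Ω¹` of `𝒪_Kbar` over `𝒪_K` is computed from the finite extensions `L / ℚ_p` inside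
`Kbar`. The ring of integers of each `L` is monogenic, `𝒪_L = ℤ_p[α]`
(`exists_adjoin_ringInt_eq_top`), so that `Ω¹` of `𝒪_L` over `ℤ_p` is cyclic with annihilator
`(f'(α))`, `f` the minimal polynomial of `α` (`smul_D_eq_zero_iff_of_adjoin_eq_top`). Since differents
multiply in towers, the annihilator of the differential of a generator of `𝒪_F` for a subfield `F` is
the different of `F` (`smul_D_algebraMap_eq_zero_iff`). For the cyclotomic fields this says that
`a dζ_r = 0` if and only if `v(a) ≥ r - 1 / (p - 1)` (`smul_D_primitiveRoot_eq_zero_iff`).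

Fix a generator `ε` of `ℤ_p(1)`. A cyclic torsion module over a valuation ring is self-injective; as
the annihilator of `dε_r` shrinks to zero when `r` grows, each `dx` is a multiple of `dlog ε_r` for
large `r`, say `dx = p ^ r y dlog ε_r` (`IsDlogCoeff.exists_of_isIntegral`), and `y` is well defined
modulo the elements of valuation at least `-1 / (p - 1)`. Hence `a / p ^ r ↦ a dlog ε_r` is a
surjection `Kbar → Ω¹` (`dlogHom`), while `x ↦ y` is a `ℤ_p`-derivation (`exists_dlogDerivation`). To
pass from `ℤ_p` to `𝒪_K = ℤ_p[β]` one kills the coefficient of `dβ`, and this coefficient generates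
`I_K` modulo the elements of valuation at least `-1 / (p - 1)`
(`IsDlogCoeff.exists_mul_or_norm_le`); here the different of `K` over `ℚ_p` agrees with that over
the maximal unramified subextension (`differentIdeal_eq_different`). So the derivation induces a
left inverse of `Kbar / I_K → Ω¹`, which gives the first isomorphism. It shows in particular that
`Ω¹` is torsion and divisible, since the `dlog ε_r` are torsion and `p dlog ε_(r+1) = dlog ε_r`.

As for the Tate module, an element `(t_r)_r` with `t_r` the image of `y_r ∈ Kbar` satisfies
`p y_(r+1) - y_r ∈ I_K`, so that `p ^ r y_r` converges in `ℂ_K`. The resulting map `T_p(Ω¹) → ℂ_K` is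
injective, as `I_K` is a closed ball, and its image contains the unit ball; therefore `ℂ_K` is the
localization `V_p(Ω¹)` (`isLocalizedModule_tateLimit`). The formula for the isomorphism on
integral elements implies the equivariance, because Galois automorphisms are isometries.

For the surjectivity of `d`, solve `β ^ q + p ^ n β = α` with `q` a large power of `p`. If `dα` is
killed by a small power of `p`, then `d(β ^ q) = 0`, so elements killed by `d` are dense
(`exists_D_eq_zero_add_pow_mul`). In `v dt` one may thus replace `v` by an element `u` with `du = 0`,
and then `v dt = d(ut)`.
-/

noncomputable section

set_option linter.unusedSectionVars false

namespace FontaineDifferentials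

open KaehlerDifferential Polynomial

/-! ### Kähler differentials of monogenic algebras -/

section Monogenic

variable {R S : Type*} [CommRing R] [CommRing S] [Algebra R S]

theorem exists_aeval_eq_of_adjoin_eq_top {α : S} (hα : Algebra.adjoin R {α} = ⊤) (x : S) :
    ∃ q : R[X], aeval α q = x := by
  have hx : x ∈ Algebra.adjoin R {α} := hα ▸ Algebra.mem_top
  rwa [Algebra.adjoin_singleton_eq_range_aeval, AlgHom.mem_range] at hx

theorem exists_D_eq_smul_of_adjoin_eq_top {α : S} (hα : Algebra.adjoin R {α} = ⊤) (x : S) :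
    ∃ c : S, D R S x = c • D R S α := by
  obtain ⟨q, rfl⟩ := exists_aeval_eq_of_adjoin_eq_top hα x
  exact ⟨aeval α (derivative q), Derivation.map_aeval _ _ _⟩

/-- On a monogenic algebra `S = R[α]`, with `f` the minimal polynomial of `α`, there is an
`R`-derivation to `S / (f'(α))` with `q(α) ↦ q'(α)`. -/
theorem exists_derivation_quotient [IsDomain R] [IsDomain S] [IsIntegrallyClosed R]
    [Module.IsTorsionFree R S] {α : S} (hint : IsIntegral R α) (hα : Algebra.adjoin R {α} = ⊤) :
    ∃ d : Derivation R S (S ⧸ Ideal.span {aeval α (derivative (minpoly R α))}), d α = 1 := by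
  set I := Ideal.span {aeval α (derivative (minpoly R α))}
  have hwd : ∀ q : R[X], aeval α q = 0 → aeval α (derivative q) ∈ I := fun q hq => by
    obtain ⟨h, rfl⟩ := minpoly.isIntegrallyClosed_dvd hint hq
    rw [derivative_mul, map_add, map_mul, map_mul, minpoly.aeval, zero_mul, add_zero]
    exact Ideal.mul_mem_right _ _ (Ideal.mem_span_singleton_self _)
  choose g hg using exists_aeval_eq_of_adjoin_eq_top hα
  have key : ∀ q : R[X], Ideal.Quotient.mk I (aeval α (derivative (g (aeval α q)))) =
      Ideal.Quotient.mk I (aeval α (derivative q)) := fun q => by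
    rw [Ideal.Quotient.eq, ← map_sub, ← derivative_sub]
    exact hwd _ (by rw [map_sub, hg, sub_self])
  let l : S →ₗ[R] S ⧸ I :=
    { toFun := fun x => Ideal.Quotient.mk I (aeval α (derivative (g x)))
      map_add' := fun x y => by
        have := key (g x + g y)
        rw [map_add, hg, hg] at this
        rw [this, derivative_add, map_add, map_add]
      map_smul' := fun r x => by
        have := key (r • g x)
        rw [map_smul, hg] at this
        rw [this, derivative_smul, map_smul, RingHom.id_apply]
        rfl }
  refine ⟨Derivation.mk' l fun x y => ?_, ?_⟩
  · have := key (g x * g y)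
    rw [map_mul, hg, hg] at this
    change Ideal.Quotient.mk I _ = x • Ideal.Quotient.mk I _ + y • Ideal.Quotient.mk I _
    rw [this, derivative_mul, map_add, map_mul, map_mul, hg, hg, add_comm, map_add, mul_comm _ y]
    rfl
  · have := key X
    rw [aeval_X] at this
    change Ideal.Quotient.mk I _ = 1
    rw [this, derivative_X, map_one, map_one]

/-- `Ω¹` of a monogenic algebra `R[α]` is cyclic, and its annihilator is generated by `f'(α)`, where
`f` is the minimal polynomial of `α`. -/
theorem smul_D_eq_zero_iff_of_adjoin_eq_top [IsDomain R] [IsDomain S] [IsIntegrallyClosed R]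
    [Module.IsTorsionFree R S] {α : S} (hint : IsIntegral R α) (hα : Algebra.adjoin R {α} = ⊤)
    (c : S) : c • D R S α = 0 ↔ aeval α (derivative (minpoly R α)) ∣ c := by
  constructor
  · intro h
    obtain ⟨d, hd⟩ := exists_derivation_quotient hint hα
    have h1 := congrArg d.liftKaehlerDifferential h
    rw [map_smul, Derivation.liftKaehlerDifferential_comp_D, hd, map_zero] at h1
    have h2 : Ideal.Quotient.mk (Ideal.span {aeval α (derivative (minpoly R α))}) c = 0 := by
      rw [← h1, Algebra.smul_def, mul_one]; rfl
    rwa [Ideal.Quotient.eq_zero_iff_mem, Ideal.mem_span_singleton] at h2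
  · rintro ⟨b, rfl⟩
    rw [mul_comm, mul_smul, ← Derivation.map_aeval, minpoly.aeval, map_zero, smul_zero]

/-- For a tower `S / T / R` and `α ∈ S`, the differential of `P(α)` with `P ∈ T[X]` is
`P'(α) dα` up to a combination of differentials from `T`. -/
theorem D_aeval_sub_mem_span {T : Type*} [CommRing T] [Algebra R T] [Algebra T S]
    [IsScalarTower R T S] (α : S) (P : T[X]) :
    D R S (aeval α P) - aeval α (derivative P) • D R S α ∈
      Submodule.span S (Set.range fun t : T => D R S (algebraMap T S t)) := by
  induction P using Polynomial.induction_on' with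
  | add P Q hP hQ =>
    rw [map_add, map_add, derivative_add, map_add, add_smul, add_sub_add_comm]
    exact add_mem hP hQ
  | monomial n t =>
    rw [aeval_monomial, derivative_monomial, aeval_monomial, Derivation.leibniz,
      Derivation.leibniz_pow, map_mul, map_natCast, mul_assoc, mul_smul, mul_smul,
      Nat.cast_smul_eq_nsmul, add_sub_cancel_left]
    exact Submodule.smul_mem _ _ (Submodule.subset_span ⟨t, rfl⟩)

theorem span_range_D_eq {T : Type*} [CommRing T] [Algebra R T] [Algebra T S]
    [IsScalarTower R T S] {β : T} (hβ : Algebra.adjoin R {β} = ⊤) :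
    Submodule.span S (Set.range fun t : T => D R S (algebraMap T S t)) =
      Submodule.span S {D R S (algebraMap T S β)} := by
  refine le_antisymm (Submodule.span_le.2 ?_) (Submodule.span_mono ?_)
  · rintro _ ⟨t, rfl⟩
    obtain ⟨q, rfl⟩ := exists_aeval_eq_of_adjoin_eq_top hβ t
    change D R S (algebraMap T S _) ∈ _
    rw [← aeval_algebraMap_apply, Derivation.map_aeval]
    exact Submodule.smul_mem _ _ (Submodule.mem_span_singleton_self _)
  · rintro _ rfl
    exact ⟨β, rfl⟩

end Monogenic

/-! ### Rings of integers of finite extensions of `ℚ_p` -/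

section FiniteLevel

variable (p : ℕ) [Fact p.Prime]

section

variable (L : Type*) [Field L] [Algebra ℚ_[p] L] [Algebra ℤ_[p] L] [IsScalarTower ℤ_[p] ℚ_[p] L]

theorem algebraMap_padicInt_injective : Function.Injective (algebraMap ℤ_[p] L) := by
  rw [IsScalarTower.algebraMap_eq ℤ_[p] ℚ_[p] L]
  exact (algebraMap ℚ_[p] L).injective.comp (IsFractionRing.injective ℤ_[p] ℚ_[p])

instance isTorsionFree_padicInt_ringInt : Module.IsTorsionFree ℤ_[p] (RingInt p L) :=
  Module.isTorsionFree_iff_algebraMap_injective.2 fun _ _ h =>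
    algebraMap_padicInt_injective p L (by
      rw [IsScalarTower.algebraMap_apply ℤ_[p] (RingInt p L) L, h,
        ← IsScalarTower.algebraMap_apply])

instance : CharZero (RingInt p L) :=
  charZero_of_injective_algebraMap (R := ℤ_[p])
    (Module.isTorsionFree_iff_algebraMap_injective.1 inferInstance)

instance : Algebra.IsIntegral ℤ_[p] (RingInt p L) := IsIntegralClosure.isIntegral_algebra ℤ_[p] L

instance faithfulSMul_padicInt_ringInt : FaithfulSMul ℤ_[p] (RingInt p L) :=
  (faithfulSMul_iff_algebraMap_injective _ _).2
    (Module.isTorsionFree_iff_algebraMap_injective.1 inferInstance)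

variable {p L} in
theorem aeval_derivative_minpoly_ne_zero (x : RingInt p L) :
    aeval x (derivative (minpoly ℤ_[p] x)) ≠ 0 := fun h => by
  have hx : IsIntegral ℤ_[p] x := Algebra.IsIntegral.isIntegral x
  have h0 := eq_zero_of_dvd_of_degree_lt (minpoly.isIntegrallyClosed_dvd hx h)
    (degree_derivative_lt (minpoly.ne_zero hx))
  exact (minpoly.natDegree_pos hx).ne' (derivative_eq_zero.1 h0)

variable [FiniteDimensional ℚ_[p] L]

instance : Module.Finite ℤ_[p] (RingInt p L) := IsIntegralClosure.finite ℤ_[p] ℚ_[p] L _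

instance : IsFractionRing (RingInt p L) L :=
  IsIntegralClosure.isFractionRing_of_finite_extension ℤ_[p] ℚ_[p] L _

end

section

variable (F E : Type*) [Field F] [Field E] [Algebra ℤ_[p] F] [Algebra ℤ_[p] E] [Algebra F E]
  [IsScalarTower ℤ_[p] F E]

/-- For `E / F`, the inclusion `𝒪_F → E`. Not an instance: for `E = F` it is not syntactically the
inclusion `𝒪_F → F`. -/
abbrev algebraRingIntField : Algebra (RingInt p F) E :=
  ((algebraMap F E).comp (algebraMap (RingInt p F) F)).toAlgebra

attribute [local instance 10] algebraRingIntField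

theorem isScalarTower_ringInt_field : IsScalarTower (RingInt p F) F E :=
  IsScalarTower.of_algebraMap_eq fun _ => rfl

theorem isScalarTower_ringInt_ringInt : IsScalarTower (RingInt p F) (RingInt p E) E :=
  IsScalarTower.of_algebraMap_eq fun _ => rfl

theorem isScalarTower_padicInt_ringInt_field : IsScalarTower ℤ_[p] (RingInt p F) E :=
  have := isScalarTower_ringInt_field p F E
  IsScalarTower.of_algebraMap_eq fun x => by
    rw [IsScalarTower.algebraMap_apply (RingInt p F) F E, ← IsScalarTower.algebraMap_apply ℤ_[p]
      (RingInt p F) F, ← IsScalarTower.algebraMap_apply]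

end

/-! ### The different in a tower of finite extensions of `ℚ_p` -/

section Tower

variable (F E : Type*) [Field F] [Algebra ℚ_[p] F] [FiniteDimensional ℚ_[p] F] [Algebra ℤ_[p] F]
  [IsScalarTower ℤ_[p] ℚ_[p] F] [Field E] [Algebra ℚ_[p] E] [FiniteDimensional ℚ_[p] E]
  [Algebra ℤ_[p] E] [IsScalarTower ℤ_[p] ℚ_[p] E] [Algebra F E] [IsScalarTower ℚ_[p] F E]

attribute [local instance 10] algebraRingIntField
attribute [local instance] isScalarTower_ringInt_field
  isScalarTower_ringInt_ringInt isScalarTower_padicInt_ringInt_field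

theorem isIntegralClosure_ringInt : IsIntegralClosure (RingInt p E) (RingInt p F) E :=
  IsIntegralClosure.tower_top (R := ℤ_[p])

instance finite_ringInt : Module.Finite (RingInt p F) (RingInt p E) :=
  Module.Finite.of_restrictScalars_finite ℤ_[p] _ _

attribute [local instance] isIntegralClosure_ringInt FractionRing.liftAlgebra
  FractionRing.isScalarTower_liftAlgebra

theorem differentIdeal_ringInt_tower :
    differentIdeal ℤ_[p] (RingInt p E) = differentIdeal (RingInt p F) (RingInt p E) *
      (differentIdeal ℤ_[p] (RingInt p F)).map (algebraMap (RingInt p F) (RingInt p E)) := by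
  have : FiniteDimensional (FractionRing ℤ_[p]) (FractionRing (RingInt p E)) :=
    .of_isLocalization ℤ_[p] (RingInt p E) (nonZeroDivisors ℤ_[p])
  have : CharZero (FractionRing ℤ_[p]) :=
    charZero_of_injective_algebraMap (R := ℤ_[p]) (IsFractionRing.injective _ _)
  have : Algebra.IsSeparable (FractionRing ℤ_[p]) (FractionRing (RingInt p E)) :=
    Algebra.IsAlgebraic.isSeparable_of_perfectField
  exact differentIdeal_eq_differentIdeal_mul_differentIdeal ℤ_[p] (RingInt p F) (RingInt p E)

variable {p E}

theorem adjoin_field_eq_top_of_adjoin_eq_top {α : RingInt p E}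
    (hα : Algebra.adjoin ℤ_[p] {α} = ⊤) :
    Algebra.adjoin F {algebraMap (RingInt p E) E α} = ⊤ := by
  refine eq_top_iff.2 fun x _ => ?_
  have hx : IsAlgebraic ℤ_[p] x :=
    (IsFractionRing.isAlgebraic_iff ℤ_[p] ℚ_[p] E).2 (Algebra.IsAlgebraic.isAlgebraic x)
  obtain ⟨z, hz, hi⟩ := hx.exists_integral_multiple
  obtain ⟨q, hq⟩ := exists_aeval_eq_of_adjoin_eq_top hα (RingInt.mk (z • x) hi)
  have hz' : algebraMap ℤ_[p] F z ≠ 0 := fun h =>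
    hz (algebraMap_padicInt_injective p F (by rw [h, map_zero]))
  have hx' : x = (algebraMap ℤ_[p] F z)⁻¹ •
      aeval (algebraMap (RingInt p E) E α) (q.map (algebraMap ℤ_[p] F)) := by
    rw [aeval_map_algebraMap, aeval_algebraMap_apply, hq, RingInt.coe_mk,
      ← algebraMap_smul F z x, inv_smul_smul₀ hz']
  rw [hx']
  exact Subalgebra.smul_mem _ (aeval_mem_adjoin_singleton _ _) _

theorem differentIdeal_padicInt_eq_span {α : RingInt p E}
    (hα : Algebra.adjoin ℤ_[p] {α} = ⊤) : differentIdeal ℤ_[p] (RingInt p E) =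
      Ideal.span {aeval α (derivative (minpoly ℤ_[p] α))} := by
  rw [← conductor_mul_differentIdeal ℤ_[p] ℚ_[p] E α
    (adjoin_field_eq_top_of_adjoin_eq_top ℚ_[p] hα), conductor_eq_top_of_adjoin_eq_top hα,
    Ideal.top_mul]

theorem adjoin_ringInt_eq_top_of_adjoin_eq_top {α : RingInt p E}
    (hα : Algebra.adjoin ℤ_[p] {α} = ⊤) : Algebra.adjoin (RingInt p F) {α} = ⊤ :=
  eq_top_iff.2 fun x _ => by
    obtain ⟨q, rfl⟩ := exists_aeval_eq_of_adjoin_eq_top hα x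
    rw [← aeval_map_algebraMap (RingInt p F)]
    exact aeval_mem_adjoin_singleton _ _

theorem differentIdeal_ringInt_eq_span {α : RingInt p E}
    (hα : Algebra.adjoin ℤ_[p] {α} = ⊤) : differentIdeal (RingInt p F) (RingInt p E) =
      Ideal.span {aeval α (derivative (minpoly (RingInt p F) α))} := by
  have : FiniteDimensional F E := FiniteDimensional.right ℚ_[p] F E
  have : CharZero F := charZero_of_injective_algebraMap (algebraMap ℚ_[p] F).injective
  rw [← conductor_mul_differentIdeal (RingInt p F) F E α
    (adjoin_field_eq_top_of_adjoin_eq_top F hα),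
    conductor_eq_top_of_adjoin_eq_top (adjoin_ringInt_eq_top_of_adjoin_eq_top F hα), Ideal.top_mul]

variable {F}

/-- The differential of a generator `β` of `𝒪_F` generates, in `Ω¹` of `𝒪_E` over `ℤ_p`, a
submodule whose annihilator is generated by the different of `F`. If `f`, `h` and `k` are the
minimal polynomials of `α` over `ℤ_p`, of `α` over `𝒪_F` and of `β` over `ℤ_p`, then `f'(α)` and
`h'(α) k'(β)` generate the same ideal, while `h'(α) dα` is a multiple of `dβ`. -/
theorem smul_D_algebraMap_eq_zero_iff {α : RingInt p E} (hα : Algebra.adjoin ℤ_[p] {α} = ⊤)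
    {β : RingInt p F} (hβ : Algebra.adjoin ℤ_[p] {β} = ⊤) (a : RingInt p E) :
    a • D ℤ_[p] (RingInt p E) (algebraMap (RingInt p F) (RingInt p E) β) = 0 ↔
      algebraMap (RingInt p F) (RingInt p E) (aeval β (derivative (minpoly ℤ_[p] β))) ∣ a := by
  constructor
  · intro ha
    set f := aeval α (derivative (minpoly ℤ_[p] α)) with hf
    set h := aeval α (derivative (minpoly (RingInt p F) α)) with hh
    set k := algebraMap (RingInt p F) (RingInt p E) (aeval β (derivative (minpoly ℤ_[p] β)))
    -- transitivity of the different
    have hfhk : h * k ∣ f := by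
      have h1 := differentIdeal_ringInt_tower p F E
      rw [differentIdeal_padicInt_eq_span hα, differentIdeal_padicInt_eq_span hβ,
        differentIdeal_ringInt_eq_span F hα, Ideal.map_span, Set.image_singleton,
        Ideal.span_singleton_mul_span_singleton] at h1
      exact Ideal.span_singleton_le_span_singleton.1 h1.le
    -- `h'(α) dα` lies in the span of `dβ`
    have hmem : h • D ℤ_[p] (RingInt p E) α ∈
        Submodule.span (RingInt p E) {D ℤ_[p] (RingInt p E)
          (algebraMap (RingInt p F) (RingInt p E) β)} := by
      rw [← span_range_D_eq hβ]
      have := D_aeval_sub_mem_span (R := ℤ_[p]) α (minpoly (RingInt p F) α)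
      rw [minpoly.aeval, map_zero, zero_sub] at this
      exact neg_mem_iff.1 this
    obtain ⟨y, hy⟩ := Submodule.mem_span_singleton.1 hmem
    have h2 : (a * h) • D ℤ_[p] (RingInt p E) α = 0 := by
      rw [mul_smul, ← hy, smul_comm, ha, smul_zero]
    rw [smul_D_eq_zero_iff_of_adjoin_eq_top (Algebra.IsIntegral.isIntegral α) hα] at h2
    have h3 := hfhk.trans h2
    have h0 : f ≠ 0 := aeval_derivative_minpoly_ne_zero α
    have h0' : h ≠ 0 := by
      rintro h00
      rw [h00, zero_mul, zero_dvd_iff] at hfhk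
      exact h0 hfhk
    rw [mul_comm a] at h3
    exact (mul_dvd_mul_iff_left h0').1 h3
  · rintro ⟨b, rfl⟩
    rw [mul_comm, mul_smul, ← aeval_algebraMap_apply, ← Derivation.map_aeval,
      aeval_algebraMap_apply, minpoly.aeval, map_zero, map_zero, smul_zero]

end Tower
end FiniteLevel

/-! ### The norm and integrality -/

section Norm

variable {p : ℕ} [Fact p.Prime] {L : Type*} [NormedField L] [NormedAlgebra ℚ_[p] L]
  [Algebra.IsAlgebraic ℚ_[p] L] [Algebra ℤ_[p] L] [IsScalarTower ℤ_[p] ℚ_[p] L]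

/-- An element of norm at most one is integral: the norm is the spectral norm, so the minimal polynomial
has integral coefficients. -/
theorem isIntegral_of_norm_le_one {x : L} (hx : ‖x‖ ≤ 1) : IsIntegral ℤ_[p] x := by
  have hint : IsIntegral ℚ_[p] x := Algebra.IsIntegral.isIntegral x
  have hm := minpoly.monic hint
  have hs : spectralValue (minpoly ℚ_[p] x) ≤ 1 := by
    rwa [NormedAlgebra.norm_eq_spectralNorm ℚ_[p] x] at hx
  have hc := (spectralValue_le_one_iff hm).1 hs
  have hl : minpoly ℚ_[p] x ∈ Polynomial.lifts (algebraMap ℤ_[p] ℚ_[p]) := by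
    rw [Polynomial.lifts_iff_coeff_lifts]
    exact fun n => ⟨⟨_, hc n⟩, rfl⟩
  obtain ⟨q, hq, -, hqm⟩ := Polynomial.lifts_and_natDegree_eq_and_monic hl hm
  refine ⟨q, hqm, ?_⟩
  rw [IsScalarTower.algebraMap_eq ℤ_[p] ℚ_[p] L, ← eval₂_map, hq]
  exact minpoly.aeval _ _

theorem dvd_iff_norm_le {a b : RingInt p L} :
    a ∣ b ↔ ‖algebraMap (RingInt p L) L b‖ ≤ ‖algebraMap (RingInt p L) L a‖ := by
  constructor
  · rintro ⟨c, rfl⟩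
    rw [map_mul, norm_mul]
    exact mul_le_of_le_one_right (norm_nonneg _) (norm_ringInt_le_one p c)
  · intro h
    rcases eq_or_ne (algebraMap (RingInt p L) L a) 0 with ha | ha
    · rw [ha, norm_zero, norm_le_zero_iff] at h
      exact ⟨0, RingInt.ext (by rw [h, mul_zero, map_zero])⟩
    · refine ⟨RingInt.mk (algebraMap (RingInt p L) L b / algebraMap (RingInt p L) L a)
        (isIntegral_of_norm_le_one ?_), RingInt.ext ?_⟩
      · rw [norm_div]
        exact div_le_one_of_le₀ h (norm_nonneg _)
      · rw [map_mul, RingInt.coe_mk, mul_div_cancel₀ _ ha]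

end Norm

section Local

variable (p : ℕ) [Fact p.Prime] (L : Type*) [Field L] [Algebra ℚ_[p] L]
  [FiniteDimensional ℚ_[p] L] [Algebra ℤ_[p] L] [IsScalarTower ℤ_[p] ℚ_[p] L]

instance valuationRing_ringInt : ValuationRing (RingInt p L) := by
  let : NormedField L := spectralNorm.normedField ℚ_[p] L
  let : NormedAlgebra ℚ_[p] L := spectralNorm.normedAlgebra ℚ_[p] L
  rw [ValuationRing.iff_dvd_total]
  refine ⟨fun a b => ?_⟩
  have h1 := dvd_iff_norm_le (a := a) (b := b)
  have h2 := dvd_iff_norm_le (a := b) (b := a)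
  rw [h1, h2]
  exact le_total _ _

open IsLocalRing

/-- The ring of integers of a finite extension of `ℚ_p` is monogenic over `ℤ_p`. Let `g` lift the
minimal polynomial of a primitive element of the residue field. A lift `c` of this element such that
`g(c)` is a uniformizer generates the ring; if `b` is any lift and `ϖ` a uniformizer, then `b` or
`b + ϖ` has this property. -/
theorem exists_adjoin_ringInt_eq_top : ∃ β : RingInt p L, Algebra.adjoin ℤ_[p] {β} = ⊤ := by
  let S := RingInt p L
  obtain ⟨ϖ, hϖ⟩ : ∃ ϖ : S, maximalIdeal S = Ideal.span {ϖ} :=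
    (IsPrincipalIdealRing.principal (maximalIdeal S)).principal
  obtain ⟨β₀, hβ₀⟩ := Field.exists_primitive_element (ResidueField ℤ_[p]) (ResidueField S)
  obtain ⟨b, hb⟩ := residue_surjective (R := S) β₀
  have hint : IsIntegral (ResidueField ℤ_[p]) β₀ := Algebra.IsIntegral.isIntegral β₀
  obtain ⟨g, hg⟩ := Polynomial.map_surjective _ (residue_surjective (R := ℤ_[p]))
    (minpoly (ResidueField ℤ_[p]) β₀)
  have hres : ∀ (q : ℤ_[p][X]) (c : S), residue S (aeval c q) =
      aeval (residue S c) (q.map (residue ℤ_[p])) := fun q c =>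
    map_aeval_eq_aeval_map (ψ := residue S) (φ := residue ℤ_[p]) rfl q c
  have hmem : ∀ {x : S}, x ∈ maximalIdeal S ↔ ϖ ∣ x := by
    intro x
    rw [hϖ, Ideal.mem_span_singleton]
  -- a lift `c` of the primitive element such that `g(c)` is a uniformizer
  obtain ⟨c, hc, hgc⟩ : ∃ c : S, residue S c = β₀ ∧ ∃ u : S, IsUnit u ∧ aeval c g = ϖ * u := by
    obtain ⟨t, ht⟩ : ϖ ∣ aeval b g := by
      rw [← hmem, ← residue_eq_zero_iff, hres, hg, hb, minpoly.aeval]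
    by_cases htu : IsUnit t
    · exact ⟨b, hb, t, htu, ht⟩
    have hd : IsUnit (aeval b (derivative g)) := by
      rw [← residue_ne_zero_iff_isUnit, hres, ← derivative_map, hg, hb]
      exact (Algebra.IsSeparable.isSeparable _ _).aeval_derivative_ne_zero (minpoly.aeval _ _)
    obtain ⟨k, hk⟩ := Polynomial.binomExpansion (g.map (algebraMap ℤ_[p] S)) b ϖ
    rw [derivative_map, eval_map_algebraMap, eval_map_algebraMap, eval_map_algebraMap] at hk
    refine ⟨b + ϖ, ?_, aeval b (derivative g) + (t + k * ϖ), ?_, ?_⟩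
    · rw [map_add, hb, (residue_eq_zero_iff ϖ).2 (hmem.2 dvd_rfl), add_zero]
    · rw [← residue_ne_zero_iff_isUnit, map_add,
        (residue_eq_zero_iff (t + k * ϖ)).2 (add_mem htu (hmem.2 (dvd_mul_left _ _))), add_zero]
      exact (residue_ne_zero_iff_isUnit _).2 hd
    · rw [hk, ht]; ring
  obtain ⟨u, hu, hgu⟩ := hgc
  have hp0 : (p : S) ≠ 0 := Nat.cast_ne_zero.2 (Fact.out : p.Prime).ne_zero
  have hpm : algebraMap ℤ_[p] S p ∈ maximalIdeal S := fun h =>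
    PadicInt.irreducible_p.not_isUnit (isUnit_of_map_unit (algebraMap ℤ_[p] S) _ h)
  have hne : maximalIdeal S ≠ ⊥ := fun h => hp0 (by
    rw [h, Ideal.mem_bot, map_natCast] at hpm
    exact hpm)
  have : IsDiscreteValuationRing S := { not_a_field' := hne }
  have hirr : Irreducible ϖ := (IsDiscreteValuationRing.irreducible_iff_uniformizer ϖ).2 hϖ
  obtain ⟨e, he⟩ := IsDiscreteValuationRing.associated_pow_irreducible hp0 hirr
  refine ⟨c, ?_⟩
  -- every element is a polynomial in `c` up to a multiple of `ϖ ^ n`, for every `n`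
  have happrox : ∀ n : ℕ, ∀ x : S, ∃ q : ℤ_[p][X], ϖ ^ n ∣ x - aeval c q := by
    intro n
    induction n with
    | zero => exact fun x => ⟨0, by simp⟩
    | succ n ih =>
      intro x
      have hx : residue S x ∈ Algebra.adjoin (ResidueField ℤ_[p]) {β₀} := by
        rw [← IntermediateField.adjoin_simple_toSubalgebra_of_isAlgebraic
          (IsAlgebraic.of_finite _ _), hβ₀]
        trivial
      rw [Algebra.adjoin_singleton_eq_range_aeval, AlgHom.mem_range] at hx
      obtain ⟨q₀, hq₀⟩ := hx
      obtain ⟨q, rfl⟩ := Polynomial.map_surjective _ (residue_surjective (R := ℤ_[p])) q₀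
      obtain ⟨y, hy⟩ : ϖ ∣ x - aeval c q := by
        rw [← hmem, ← residue_eq_zero_iff, map_sub, hres, hc, hq₀, sub_self]
      obtain ⟨v, hv⟩ := hu.exists_right_inv
      obtain ⟨r, z, hz⟩ := ih (v * y)
      refine ⟨q + g * r, u * z, ?_⟩
      rw [map_add, map_mul, hgu, sub_add_eq_sub_sub, hy]
      calc ϖ * y - ϖ * u * aeval c r = ϖ * u * (v * y - aeval c r) + ϖ * y * (1 - u * v) := by ring
        _ = ϖ ^ (n + 1) * (u * z) := by rw [hz, hv]; ring
  -- for `n = e`, where `p` generates the ideal of `ϖ ^ e`, this is the hypothesis of Nakayama's lemma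
  refine eq_top_iff.2 (Submodule.le_of_le_smul_of_le_jacobson_bot
    (Module.finite_def.1 (inferInstanceAs (Module.Finite ℤ_[p] S)))
    (maximalIdeal_le_jacobson ⊥)
    (?_ : ⊤ ≤ (Algebra.adjoin ℤ_[p] {c}).toSubmodule ⊔ maximalIdeal ℤ_[p] • ⊤))
  intro x _
  obtain ⟨q, hq⟩ := happrox e x
  refine Submodule.mem_sup.2 ⟨aeval c q, aeval_mem_adjoin_singleton _ _, x - aeval c q, ?_,
    by ring⟩
  obtain ⟨z, hz⟩ := he.dvd.trans hq
  have : x - aeval c q = (p : ℤ_[p]) • z := by rw [hz, Algebra.smul_def, map_natCast]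
  rw [this]
  refine Submodule.smul_mem_smul ?_ trivial
  exact PadicInt.irreducible_p.not_isUnit

end Local

/-! ### Cyclotomic extensions of `ℚ_p` -/

section Cyclotomic

variable (p : ℕ) [hp : Fact p.Prime] (n : ℕ)

theorem monic_cyclotomic_comp_X_add_one (R : Type*) [CommRing R] [Nontrivial R] (m : ℕ) :
    ((cyclotomic m R).comp (X + 1)).Monic := by
  rw [← C_1]
  exact (cyclotomic.monic m R).comp (monic_X_add_C 1) (by rw [natDegree_X_add_C]; exact one_ne_zero)

theorem isEisensteinAt_cyclotomic_padicInt :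
    ((cyclotomic (p ^ (n + 1)) ℤ_[p]).comp (X + 1)).IsEisensteinAt
      (Submodule.span ℤ_[p] {(p : ℤ_[p])}) := by
  have hmap : (cyclotomic (p ^ (n + 1)) ℤ_[p]).comp (X + 1) =
      ((cyclotomic (p ^ (n + 1)) ℤ).comp (X + 1)).map (Int.castRingHom ℤ_[p]) := by
    rw [Polynomial.map_comp, map_cyclotomic, Polynomial.map_add, map_X, Polynomial.map_one]
  refine (monic_cyclotomic_comp_X_add_one ℤ_[p] _).isEisensteinAt_of_mem_of_notMem ?_ ?_ ?_
  · exact fun h => PadicInt.irreducible_p.not_isUnit (Ideal.span_singleton_eq_top.1 h)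
  · intro i hi
    rw [hmap, (monic_cyclotomic_comp_X_add_one ℤ _).natDegree_map] at hi
    have := (cyclotomic_prime_pow_comp_X_add_one_isEisensteinAt p n).mem hi
    obtain ⟨c, hc⟩ := Ideal.mem_span_singleton.1 this
    rw [hmap, coeff_map, hc]
    exact Ideal.mem_span_singleton.2 ⟨(c : ℤ_[p]), by simp⟩
  · rw [coeff_zero_eq_eval_zero, eval_comp, eval_add, eval_X, eval_one, zero_add,
      eval_one_cyclotomic_prime_pow]
    intro h
    rw [Ideal.submodule_span_eq, Ideal.span_singleton_pow, Ideal.mem_span_singleton] at h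
    have h0 := PadicInt.irreducible_p (p := p)
    rw [sq, mul_comm] at h
    exact h0.not_isUnit (isUnit_of_dvd_one ((mul_dvd_mul_iff_left h0.ne_zero).1 (by simpa using h)))

theorem irreducible_cyclotomic_comp_padicInt :
    Irreducible ((cyclotomic (p ^ (n + 1)) ℤ_[p]).comp (X + 1)) := by
  refine (isEisensteinAt_cyclotomic_padicInt p n).irreducible ?_
    (monic_cyclotomic_comp_X_add_one _ _).isPrimitive ?_
  · exact (Ideal.span_singleton_prime PadicInt.prime_p.ne_zero).2 PadicInt.prime_p
  · have := natDegree_comp (p := cyclotomic (p ^ (n + 1)) ℤ_[p]) (q := X + 1)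
    rw [this, natDegree_cyclotomic, ← C_1, natDegree_X_add_C, mul_one]
    exact Nat.totient_pos.2 (pow_pos hp.out.pos _)

variable {p n} {F : Type*} [Field F] [Algebra ℚ_[p] F] [Algebra ℤ_[p] F]
  [IsScalarTower ℤ_[p] ℚ_[p] F]

theorem isIntegral_sub_one {ζ : F} (hζ : IsPrimitiveRoot ζ (p ^ (n + 1))) :
    IsIntegral ℤ_[p] (ζ - 1) :=
  (hζ.isIntegral (pow_pos hp.out.pos _)).tower_top.sub isIntegral_one

theorem minpoly_sub_one_eq {ζ : F} (hζ : IsPrimitiveRoot ζ (p ^ (n + 1))) :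
    minpoly ℤ_[p] (ζ - 1) = (cyclotomic (p ^ (n + 1)) ℤ_[p]).comp (X + 1) := by
  have hint := isIntegral_sub_one hζ
  have : CharZero F := charZero_of_injective_algebraMap (algebraMap ℚ_[p] F).injective
  have : Module.IsTorsionFree ℤ_[p] F :=
    Module.isTorsionFree_iff_algebraMap_injective.2 (algebraMap_padicInt_injective p F)
  have h0 : aeval (ζ - 1) ((cyclotomic (p ^ (n + 1)) ℤ_[p]).comp (X + 1)) = 0 := by
    rw [aeval_comp, map_add, aeval_X, map_one, sub_add_cancel, ← eval_map_algebraMap,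
      map_cyclotomic]
    exact hζ.isRoot_cyclotomic (pow_pos hp.out.pos _)
  exact eq_of_monic_of_associated (minpoly.monic hint) (monic_cyclotomic_comp_X_add_one _ _)
    (((irreducible_cyclotomic_comp_padicInt p n).dvd_iff.1
      (minpoly.isIntegrallyClosed_dvd hint h0)).resolve_left (minpoly.not_isUnit ℤ_[p] _)).symm

theorem minpoly_primitiveRoot_eq {ζ : F} (hζ : IsPrimitiveRoot ζ (p ^ (n + 1))) :
    minpoly ℤ_[p] ζ = cyclotomic (p ^ (n + 1)) ℤ_[p] := by
  have hint : IsIntegral ℤ_[p] ζ := (hζ.isIntegral (pow_pos hp.out.pos _)).tower_top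
  have : CharZero F := charZero_of_injective_algebraMap (algebraMap ℚ_[p] F).injective
  have : Module.IsTorsionFree ℤ_[p] F :=
    Module.isTorsionFree_iff_algebraMap_injective.2 (algebraMap_padicInt_injective p F)
  have h0 : aeval ζ (cyclotomic (p ^ (n + 1)) ℤ_[p]) = 0 := by
    rw [← eval_map_algebraMap, map_cyclotomic]
    exact hζ.isRoot_cyclotomic (pow_pos hp.out.pos _)
  have h1 : minpoly ℤ_[p] (ζ - 1) ∣ (minpoly ℤ_[p] ζ).comp (X + 1) :=
    minpoly.isIntegrallyClosed_dvd (isIntegral_sub_one hζ) (by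
      rw [aeval_comp, map_add, aeval_X, map_one, sub_add_cancel, minpoly.aeval])
  have hm := minpoly.monic hint
  refine (eq_of_monic_of_dvd_of_natDegree_le hm (cyclotomic.monic _ _)
    (minpoly.isIntegrallyClosed_dvd hint h0) ?_).symm
  rw [minpoly_sub_one_eq hζ] at h1
  have hX : (X + 1 : ℤ_[p][X]) = X + C 1 := by rw [C_1]
  have h2 := natDegree_le_of_dvd h1 (by
    rw [hX]; exact (hm.comp (monic_X_add_C 1) (by rw [natDegree_X_add_C]; exact one_ne_zero)).ne_zero)
  rwa [hX, natDegree_comp, natDegree_comp, natDegree_X_add_C, mul_one, mul_one] at h2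

/-- The ring of integers of `ℚ_p(ζ)` is `ℤ_p[ζ]`, since the minimal polynomial of `ζ - 1` is
Eisenstein. -/
theorem adjoin_primitiveRoot_eq_top [FiniteDimensional ℚ_[p] F] {ζ : RingInt p F}
    (hζ : IsPrimitiveRoot (algebraMap (RingInt p F) F ζ) (p ^ (n + 1)))
    (hF : Algebra.adjoin ℚ_[p] {algebraMap (RingInt p F) F ζ} = ⊤) :
    Algebra.adjoin ℤ_[p] {ζ} = ⊤ := by
  have hint := isIntegral_sub_one hζ
  set x : F := algebraMap (RingInt p F) F ζ - 1
  have hx : algebraMap (RingInt p F) F (ζ - 1) = x := by rw [map_sub, map_one]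
  have hadj : Algebra.adjoin ℚ_[p] {x} = ⊤ := by
    rw [eq_top_iff, ← hF, Algebra.adjoin_le_iff, Set.singleton_subset_iff]
    have : algebraMap (RingInt p F) F ζ = x + 1 := by simp [x]
    rw [this]
    exact add_mem (Algebra.self_mem_adjoin_singleton _ _) (one_mem _)
  let B := PowerBasis.ofAdjoinEqTop (Algebra.IsIntegral.isIntegral (R := ℚ_[p]) x) hadj
  have hB : B.gen = x := PowerBasis.ofAdjoinEqTop_gen _ _
  have hmem : ∀ z : RingInt p F, (z : F) ∈ Algebra.adjoin ℤ_[p] {x} := fun z => by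
    have hz : (z : F) ∈ Algebra.adjoin ℚ_[p] {x} := hadj ▸ Algebra.mem_top
    rw [Algebra.adjoin_singleton_eq_range_aeval, AlgHom.mem_range] at hz
    obtain ⟨q, hq⟩ := hz
    obtain ⟨b, hbm, hb⟩ := IsLocalization.integerNormalization_spec (nonZeroDivisors ℤ_[p]) q
    have hb0 : b ≠ 0 := nonZeroDivisors.ne_zero hbm
    have hu := PadicInt.unitCoeff_spec hb0
    have hbz : b • (z : F) ∈ Algebra.adjoin ℤ_[p] {x} := by
      rw [← hq, ← (aeval x : ℚ_[p][X] →ₐ[ℚ_[p]] F).toLinearMap_apply, ← LinearMap.map_smul_of_tower,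
        ← hb, AlgHom.toLinearMap_apply, aeval_map_algebraMap]
      exact aeval_mem_adjoin_singleton _ _
    have hpz : (p : ℤ_[p]) ^ b.valuation • (z : F) ∈ Algebra.adjoin ℤ_[p] {x} := by
      have : (p : ℤ_[p]) ^ b.valuation =
          (((PadicInt.unitCoeff hb0)⁻¹ : ℤ_[p]ˣ) : ℤ_[p]) * b := by
        rw [Units.eq_inv_mul_iff_mul_eq, ← hu]
      rw [this, mul_smul]
      exact Subalgebra.smul_mem _ hbz _
    have := mem_adjoin_of_smul_prime_pow_smul_of_minpoly_isEisensteinAt (B := B)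
      PadicInt.prime_p (by rw [hB]; exact hint) z.isIntegral (by rw [hB]; exact hpz)
      (by rw [hB, minpoly_sub_one_eq hζ]; exact isEisensteinAt_cyclotomic_padicInt p n)
    rwa [hB] at this
  refine eq_top_iff.2 fun z _ => ?_
  obtain ⟨q, hq⟩ := (AlgHom.mem_range _).1
    (by simpa only [Algebra.adjoin_singleton_eq_range_aeval] using hmem z)
  have : z = aeval (ζ - 1) q := RingInt.ext (by
    rw [← hq, ← hx, aeval_algebraMap_apply])
  rw [this]
  have h1 : ζ - 1 ∈ Algebra.adjoin ℤ_[p] {ζ} :=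
    sub_mem (Algebra.self_mem_adjoin_singleton _ _) (one_mem _)
  exact Algebra.adjoin_le (Set.singleton_subset_iff.2 h1)
    (aeval_mem_adjoin_singleton ℤ_[p] _)

variable (p) in
theorem norm_natCast_self (N : Type*) [NormedField N] [NormedAlgebra ℚ_[p] N] :
    ‖(p : N)‖ = (p : ℝ)⁻¹ := by
  rw [← map_natCast (algebraMap ℚ_[p] N), norm_algebraMap', Padic.norm_p]

/-- The norm of `ζ - 1` is determined by the constant term `p` of its minimal polynomial, which has degree
`p - 1`. -/
theorem norm_sub_one_of_primitiveRoot {N : Type*} [NormedField N] [NormedAlgebra ℚ_[p] N]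
    [Algebra.IsAlgebraic ℚ_[p] N] [Algebra ℤ_[p] N] [IsScalarTower ℤ_[p] ℚ_[p] N] {ζ : N}
    (hζ : IsPrimitiveRoot ζ p) : ‖ζ - 1‖ = (p : ℝ) ^ (-(1 / ((p : ℝ) - 1))) := by
  have hζ' : IsPrimitiveRoot ζ (p ^ (0 + 1)) := by simpa using hζ
  rw [NormedAlgebra.norm_eq_spectralNorm ℚ_[p], spectralNorm.spectralNorm_eq_norm_coeff_zero_rpow,
    minpoly.isIntegrallyClosed_eq_field_fractions' ℚ_[p] (isIntegral_sub_one hζ'),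
    minpoly_sub_one_eq hζ', (monic_cyclotomic_comp_X_add_one _ _).natDegree_map, coeff_map,
    coeff_zero_eq_eval_zero, eval_comp, eval_add, eval_X, eval_one, zero_add,
    eval_one_cyclotomic_prime_pow, natDegree_comp, natDegree_cyclotomic, ← C_1, natDegree_X_add_C,
    zero_add, pow_one, Nat.totient_prime hp.out, mul_one, map_natCast, Padic.norm_p,
    Nat.cast_sub hp.out.one_le, Nat.cast_one, Real.inv_rpow (Nat.cast_nonneg p),
    Real.rpow_neg (Nat.cast_nonneg p)]

/-- The different of `ℚ_p(ζ)`, obtained by differentiating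
`Φ(X) (X ^ (p ^ n) - 1) = X ^ (p ^ (n + 1)) - 1` at `ζ`. -/
theorem norm_derivative_cyclotomic {N : Type*} [NormedField N] [NormedAlgebra ℚ_[p] N]
    [Algebra.IsAlgebraic ℚ_[p] N] [Algebra ℤ_[p] N] [IsScalarTower ℤ_[p] ℚ_[p] N] {ζ : N}
    (hζ : IsPrimitiveRoot ζ (p ^ (n + 1))) :
    ‖eval ζ (derivative (cyclotomic (p ^ (n + 1)) N))‖ =
      (p : ℝ) ^ (1 / ((p : ℝ) - 1) - (n + 1)) := by
  have h1 := congr_arg (fun q => eval ζ (derivative q)) (cyclotomic_prime_pow_mul_X_pow_sub_one N p n)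
  simp only [derivative_mul, eval_add, eval_mul, derivative_sub, derivative_X_pow, derivative_one,
    eval_sub, eval_pow, eval_X, eval_one, sub_zero, eval_C] at h1
  have h2 : eval ζ (cyclotomic (p ^ (n + 1)) N) = 0 :=
    hζ.isRoot_cyclotomic (pow_pos hp.out.pos _)
  have hp0 : (0 : ℝ) < p := Nat.cast_pos.2 hp.out.pos
  have h3 : IsPrimitiveRoot (ζ ^ p ^ n) p :=
    hζ.pow (pow_pos hp.out.pos _) (pow_succ p n)
  have h4 : ‖ζ‖ = 1 := (pow_eq_one_iff_of_nonneg (norm_nonneg ζ) (pow_pos hp.out.pos (n + 1)).ne').1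
    (by rw [← norm_pow, hζ.pow_eq_one, norm_one])
  rw [h2, zero_mul, add_zero] at h1
  have h5 := congrArg norm h1
  rw [norm_mul, norm_mul, norm_pow, h4, one_pow, mul_one, norm_sub_one_of_primitiveRoot h3,
    Nat.cast_pow, norm_pow, norm_natCast_self] at h5
  rw [Real.rpow_sub hp0, eq_div_iff (Real.rpow_pos_of_pos hp0 _).ne']
  rw [Real.rpow_neg hp0.le, ← div_eq_mul_inv, div_eq_iff (Real.rpow_pos_of_pos hp0 _).ne', inv_pow,
    inv_mul_eq_div, eq_div_iff (pow_pos hp0 _).ne'] at h5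
  rw [← h5]
  norm_cast

end Cyclotomic

/-! ### Finite levels of an algebraic extension of `ℚ_p` -/

section SelfInjective

variable {p : ℕ} [Fact p.Prime] {L : Type*} [Field L] [Algebra ℚ_[p] L]
  [FiniteDimensional ℚ_[p] L] [Algebra ℤ_[p] L] [IsScalarTower ℤ_[p] ℚ_[p] L]

/-- The module `Ω¹` of `𝒪_L` over `ℤ_p` is a cyclic torsion module over a valuation ring, hence
`dx` is a multiple of `dz` as soon as it is killed by the annihilator of `dz`. -/
theorem exists_D_eq_smul_D {x z : RingInt p L}
    (h : ∀ c : RingInt p L, c • D ℤ_[p] (RingInt p L) z = 0 → c • D ℤ_[p] (RingInt p L) x = 0) :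
    ∃ b : RingInt p L, D ℤ_[p] (RingInt p L) x = b • D ℤ_[p] (RingInt p L) z := by
  obtain ⟨α, hα⟩ := exists_adjoin_ringInt_eq_top p L
  have hann := smul_D_eq_zero_iff_of_adjoin_eq_top (Algebra.IsIntegral.isIntegral (R := ℤ_[p]) α) hα
  have hδ := aeval_derivative_minpoly_ne_zero α
  set δ := aeval α (derivative (minpoly ℤ_[p] α))
  obtain ⟨y, hy⟩ := exists_D_eq_smul_of_adjoin_eq_top hα z
  obtain ⟨x', hx'⟩ := exists_D_eq_smul_of_adjoin_eq_top hα x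
  rcases ValuationRing.dvd_total δ y with hd | ⟨c, hc⟩
  · have := h 1 (by rw [one_smul, hy, hann]; exact hd)
    exact ⟨0, by rw [zero_smul, ← this, one_smul]⟩
  · have h1 := h c (by rw [hy, smul_smul, hann, hc, mul_comm])
    rw [hx', smul_smul, hann, hc, mul_comm y] at h1
    have hc0 : c ≠ 0 := by
      rintro rfl
      exact hδ (by rw [hc, mul_zero])
    obtain ⟨b, hb⟩ := (mul_dvd_mul_iff_left hc0).1 h1
    exact ⟨b, by rw [hx', hy, smul_smul, hb, mul_comm]⟩

end SelfInjective

section Levels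

variable {p : ℕ} [hp : Fact p.Prime] {N : Type*} [NormedField N] [NormedAlgebra ℚ_[p] N]
  [Algebra.IsAlgebraic ℚ_[p] N] [Algebra ℤ_[p] N] [IsScalarTower ℤ_[p] ℚ_[p] N]

theorem exists_ringInt_level_eq (L : IntermediateField ℚ_[p] N) {x : N} (hx : IsIntegral ℤ_[p] x)
    (hL : x ∈ L) : ∃ x' : RingInt p L, ((x' : L) : N) = x :=
  ⟨RingInt.mk ⟨x, hL⟩ ((isIntegral_algHom_iff (IsScalarTower.toAlgHom ℤ_[p] L N)
    (algebraMap L N).injective).1 hx), rfl⟩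

theorem ringInt_level_ext {L : IntermediateField ℚ_[p] N} {x y : RingInt p L}
    (h : ((x : L) : N) = ((y : L) : N)) : x = y :=
  RingInt.ext (Subtype.ext h)

/-- The inclusion of `𝒪_L` into the ambient field. -/
def levelHom (L : IntermediateField ℚ_[p] N) : RingInt p L →ₐ[ℤ_[p]] N :=
  (IsScalarTower.toAlgHom ℤ_[p] L N).comp (IsScalarTower.toAlgHom ℤ_[p] (RingInt p L) L)

theorem minpoly_level (L : IntermediateField ℚ_[p] N) (x : RingInt p L) :
    minpoly ℤ_[p] ((x : L) : N) = minpoly ℤ_[p] x :=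
  minpoly.algHom_eq (levelHom L) (fun _ _ h => ringInt_level_ext h) x

theorem coe_aeval_level (L : IntermediateField ℚ_[p] N) (x : RingInt p L) (q : ℤ_[p][X]) :
    ((aeval x q : RingInt p L) : L) = aeval ((x : L) : N) q :=
  (aeval_algHom_apply (levelHom L) x q).symm

theorem dvd_iff_norm_le_level {L : IntermediateField ℚ_[p] N} {a b : RingInt p L} :
    a ∣ b ↔ ‖((b : L) : N)‖ ≤ ‖((a : L) : N)‖ :=
  dvd_iff_norm_le (L := L)

/-- In `Ω¹` of `𝒪_L` over `ℤ_p`, the annihilator of the differential of a generator of the ring of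
integers of a subfield is the different of that subfield. -/
theorem smul_D_eq_zero_iff_norm_le (F : Type*) [Field F] [Algebra ℚ_[p] F]
    [FiniteDimensional ℚ_[p] F] [Algebra ℤ_[p] F] [IsScalarTower ℤ_[p] ℚ_[p] F] [Algebra F N]
    [IsScalarTower ℚ_[p] F N] {L : IntermediateField ℚ_[p] N} [FiniteDimensional ℚ_[p] L]
    (hL : ∀ x : F, algebraMap F N x ∈ L) {β : RingInt p F} (hβ : Algebra.adjoin ℤ_[p] {β} = ⊤)
    {b : RingInt p L} (hb : ((b : L) : N) = algebraMap F N β) (a : RingInt p L) :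
    a • D ℤ_[p] (RingInt p L) b = 0 ↔
      ‖((a : L) : N)‖ ≤ ‖algebraMap F N (aeval β (derivative (minpoly ℤ_[p] β)) : RingInt p F)‖ := by
  let i : F →ₐ[ℚ_[p]] L :=
    (IsScalarTower.toAlgHom ℚ_[p] F N).codRestrict L.toSubalgebra hL
  let : Algebra F L := i.toRingHom.toAlgebra
  have : IsScalarTower ℚ_[p] F L := IsScalarTower.of_algebraMap_eq fun x => (i.commutes x).symm
  obtain ⟨α, hα⟩ := exists_adjoin_ringInt_eq_top p L
  have hbβ : b = algebraMap (RingInt p F) (RingInt p L) β := ringInt_level_ext hb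
  rw [hbβ, smul_D_algebraMap_eq_zero_iff hα hβ, dvd_iff_norm_le_level]
  rfl

/-- The annihilator of `dζ` for a primitive root of unity `ζ` of order `p ^ (n + 1)` consists of
the elements of valuation at least `n + 1 - 1 / (p - 1)`. -/
theorem smul_D_primitiveRoot_eq_zero_iff {L : IntermediateField ℚ_[p] N} [FiniteDimensional ℚ_[p] L]
    {n : ℕ} {z : RingInt p L} (hz : IsPrimitiveRoot ((z : L) : N) (p ^ (n + 1)))
    (a : RingInt p L) : a • D ℤ_[p] (RingInt p L) z = 0 ↔
      ‖((a : L) : N)‖ ≤ (p : ℝ) ^ (1 / ((p : ℝ) - 1) - (n + 1)) := by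
  set ζ : N := ((z : L) : N) with hζ
  have hint : IsIntegral ℚ_[p] ζ := Algebra.IsIntegral.isIntegral ζ
  let F := IntermediateField.adjoin ℚ_[p] {ζ}
  have : FiniteDimensional ℚ_[p] F := IntermediateField.adjoin.finiteDimensional hint
  have hζF : ζ ∈ F := IntermediateField.mem_adjoin_simple_self ℚ_[p] ζ
  obtain ⟨β, hβ⟩ := exists_ringInt_level_eq F (z.isIntegral.algebraMap (B := N)) hζF
  have hβ' : algebraMap F N (algebraMap (RingInt p F) F β) = ζ := hβ
  have hprim : IsPrimitiveRoot (algebraMap (RingInt p F) F β) (p ^ (n + 1)) :=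
    IsPrimitiveRoot.of_map_of_injective (f := algebraMap F N) (by rw [hβ']; exact hz) (algebraMap F N).injective
  have hgen : Algebra.adjoin ℚ_[p] {algebraMap (RingInt p F) F β} = ⊤ := by
    have h1 := (IntermediateField.adjoin.powerBasis hint).adjoin_gen_eq_top
    rw [IntermediateField.adjoin.powerBasis_gen] at h1
    have h2 : algebraMap (RingInt p F) F β = IntermediateField.AdjoinSimple.gen ℚ_[p] ζ :=
      Subtype.ext (by rw [IntermediateField.AdjoinSimple.coe_gen]; exact hβ)
    rwa [h2]
  have hadj := adjoin_primitiveRoot_eq_top hprim hgen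
  have hFL : ∀ x : F, algebraMap F N x ∈ L := by
    have : F ≤ L := by
      rw [IntermediateField.adjoin_simple_le_iff]
      exact (z : L).2
    exact fun x => this x.2
  have hmin : minpoly ℤ_[p] β = cyclotomic (p ^ (n + 1)) ℤ_[p] := by
    rw [← minpoly_primitiveRoot_eq hprim]
    exact (minpoly.algebraMap_eq (IsIntegralClosure.algebraMap_injective (RingInt p F) ℤ_[p] F) β).symm
  rw [smul_D_eq_zero_iff_norm_le F hFL hadj hβ.symm, hmin, ← aeval_algebraMap_apply,
    ← aeval_algebraMap_apply, ← eval_map_algebraMap, ← derivative_map, map_cyclotomic]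
  rw [hβ', norm_derivative_cyclotomic hz]

variable (p) in
theorem norm_pow_mul_le_iff (r : ℕ) (t : ℝ) (y : N) :
    ‖(p : N) ^ r * y‖ ≤ (p : ℝ) ^ (t - r) ↔ ‖y‖ ≤ (p : ℝ) ^ t := by
  have hp0 : (0 : ℝ) < p := Nat.cast_pos.2 hp.out.pos
  rw [norm_mul, norm_pow, norm_natCast_self, Real.rpow_sub hp0, Real.rpow_natCast, inv_pow,
    inv_mul_eq_div, div_le_div_iff_of_pos_right (pow_pos hp0 _)]

/-- Let `ζ_r` be a root of unity of order `p ^ r`. The number `y` is a coefficient of `dx` at the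
level `(L, r)` if `dx = p ^ r y dlog ζ_r` in `Ω¹` of `𝒪_L` over `ℤ_p`, where all of `x`, `ζ_r` and
`p ^ r y` are elements of `𝒪_L`. The equation is written as `ζ_r dx = p ^ r y dζ_r`. -/
def IsDlogCoeff (ζ : ℕ → N) (L : IntermediateField ℚ_[p] N) (r : ℕ) (x y : N) : Prop :=
  ∃ x' z' c : RingInt p L, ((x' : L) : N) = x ∧ ((z' : L) : N) = ζ r ∧
    ((c : L) : N) = (p : N) ^ r * y ∧
      z' • D ℤ_[p] (RingInt p L) x' = c • D ℤ_[p] (RingInt p L) z'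

namespace IsDlogCoeff

variable {ζ : ℕ → N} {L L' : IntermediateField ℚ_[p] N} {r s : ℕ} {x x' y y' : N}

theorem mono_field (h : IsDlogCoeff ζ L r x y) (hL : L ≤ L') : IsDlogCoeff ζ L' r x y := by
  obtain ⟨x', z', c, hx, hz, hc, h⟩ := h
  let : Algebra L L' := (IntermediateField.inclusion hL).toRingHom.toAlgebra
  have : IsScalarTower ℚ_[p] L L' :=
    IsScalarTower.of_algebraMap_eq fun x => ((IntermediateField.inclusion hL).commutes x).symm
  let ι := algebraMap (RingInt p L) (RingInt p L')
  refine ⟨ι x', ι z', ι c, hx, hz, hc, ?_⟩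
  have h1 := congrArg (KaehlerDifferential.map ℤ_[p] ℤ_[p] (RingInt p L) (RingInt p L')) h
  rw [map_smul, map_smul, map_D, map_D] at h1
  rwa [algebraMap_smul, algebraMap_smul]

/-- Since `ζ_r = ζ_(r+1) ^ p`, the equation `dlog ζ_r = p dlog ζ_(r+1)` holds, which explains the
normalization of the coefficient by the factor `p ^ r`. -/
theorem succ (hζ : ∀ n, ζ (n + 1) ^ p = ζ n) (hprim : ∀ n, IsPrimitiveRoot (ζ n) (p ^ n))
    (h : IsDlogCoeff ζ L r x y) (hL : ζ (r + 1) ∈ L) : IsDlogCoeff ζ L (r + 1) x y := by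
  obtain ⟨x', z', c, hx, hz, hc, h⟩ := h
  obtain ⟨w, hw⟩ := exists_ringInt_level_eq L
    (((hprim (r + 1)).isIntegral (pow_pos hp.out.pos _)).tower_top (A := ℤ_[p])) hL
  have hwz : z' = w ^ p := ringInt_level_ext (by rw [hz, ← hζ r, ← hw]; simp)
  have hw1 : w ^ p ^ (r + 1) = 1 := ringInt_level_ext (by
    have := (hprim (r + 1)).pow_eq_one
    rw [← hw] at this
    simpa using this)
  have hu : IsUnit (w ^ p) := (IsUnit.of_pow_eq_one hw1 (pow_pos hp.out.pos _).ne').pow p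
  refine ⟨x', w, p * c, hx, hw, ?_, hu.smul_left_cancel.1 ?_⟩
  · rw [pow_succ, map_mul]
    change ((algebraMap (RingInt p L) L p : L) : N) * ((c : L) : N) = _
    rw [hc, map_natCast]
    push_cast
    ring
  · rw [smul_comm, ← hwz, h, hwz, Derivation.leibniz_pow, ← Nat.cast_smul_eq_nsmul (RingInt p L),
      smul_smul, smul_smul, smul_smul, smul_smul]
    congr 1
    have : w ^ p = w ^ (p - 1) * w := by rw [← pow_succ, Nat.sub_add_cancel hp.out.one_le]
    rw [this]
    ring

theorem mono (hζ : ∀ n, ζ (n + 1) ^ p = ζ n) (hprim : ∀ n, IsPrimitiveRoot (ζ n) (p ^ n))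
    (h : IsDlogCoeff ζ L r x y) (hL : L ≤ L') (hrs : r ≤ s) (hs : ζ s ∈ L') :
    IsDlogCoeff ζ L' s x y := by
  have hmem : ∀ n, n ≤ s → ζ n ∈ L' := fun n hn => by
    obtain ⟨k, rfl⟩ := Nat.exists_eq_add_of_le hn
    clear hrs hn
    induction k with
    | zero => exact hs
    | succ k ih => exact ih (by rw [← hζ]; exact pow_mem hs p)
  obtain ⟨k, rfl⟩ := Nat.exists_eq_add_of_le hrs
  clear hrs hs
  induction k with
  | zero => exact h.mono_field hL
  | succ k ih => exact (ih fun n hn => hmem n (by omega)).succ hζ hprim (hmem _ le_rfl)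

theorem add (h : IsDlogCoeff ζ L r x y) (h' : IsDlogCoeff ζ L r x' y') :
    IsDlogCoeff ζ L r (x + x') (y + y') := by
  obtain ⟨a, z, c, ha, hz, hc, h⟩ := h
  obtain ⟨a', z', c', ha', hz', hc', h'⟩ := h'
  obtain rfl : z = z' := ringInt_level_ext (hz.trans hz'.symm)
  refine ⟨a + a', z, c + c', ?_, hz, ?_, ?_⟩
  · rw [← ha, ← ha', map_add]; rfl
  · rw [mul_add, ← hc, ← hc', map_add]; rfl
  · rw [map_add, smul_add, h, h', add_smul]

theorem mul (h : IsDlogCoeff ζ L r x y) (h' : IsDlogCoeff ζ L r x' y') :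
    IsDlogCoeff ζ L r (x * x') (x * y' + x' * y) := by
  obtain ⟨a, z, c, ha, hz, hc, h⟩ := h
  obtain ⟨a', z', c', ha', hz', hc', h'⟩ := h'
  obtain rfl : z = z' := ringInt_level_ext (hz.trans hz'.symm)
  refine ⟨a * a', z, a * c' + a' * c, ?_, hz, ?_, ?_⟩
  · rw [← ha, ← ha', map_mul]; rfl
  · rw [mul_add, mul_left_comm, mul_left_comm _ x', ← hc, ← hc', ← ha, ← ha', map_add, map_mul,
      map_mul]
    rfl
  · rw [Derivation.leibniz, smul_add, smul_comm, h', smul_comm z a', h, add_smul, mul_smul, mul_smul]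

theorem const (hr : ∃ z : RingInt p L, ((z : L) : N) = ζ r) (a : ℤ_[p]) :
    IsDlogCoeff ζ L r (algebraMap ℤ_[p] N a) 0 := by
  obtain ⟨z, hz⟩ := hr
  refine ⟨algebraMap ℤ_[p] (RingInt p L) a, z, 0, ?_, hz, by simp, by simp⟩
  rw [← IsScalarTower.algebraMap_apply, IsScalarTower.algebraMap_apply ℤ_[p] L N]
  rfl

/-- The coefficients of `dx` at a given level differ by elements of valuation at least `-1 / (p - 1)`. -/
theorem norm_sub_le [FiniteDimensional ℚ_[p] L] (hprim : ∀ n, IsPrimitiveRoot (ζ n) (p ^ n))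
    (hr : r ≠ 0) (h : IsDlogCoeff ζ L r x y) (h' : IsDlogCoeff ζ L r x y') :
    ‖y - y'‖ ≤ (p : ℝ) ^ (1 / ((p : ℝ) - 1)) := by
  obtain ⟨a, z, c, ha, hz, hc, h⟩ := h
  obtain ⟨a', z', c', ha', hz', hc', h'⟩ := h'
  obtain rfl : z = z' := ringInt_level_ext (hz.trans hz'.symm)
  obtain rfl : a = a' := ringInt_level_ext (ha.trans ha'.symm)
  obtain ⟨n, rfl⟩ := Nat.exists_eq_succ_of_ne_zero hr
  have h0 : (c - c') • D ℤ_[p] (RingInt p L) z = 0 := by rw [sub_smul, ← h, ← h', sub_self]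
  rw [smul_D_primitiveRoot_eq_zero_iff (by rw [hz]; exact hprim (n + 1))] at h0
  have h1 : (((c - c' : RingInt p L) : L) : N) = (p : N) ^ (n + 1) * (y - y') := by
    rw [mul_sub, ← hc, ← hc', map_sub]; rfl
  rw [h1] at h0
  exact_mod_cast (norm_pow_mul_le_iff p (n + 1) _ _).1 (by exact_mod_cast h0)

/-- The coefficient of `dζ_r` is `ζ_r / p ^ r`. -/
theorem self (hr : ∃ z : RingInt p L, ((z : L) : N) = ζ r) :
    IsDlogCoeff ζ L r (ζ r) (ζ r / (p : N) ^ r) := by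
  obtain ⟨z, hz⟩ := hr
  have hp0 : (p : N) ^ r ≠ 0 := pow_ne_zero _ (norm_pos_iff.1 (by
    rw [norm_natCast_self]; exact inv_pos.2 (Nat.cast_pos.2 hp.out.pos)))
  exact ⟨z, z, z, hz, hz, by rw [hz, mul_div_cancel₀ _ hp0], rfl⟩

/-- If `r` is large enough for `x`, then `dx` has a coefficient at every level `(L, r)` with `x` and `ζ_r`
in `L`. -/
theorem exists_at_level {x : N} (hx : IsIntegral ℤ_[p] x) :
    ∃ r₀ : ℕ, r₀ ≠ 0 ∧ ∀ r, r₀ ≤ r → IsPrimitiveRoot (ζ r) (p ^ r) →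
      ∀ L : IntermediateField ℚ_[p] N, FiniteDimensional ℚ_[p] L → x ∈ L → ζ r ∈ L →
        ∃ y, IsDlogCoeff ζ L r x y := by
  have hp1 : (1 : ℝ) < p := Nat.one_lt_cast.2 hp.out.one_lt
  have hmin : minpoly ℤ_[p] x = minpoly ℤ_[p] (RingInt.mk x hx) :=
    minpoly.algebraMap_eq (IsIntegralClosure.algebraMap_injective (RingInt p N) ℤ_[p] N)
      (RingInt.mk x hx)
  have hδ : 0 < ‖aeval x (derivative (minpoly ℤ_[p] x))‖ := by
    refine norm_pos_iff.2 fun h => aeval_derivative_minpoly_ne_zero (RingInt.mk x hx)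
      (RingInt.ext ?_)
    rw [← aeval_algebraMap_apply, ← hmin, map_zero]
    exact h
  -- for large `r`, the annihilator of `dζ_r` is contained in that of `dx`
  obtain ⟨m, hm⟩ : ∃ m : ℕ,
      (p : ℝ) ^ (1 / ((p : ℝ) - 1) - m) ≤ ‖aeval x (derivative (minpoly ℤ_[p] x))‖ := by
    have hp0 : (0 : ℝ) < p := zero_lt_one.trans hp1
    obtain ⟨m, hm⟩ := pow_unbounded_of_one_lt
      ((p : ℝ) ^ (1 / ((p : ℝ) - 1)) / ‖aeval x (derivative (minpoly ℤ_[p] x))‖) hp1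
    refine ⟨m, ?_⟩
    rw [Real.rpow_sub hp0, Real.rpow_natCast, div_le_iff₀ (pow_pos hp0 m)]
    rw [div_lt_iff₀ hδ] at hm
    rw [mul_comm]
    exact hm.le
  refine ⟨m + 1, m.succ_ne_zero, fun r hr hprim L hfin hxL hζL => ?_⟩
  obtain ⟨n, rfl⟩ := Nat.exists_eq_succ_of_ne_zero (by omega : r ≠ 0)
  obtain ⟨x', hx'⟩ := exists_ringInt_level_eq L hx hxL
  obtain ⟨z, hz⟩ := exists_ringInt_level_eq L
    ((hprim.isIntegral (pow_pos hp.out.pos _)).tower_top (A := ℤ_[p])) hζL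
  obtain ⟨b, hb⟩ := exists_D_eq_smul_D (x := x') (z := z) fun c hc => by
    rw [smul_D_primitiveRoot_eq_zero_iff (by rw [hz]; exact hprim)] at hc
    obtain ⟨d, rfl⟩ : aeval x' (derivative (minpoly ℤ_[p] x')) ∣ c := by
      rw [dvd_iff_norm_le_level]
      refine (hc.trans ((Real.rpow_le_rpow_of_exponent_le hp1.le ?_).trans hm)).trans_eq ?_
      · have : (m : ℝ) ≤ n + 1 := by exact_mod_cast (by omega : m ≤ n + 1)
        linarith
      · rw [← minpoly_level, coe_aeval_level, hx']
    rw [mul_comm, mul_smul, ← Derivation.map_aeval, minpoly.aeval, map_zero, smul_zero]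
  have hp0 : (p : N) ^ (n + 1) ≠ 0 := pow_ne_zero _ (norm_pos_iff.1 (by
    rw [norm_natCast_self]; exact inv_pos.2 (Nat.cast_pos.2 hp.out.pos)))
  exact ⟨(((z * b : RingInt p L) : L) : N) / (p : N) ^ (n + 1), x', z, z * b, hx', hz,
    (mul_div_cancel₀ _ hp0).symm, by rw [hb, mul_smul]⟩

end IsDlogCoeff

end Levels

/-! ### The derivation dual to `dlog` -/

section DlogDerivation

variable {p : ℕ} [hp : Fact p.Prime] {N : Type*} [NormedField N] [NormedAlgebra ℚ_[p] N]
  [Algebra.IsAlgebraic ℚ_[p] N] [Algebra ℤ_[p] N] [IsScalarTower ℤ_[p] ℚ_[p] N]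

theorem exists_level_ge (L : IntermediateField ℚ_[p] N) [FiniteDimensional ℚ_[p] L] (x : N) :
    ∃ L' : IntermediateField ℚ_[p] N, FiniteDimensional ℚ_[p] L' ∧ L ≤ L' ∧ x ∈ L' := by
  have := IntermediateField.adjoin.finiteDimensional (Algebra.IsIntegral.isIntegral (R := ℚ_[p]) x)
  exact ⟨L ⊔ IntermediateField.adjoin ℚ_[p] {x}, inferInstance, le_sup_left,
    (le_sup_right : _ ≤ L ⊔ _) (IntermediateField.mem_adjoin_simple_self ℚ_[p] x)⟩

variable {ζ : ℕ → N} (hζ : ∀ n, ζ (n + 1) ^ p = ζ n)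
  (hprim : ∀ n, IsPrimitiveRoot (ζ n) (p ^ n))

namespace IsDlogCoeff

include hζ hprim

theorem exists_common_level {L L' : IntermediateField ℚ_[p] N} [FiniteDimensional ℚ_[p] L]
    [FiniteDimensional ℚ_[p] L'] {r r' : ℕ} {x y x' y' : N} (h : IsDlogCoeff ζ L r x y)
    (h' : IsDlogCoeff ζ L' r' x' y') : ∃ L'' : IntermediateField ℚ_[p] N,
      FiniteDimensional ℚ_[p] L'' ∧ ∃ s, s ≠ 0 ∧ IsDlogCoeff ζ L'' s x y ∧
        IsDlogCoeff ζ L'' s x' y' := by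
  obtain ⟨L'', hfin, hL, hs⟩ := exists_level_ge (L ⊔ L') (ζ (r + r' + 1))
  exact ⟨L'', hfin, r + r' + 1, by omega,
    h.mono hζ hprim (le_sup_left.trans hL) (by omega) hs,
    h'.mono hζ hprim (le_sup_right.trans hL) (by omega) hs⟩

theorem norm_sub_le_of_levels {L L' : IntermediateField ℚ_[p] N} [FiniteDimensional ℚ_[p] L]
    [FiniteDimensional ℚ_[p] L'] {r r' : ℕ} {x y y' : N} (h : IsDlogCoeff ζ L r x y)
    (h' : IsDlogCoeff ζ L' r' x y') : ‖y - y'‖ ≤ (p : ℝ) ^ (1 / ((p : ℝ) - 1)) := by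
  obtain ⟨L'', hfin, s, hs, h1, h2⟩ := exists_common_level hζ hprim h h'
  exact h1.norm_sub_le hprim hs h2

omit hζ in
theorem exists_of_isIntegral {x : N} (hx : IsIntegral ℤ_[p] x) (L : IntermediateField ℚ_[p] N)
    [FiniteDimensional ℚ_[p] L] : ∃ L' : IntermediateField ℚ_[p] N,
      FiniteDimensional ℚ_[p] L' ∧ L ≤ L' ∧ ∃ r y, r ≠ 0 ∧ IsDlogCoeff ζ L' r x y := by
  obtain ⟨r, hr0, hr⟩ := exists_at_level (ζ := ζ) hx
  obtain ⟨L₁, hfin₁, hL₁, hx₁⟩ := exists_level_ge L x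
  obtain ⟨L₂, hfin₂, hL₂, hz₂⟩ := exists_level_ge L₁ (ζ r)
  obtain ⟨y, hy⟩ := hr r le_rfl (hprim r) L₂ hfin₂ (hL₂ hx₁) hz₂
  exact ⟨L₂, hfin₂, hL₁.trans hL₂, r, y, hr0, hy⟩

end IsDlogCoeff

include hζ hprim in
/-- The `ℤ_p`-derivation of `𝒪_N` that takes `x` with `dx = p ^ r y dlog ζ_r` to the class of `y`. -/
theorem exists_dlogDerivation (J : Submodule (RingInt p N) N)
    (hJ : ∀ y : N, ‖y‖ ≤ (p : ℝ) ^ (1 / ((p : ℝ) - 1)) → y ∈ J) :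
    ∃ d : Derivation ℤ_[p] (RingInt p N) (N ⧸ J),
      ∀ (L : IntermediateField ℚ_[p] N) (_ : FiniteDimensional ℚ_[p] L) (r : ℕ) (x : RingInt p N)
        (y : N), IsDlogCoeff ζ L r x y → d x = J.mkQ y := by
  choose L hfin _ r y _ hy using fun x : RingInt p N =>
    IsDlogCoeff.exists_of_isIntegral hprim x.isIntegral ⊥
  have huniq : ∀ (L' : IntermediateField ℚ_[p] N) (_ : FiniteDimensional ℚ_[p] L') (r' : ℕ)
      (x : RingInt p N) (y' : N), IsDlogCoeff ζ L' r' x y' → J.mkQ (y x) = J.mkQ y' :=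
    fun L' hfin' r' x y' h' => by
      have := hfin x
      exact (Submodule.Quotient.eq J).2 (hJ _ ((hy x).norm_sub_le_of_levels hζ hprim h'))
  have hadd : ∀ a b : RingInt p N, J.mkQ (y (a + b)) = J.mkQ (y a) + J.mkQ (y b) := fun a b => by
    have := hfin a
    have := hfin b
    obtain ⟨L', hfin', s, -, h1, h2⟩ := (hy a).exists_common_level hζ hprim (hy b)
    rw [← map_add]
    exact huniq L' hfin' s _ _ (by rw [map_add]; exact h1.add h2)
  have hmul : ∀ a b : RingInt p N, J.mkQ (y (a * b)) = a • J.mkQ (y b) + b • J.mkQ (y a) :=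
    fun a b => by
      have := hfin a
      have := hfin b
      obtain ⟨L', hfin', s, -, h1, h2⟩ := (hy a).exists_common_level hζ hprim (hy b)
      rw [← map_smul, ← map_smul, ← map_add]
      refine huniq L' hfin' s _ _ ?_
      rw [map_mul, Algebra.smul_def, Algebra.smul_def]
      exact h1.mul h2
  have hconst : ∀ c : ℤ_[p], J.mkQ (y (algebraMap ℤ_[p] (RingInt p N) c)) = 0 := fun c => by
    rw [← map_zero J.mkQ]
    refine huniq ⊥ inferInstance 0 _ _ ?_
    rw [← IsScalarTower.algebraMap_apply]
    refine IsDlogCoeff.const ⟨1, ?_⟩ c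
    have := hprim 0
    rw [pow_zero, IsPrimitiveRoot.one_right_iff] at this
    rw [this, map_one]
    rfl
  let l : RingInt p N →ₗ[ℤ_[p]] N ⧸ J :=
    { toFun := fun x => J.mkQ (y x)
      map_add' := hadd
      map_smul' := fun c x => by
        rw [Algebra.smul_def, hmul, hconst, smul_zero, add_zero, RingHom.id_apply,
          algebraMap_smul] }
  exact ⟨Derivation.mk' l hmul, fun L' hfin' r' x y' h => huniq L' hfin' r' x y' h⟩

end DlogDerivation

/-! ### The maximal unramified subextension and the ideal `I_K` -/

section Unramified

variable (p : ℕ) [hp : Fact p.Prime]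

theorem formallyUnramified_iff_differentIdeal_eq_top (F : Type*) [Field F] [Algebra ℚ_[p] F]
    [FiniteDimensional ℚ_[p] F] [Algebra ℤ_[p] F] [IsScalarTower ℤ_[p] ℚ_[p] F] :
    Algebra.FormallyUnramified ℤ_[p] (RingInt p F) ↔ differentIdeal ℤ_[p] (RingInt p F) = ⊤ := by
  obtain ⟨β, hβ⟩ := exists_adjoin_ringInt_eq_top p F
  have hann := smul_D_eq_zero_iff_of_adjoin_eq_top
    (Algebra.IsIntegral.isIntegral (R := ℤ_[p]) β) hβ 1
  rw [differentIdeal_padicInt_eq_span hβ, Ideal.span_singleton_eq_top, isUnit_iff_dvd_one, ← hann,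
    one_smul, Algebra.formallyUnramified_iff]
  refine ⟨fun h => Subsingleton.elim _ _, fun h => ?_⟩
  have hD : ∀ x, D ℤ_[p] (RingInt p F) x = 0 := fun x => by
    obtain ⟨c, hc⟩ := exists_D_eq_smul_of_adjoin_eq_top hβ x
    rw [hc, h, smul_zero]
  refine subsingleton_of_forall_eq 0 fun ω => ?_
  have hω : ω ∈ Submodule.span (RingInt p F) (Set.range (D ℤ_[p] (RingInt p F))) := by
    rw [span_range_derivation]; trivial
  rw [Submodule.span_eq_bot.2 (by rintro _ ⟨x, rfl⟩; exact hD x)] at hω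
  exact hω

variable {p}

theorem exists_aeval_eq_of_mem_sup {k K : Type*} [Field k] [Field K] [Algebra k K]
    {L₁ L₂ : IntermediateField k K} [FiniteDimensional k L₁] {g : L₁}
    (hg : Algebra.adjoin k {g} = ⊤) {x : K} (hx : x ∈ L₁ ⊔ L₂) :
    ∃ q : L₂[X], aeval (g : K) q = x := by
  have hle : (L₁ ⊔ L₂).toSubalgebra ≤ (Algebra.adjoin L₂ {(g : K)}).restrictScalars k := by
    rw [IntermediateField.sup_toSubalgebra_of_left]
    refine sup_le (fun x hx => ?_) fun x hx => ?_
    · obtain ⟨q, hq⟩ := exists_aeval_eq_of_adjoin_eq_top hg (⟨x, hx⟩ : L₁)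
      have h1 : aeval (algebraMap L₁ K g) q = x := by rw [aeval_algebraMap_apply, hq]; rfl
      have hx' : x = aeval (g : K) (q.map (algebraMap k L₂)) := by
        rw [aeval_map_algebraMap, ← h1]; rfl
      rw [Subalgebra.mem_restrictScalars, hx']
      exact aeval_mem_adjoin_singleton _ _
    · exact (Algebra.adjoin L₂ {(g : K)}).algebraMap_mem (⟨x, hx⟩ : L₂)
  have hx' : x ∈ Algebra.adjoin L₂ {(g : K)} := (Subalgebra.mem_restrictScalars k).1 (hle hx)
  rwa [Algebra.adjoin_singleton_eq_range_aeval, AlgHom.mem_range] at hx'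

/-- If `E = F(γ)` where `γ` generates the ring of integers of an unramified extension of `ℚ_p`, then
the different of `E / F` is trivial: the minimal polynomial of `γ` over `𝒪_F` divides that over
`ℤ_p`, whose derivative at `γ` is a unit. -/
theorem differentIdeal_eq_top_of_adjoin_eq_top (F E : Type*) [Field F] [Algebra ℚ_[p] F]
    [FiniteDimensional ℚ_[p] F] [Algebra ℤ_[p] F] [IsScalarTower ℤ_[p] ℚ_[p] F] [Field E]
    [Algebra ℚ_[p] E] [FiniteDimensional ℚ_[p] E] [Algebra ℤ_[p] E] [IsScalarTower ℤ_[p] ℚ_[p] E]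
    [Algebra F E] [IsScalarTower ℚ_[p] F E] {γ : RingInt p E}
    (hγ : Algebra.adjoin F {algebraMap (RingInt p E) E γ} = ⊤)
    (hu : IsUnit (aeval γ (derivative (minpoly ℤ_[p] γ)))) :
    differentIdeal (RingInt p F) (RingInt p E) = ⊤ := by
  let := algebraRingIntField p F E
  have := isScalarTower_ringInt_field p F E
  have := isScalarTower_ringInt_ringInt p F E
  have := isIntegralClosure_ringInt p F E
  have : FiniteDimensional F E := FiniteDimensional.right ℚ_[p] F E
  have : CharZero F := charZero_of_injective_algebraMap (algebraMap ℚ_[p] F).injective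
  have hmem := aeval_derivative_mem_differentIdeal (RingInt p F) F E γ hγ
  refine Ideal.eq_top_of_isUnit_mem _ hmem ?_
  have hint : IsIntegral (RingInt p F) γ := Algebra.IsIntegral.isIntegral γ
  obtain ⟨q, hq⟩ := minpoly.isIntegrallyClosed_dvd hint
    (p := (minpoly ℤ_[p] γ).map (algebraMap ℤ_[p] (RingInt p F)))
    (by rw [aeval_map_algebraMap, minpoly.aeval])
  have h1 := congrArg (fun f => aeval γ (derivative f)) hq
  simp only [derivative_map, aeval_map_algebraMap, derivative_mul, map_add, map_mul,
    minpoly.aeval, zero_mul, add_zero] at h1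
  rw [h1] at hu
  exact isUnit_of_mul_isUnit_left hu

variable {K : Type*} [Field K] [Algebra ℚ_[p] K] [FiniteDimensional ℚ_[p] K]
  [Algebra ℤ_[p] K] [IsScalarTower ℤ_[p] ℚ_[p] K]

theorem formallyUnramified_sup {L₁ L₂ : IntermediateField ℚ_[p] K}
    (h₁ : Algebra.FormallyUnramified ℤ_[p] (RingInt p L₁))
    (h₂ : Algebra.FormallyUnramified ℤ_[p] (RingInt p L₂)) :
    Algebra.FormallyUnramified ℤ_[p] (RingInt p ↥(L₁ ⊔ L₂)) := by
  rw [formallyUnramified_iff_differentIdeal_eq_top] at *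
  let E := L₁ ⊔ L₂
  let : Algebra L₁ E := (IntermediateField.inclusion (le_sup_left : L₁ ≤ E)).toRingHom.toAlgebra
  let : Algebra L₂ E := (IntermediateField.inclusion (le_sup_right : L₂ ≤ E)).toRingHom.toAlgebra
  have : IsScalarTower ℚ_[p] L₁ E := IsScalarTower.of_algebraMap_eq fun x => rfl
  have : IsScalarTower ℚ_[p] L₂ E := IsScalarTower.of_algebraMap_eq fun x => rfl
  obtain ⟨γ, hγ⟩ := exists_adjoin_ringInt_eq_top p L₁
  rw [differentIdeal_padicInt_eq_span hγ, Ideal.span_singleton_eq_top] at h₁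
  have htop : differentIdeal (RingInt p L₂) (RingInt p E) = ⊤ := by
    refine differentIdeal_eq_top_of_adjoin_eq_top L₂ E
      (γ := algebraMap (RingInt p L₁) (RingInt p E) γ) ?_ ?_
    · have hγ' := adjoin_field_eq_top_of_adjoin_eq_top ℚ_[p] hγ
      refine eq_top_iff.2 fun x _ => ?_
      obtain ⟨q, hq⟩ := exists_aeval_eq_of_mem_sup hγ' x.2
      have : IsScalarTower L₂ E K := IsScalarTower.of_algebraMap_eq fun x => rfl
      have hx' : x = aeval (algebraMap L₁ E (algebraMap (RingInt p L₁) L₁ γ)) q :=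
        (algebraMap E K).injective (by rw [← aeval_algebraMap_apply]; exact hq.symm)
      rw [hx']
      exact aeval_mem_adjoin_singleton _ _
    · rw [minpoly.algebraMap_eq (Module.isTorsionFree_iff_algebraMap_injective.1 inferInstance),
        aeval_algebraMap_apply]
      exact h₁.map _
  rw [differentIdeal_ringInt_tower p L₂ E, htop, h₂, Ideal.map_top, Ideal.top_mul]

variable (p K)

/-- The supremum of all unramified subextensions is attained by a finite compositum, hence unramified. -/
theorem formallyUnramified_maxUnramified :
    Algebra.FormallyUnramified ℤ_[p] (RingInt p (maxUnramified p K)) := by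
  have : WellFoundedGT (IntermediateField ℚ_[p] K) := by
    refine StrictMono.wellFoundedGT (β := Submodule ℚ_[p] K)
      (f := fun L => Subalgebra.toSubmodule L.toSubalgebra) fun L₁ L₂ h => h
  refine CompleteLattice.WellFoundedGT.isSupClosedCompact _ this
    {L | Algebra.FormallyUnramified ℤ_[p] (RingInt p L)} ⟨⊥, ?_⟩
    fun L₁ h₁ L₂ h₂ => formallyUnramified_sup h₁ h₂
  refine (Algebra.formallyUnramified_iff _ _).2
    (KaehlerDifferential.subsingleton_of_surjective _ _ fun x => ?_)
  obtain ⟨q, hq⟩ := IntermediateField.mem_bot.1 (x : (⊥ : IntermediateField ℚ_[p] K)).2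
  have hx : IsIntegral ℤ_[p] (algebraMap ℚ_[p] K q) := by
    rw [hq]
    exact x.isIntegral.algebraMap (B := K)
  rw [isIntegral_algebraMap_iff (algebraMap ℚ_[p] K).injective] at hx
  obtain ⟨z, hz⟩ := IsIntegrallyClosed.isIntegral_iff.1 hx
  refine ⟨z, RingInt.ext (Subtype.ext ?_)⟩
  rw [← hq, ← hz, ← IsScalarTower.algebraMap_apply, ← IsScalarTower.algebraMap_apply]
  rfl

/-- The different of `K` over `ℚ_p` is that over the maximal unramified subextension. -/
theorem differentIdeal_eq_different : differentIdeal ℤ_[p] (RingInt p K) = different p K := by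
  rw [differentIdeal_ringInt_tower p (maxUnramified p K) K,
    (formallyUnramified_iff_differentIdeal_eq_top p _).1 (formallyUnramified_maxUnramified p K),
    Ideal.map_top, Ideal.mul_top]
  rfl

end Unramified

section FracIdeal

variable {p : ℕ} [hp : Fact p.Prime] {N : Type*} [NormedField N] [NormedAlgebra ℚ_[p] N]
  [Algebra ℤ_[p] N] [IsScalarTower ℤ_[p] ℚ_[p] N]
  {K : Type*} [Field K] [Algebra ℚ_[p] K] [FiniteDimensional ℚ_[p] K]
  [Algebra ℤ_[p] K] [IsScalarTower ℤ_[p] ℚ_[p] K] [Algebra K N] [IsScalarTower ℚ_[p] K N]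

variable (N) in
theorem norm_algebraMap_aeval_derivative_pos (β : RingInt p K) :
    0 < ‖algebraMap K N (aeval β (derivative (minpoly ℤ_[p] β)) : RingInt p K)‖ := by
  rw [norm_pos_iff, _root_.map_ne_zero]
  exact fun h => aeval_derivative_minpoly_ne_zero β (RingInt.ext (by rw [h, map_zero]))

theorem valDifferent_eq {β : RingInt p K} (hβ : Algebra.adjoin ℤ_[p] {β} = ⊤) :
    valDifferent p N K = ((-Real.logb p
      ‖algebraMap K N (aeval β (derivative (minpoly ℤ_[p] β)) : RingInt p K)‖ : ℝ) : EReal) := by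
  have h0 := norm_algebraMap_aeval_derivative_pos N β
  have hval : val p (algebraMap K N (aeval β (derivative (minpoly ℤ_[p] β)) : RingInt p K)) =
      ((-Real.logb p
      ‖algebraMap K N (aeval β (derivative (minpoly ℤ_[p] β)) : RingInt p K)‖ : ℝ) : EReal) := by
    rw [val, if_neg (norm_pos_iff.1 h0)]
  rw [valDifferent, ← differentIdeal_eq_different, differentIdeal_padicInt_eq_span hβ, ← hval]
  refine le_antisymm (iInf₂_le _ (Ideal.mem_span_singleton_self _)) (le_iInf₂ fun x hx => ?_)
  obtain ⟨c, rfl⟩ := Ideal.mem_span_singleton.1 hx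
  refine le_val_iff p ?_ le_rfl
  rw [map_mul, map_mul, norm_mul]
  exact mul_le_of_le_one_right (norm_nonneg _)
    (norm_ringInt_le_one p (algebraMap (RingInt p K) (RingInt p N) c))

theorem mem_fracIdeal_iff {β : RingInt p K} (hβ : Algebra.adjoin ℤ_[p] {β} = ⊤) (a : N) :
    a ∈ fracIdeal p N K ↔
      ‖a‖ * ‖algebraMap K N (aeval β (derivative (minpoly ℤ_[p] β)) : RingInt p K)‖ ≤
        (p : ℝ) ^ (1 / ((p : ℝ) - 1)) := by
  have h0 := norm_algebraMap_aeval_derivative_pos N β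
  have hp1 : (1 : ℝ) < p := Nat.one_lt_cast.2 hp.out.one_lt
  change -(valDifferent p N K) - ((1 / ((p : ℝ) - 1) : ℝ) : EReal) ≤ val p a ↔ _
  rw [valDifferent_eq hβ, val, ← EReal.coe_neg, ← EReal.coe_sub, neg_neg]
  split_ifs with ha
  · simp only [le_top, ha, norm_zero, zero_mul, true_iff]
    exact (Real.rpow_pos_of_pos (zero_lt_one.trans hp1) _).le
  · have ha' : 0 < ‖a‖ := norm_pos_iff.2 ha
    rw [EReal.coe_le_coe_iff, sub_le_iff_le_add, ← sub_le_iff_le_add', sub_neg_eq_add, add_comm,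
      ← Real.logb_mul ha'.ne' h0.ne', Real.logb_le_iff_le_rpow hp1 (mul_pos ha' h0)]

end FracIdeal

/-! ### A generator of `ℤ_p(1)` -/

section Generator

variable {p : ℕ} [hp : Fact p.Prime] {N : Type*} [Field N]

namespace Mu

/-- A root of unity of `p`-power order, as an element of `μ_{p^∞}`. -/
def ofUnit (u : Nˣ) (hu : ∃ n : ℕ, u ^ p ^ n = 1) : Mu p N :=
  Additive.ofMul (⟨u, by
    obtain ⟨n, hn⟩ := hu
    exact ⟨n, hn⟩⟩ : CommGroup.primaryComponent Nˣ p)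

theorem unit_injective : Function.Injective (unit : Mu p N → Nˣ) := fun _ _ h => Subtype.ext h

theorem unit_nsmul (m : ℕ) (x : Mu p N) : (m • x).unit = x.unit ^ m := rfl

theorem unit_zero : (0 : Mu p N).unit = 1 := rfl

theorem nsmul_eq_zero_iff (m : ℕ) (x : Mu p N) : m • x = 0 ↔ x.unit ^ m = 1 := by
  rw [← unit_injective.eq_iff, unit_nsmul, unit_zero]

end Mu

theorem exists_compatible_roots [IsAlgClosed N] [CharZero N] :
    ∃ ζ : ℕ → N, (∀ n, ζ (n + 1) ^ p = ζ n) ∧ ∀ n, IsPrimitiveRoot (ζ n) (p ^ n) := by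
  have : NeZero (p : N) := ⟨Nat.cast_ne_zero.2 hp.out.ne_zero⟩
  obtain ⟨ω, hω⟩ := IsAlgClosed.exists_root (cyclotomic p N)
    (by rw [degree_cyclotomic]; exact_mod_cast (Nat.totient_pos.2 hp.out.pos).ne')
  rw [isRoot_cyclotomic_iff] at hω
  choose f hf using fun x : N => IsAlgClosed.exists_pow_nat_eq x hp.out.pos
  have hζ : ∀ n, (f^[n + 1] ω) ^ p = f^[n] ω := fun n => by
    rw [Function.iterate_succ_apply', hf]
  refine ⟨fun n => (f^[n] ω) ^ p, fun n => congrArg (· ^ p) (hζ n), fun n => ?_⟩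
  have hpow : ∀ n, ((f^[n] ω) ^ p) ^ p ^ n = 1 := fun n => by
    induction n with
    | zero => simpa using hω.pow_eq_one
    | succ n ih => rw [hζ, pow_succ', pow_mul, ih]
  cases n with
  | zero =>
    rw [pow_zero, IsPrimitiveRoot.one_right_iff]
    simpa using hω.pow_eq_one
  | succ n =>
    have hne : ¬ ((f^[n + 1] ω) ^ p) ^ p ^ n = 1 := by
      have : ∀ n, ((f^[n + 1] ω) ^ p) ^ p ^ n = ω := fun n => by
        induction n with
        | zero => rw [hζ]; simp
        | succ n ih => rw [hζ, pow_succ', pow_mul, ih]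
      rw [this]
      exact hω.ne_one hp.out.one_lt
    rw [← orderOf_eq_prime_pow hne (hpow (n + 1))]
    exact IsPrimitiveRoot.orderOf _

/-- A compatible system of primitive roots of unity of order `p ^ n`, as an element of `ℤ_p(1)`. -/
theorem exists_generator [IsAlgClosed N] [CharZero N] : ∃ ε : Zp1 p N,
    ∀ n, IsPrimitiveRoot ((ε.1 n).unit : N) (p ^ n) := by
  obtain ⟨ζ, hζ, hprim⟩ := exists_compatible_roots (p := p) (N := N)
  let u : ℕ → Nˣ := fun n => (hprim n).isUnit (pow_pos hp.out.pos n).ne' |>.unit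
  have hu : ∀ n, u n ^ p ^ n = 1 := fun n => Units.ext (hprim n).pow_eq_one
  refine ⟨⟨fun n => Mu.ofUnit (u n) ⟨n, hu n⟩, fun n => ?_, fun n => ?_⟩, fun n => ?_⟩
  · rw [← Nat.cast_pow, Nat.cast_smul_eq_nsmul, Mu.nsmul_eq_zero_iff]
    exact hu n
  · rw [Nat.cast_smul_eq_nsmul]
    exact Mu.unit_injective (Units.ext (hζ n))
  · exact hprim n

section

variable {ε : Zp1 p N} (hε : ∀ n, IsPrimitiveRoot ((ε.1 n).unit : N) (p ^ n))

theorem nsmul_self_eq_zero (x : Zp1 p N) (n : ℕ) : p ^ n • x.1 n = 0 := by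
  have := x.2.1 n
  rwa [← Nat.cast_pow, Nat.cast_smul_eq_nsmul] at this

theorem unit_pow_eq (x : Zp1 p N) (n : ℕ) :
    (((x.1 (n + 1)).unit : Nˣ) : N) ^ p = ((x.1 n).unit : Nˣ) := by
  have := x.2.2 n
  rw [Nat.cast_smul_eq_nsmul] at this
  rw [← this, Mu.unit_nsmul, Units.val_pow_eq_pow_val]

include hε

theorem nsmul_generator_eq_zero_iff (n m : ℕ) : m • ε.1 n = 0 ↔ p ^ n ∣ m := by
  rw [Mu.nsmul_eq_zero_iff, ← (hε n).pow_eq_one_iff_dvd, Units.ext_iff, Units.val_pow_eq_pow_val,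
    Units.val_one]

theorem exists_eq_nsmul_generator {n : ℕ} {x : Mu p N} (hx : p ^ n • x = 0) :
    ∃ m : ℕ, x = m • ε.1 n := by
  have : NeZero (p ^ n) := ⟨(pow_pos hp.out.pos n).ne'⟩
  rw [Mu.nsmul_eq_zero_iff, Units.ext_iff, Units.val_pow_eq_pow_val, Units.val_one] at hx
  obtain ⟨m, -, hm⟩ := (hε n).eq_pow_of_pow_eq_one hx
  exact ⟨m, Mu.unit_injective (Units.ext hm.symm)⟩

theorem smul_generator_eq_zero {z : ℤ_[p]} (hz : z • ε = 0) : z = 0 := by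
  by_contra h0
  have h : ∀ n, z ∈ Ideal.span {(p : ℤ_[p]) ^ n} := fun n => by
    have h1 := PadicInt.appr_spec n z
    have h2 : z • ε.1 n = 0 := congrFun (congrArg Subtype.val hz) n
    rw [Mu.smul_eq (nsmul_self_eq_zero ε n) h1, nsmul_generator_eq_zero_iff hε] at h2
    obtain ⟨k, hk⟩ := h2
    have h3 : (z.appr n : ℤ_[p]) ∈ Ideal.span {(p : ℤ_[p]) ^ n} := by
      rw [hk, Nat.cast_mul, Nat.cast_pow]
      exact Ideal.mul_mem_right _ _ (Ideal.mem_span_singleton_self _)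
    simpa using add_mem h1 h3
  have := (PadicInt.mem_span_pow_iff_le_valuation z h0 _).1 (h (z.valuation + 1))
  omega

theorem exists_eq_smul_generator (x : Zp1 p N) : ∃ z : ℤ_[p], x = z • ε := by
  -- the exponents `m n` of `x` with respect to `ε` converge to `z`
  choose m hm using fun n => exists_eq_nsmul_generator hε (nsmul_self_eq_zero x n)
  have hstep : ∀ n, (m n : ℤ_[p]) - m (n + 1) ∈ Ideal.span {(p : ℤ_[p]) ^ n} := fun n => by
    have h1 := x.2.2 n
    have h2 := ε.2.2 n
    rw [Nat.cast_smul_eq_nsmul] at h1 h2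
    rw [hm, hm, smul_comm, h2] at h1
    have hord : addOrderOf (ε.1 n) = p ^ n := Nat.dvd_antisymm
      (addOrderOf_dvd_of_nsmul_eq_zero (nsmul_self_eq_zero ε n))
      ((nsmul_generator_eq_zero_iff hε n _).1 (addOrderOf_nsmul_eq_zero _))
    rw [nsmul_eq_nsmul_iff_modEq, hord, Nat.modEq_iff_dvd] at h1
    rw [Ideal.mem_span_singleton]
    obtain ⟨c, hc⟩ := h1
    exact ⟨c, by exact_mod_cast congrArg (Int.cast : ℤ → ℤ_[p]) hc⟩
  obtain ⟨z, hz⟩ : ∃ z : ℤ_[p], ∀ n, z - m n ∈ Ideal.span {(p : ℤ_[p]) ^ n} := by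
    have hI : ∀ n, (IsLocalRing.maximalIdeal ℤ_[p] ^ n • ⊤ : Ideal ℤ_[p])
        = Ideal.span {(p : ℤ_[p]) ^ n} := fun n => by
      rw [PadicInt.maximalIdeal_eq_span_p, Ideal.span_singleton_pow, smul_eq_mul, Ideal.mul_top]
    have hmn : ∀ {k n}, k ≤ n → (m k : ℤ_[p]) - m n ∈ Ideal.span {(p : ℤ_[p]) ^ k} := by
      intro k n hkn
      induction n, hkn using Nat.le_induction with
      | base => simp
      | succ n hkn ih =>
        have := Ideal.span_singleton_le_span_singleton.2 (pow_dvd_pow (p : ℤ_[p]) hkn) (hstep n)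
        simpa using add_mem ih this
    obtain ⟨z, hz⟩ := IsPrecomplete.prec (I := IsLocalRing.maximalIdeal ℤ_[p])
      (M := ℤ_[p]) inferInstance (f := fun n => (m n : ℤ_[p])) fun {k n} hkn => by
        rw [SModEq.sub_mem, hI]; exact hmn hkn
    refine ⟨z, fun n => ?_⟩
    rw [← hI, ← SModEq.sub_mem]
    exact (hz n).symm
  refine ⟨z, Subtype.ext (funext fun n => ?_)⟩
  rw [hm]
  exact (Mu.smul_eq (nsmul_self_eq_zero ε n) (hz n)).symm

/-- `ℤ_p(1)` is free of rank one on a compatible system of primitive roots of unity. -/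
def generatorEquiv : ℤ_[p] ≃ₗ[ℤ_[p]] Zp1 p N :=
  LinearEquiv.ofBijective (LinearMap.toSpanSingleton ℤ_[p] (Zp1 p N) ε)
    ⟨(injective_iff_map_eq_zero _).2 fun _ h => smul_generator_eq_zero hε h,
      fun x => (exists_eq_smul_generator hε x).imp fun _ h => h.symm⟩

theorem generatorEquiv_apply (z : ℤ_[p]) : generatorEquiv hε z = z • ε := rfl

end
end Generator

/-! ### The map `Kbar → Ω¹` given by a generator of `ℤ_p(1)` -/

section Omega

variable {p : ℕ} [hp : Fact p.Prime] {N : Type*} [NormedField N] [NormedAlgebra ℚ_[p] N]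
  [Algebra.IsAlgebraic ℚ_[p] N] [Algebra ℤ_[p] N] [IsScalarTower ℤ_[p] ℚ_[p] N]
  (K : Type*) [Field K] [Algebra ℚ_[p] K] [FiniteDimensional ℚ_[p] K]
  [Algebra ℤ_[p] K] [IsScalarTower ℤ_[p] ℚ_[p] K] [Algebra K N] [IsScalarTower ℚ_[p] K N]

theorem smul_dlogMu {x : Mu p N} {z : RingInt p N} (hz : (z : N) = x.unit) :
    z • dlogMu p N K x = D (RingInt p K) (RingInt p N) z := by
  have hz' : z = (muToUnits p N (Additive.toMul x)).1 := RingInt.ext hz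
  change z • ((muToUnits p N (Additive.toMul x))⁻¹ : (RingInt p N)ˣ).1 •
    D (RingInt p K) (RingInt p N) (muToUnits p N (Additive.toMul x)).1 = _
  rw [smul_smul, ← hz', hz', Units.mul_inv, one_smul]

/-- Roots of unity can be cancelled. -/
theorem eq_of_unit_smul_eq {M : Type*} [AddCommGroup M] [Module (RingInt p N) M] {x : Mu p N}
    {z : RingInt p N} (hz : (z : N) = x.unit) {m m' : M} (h : z • m = z • m') : m = m' := by
  have hz' : z = (muToUnits p N (Additive.toMul x)).1 := RingInt.ext hz
  have := congrArg (((muToUnits p N (Additive.toMul x))⁻¹ : (RingInt p N)ˣ).1 • ·) h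
  simpa only [smul_smul, hz', Units.inv_mul, one_smul] using this

omit [Algebra.IsAlgebraic ℚ_[p] N] in
/-- A relation between differentials of `𝒪_L` over `ℤ_p` persists in `Ω¹`. -/
theorem smul_D_eq_of_level {L : IntermediateField ℚ_[p] N} {a b c d : RingInt p L}
    (h : a • D ℤ_[p] (RingInt p L) b = c • D ℤ_[p] (RingInt p L) d) :
    algebraMap (RingInt p L) (RingInt p N) a •
      D (RingInt p K) (RingInt p N) (algebraMap (RingInt p L) (RingInt p N) b) =
    algebraMap (RingInt p L) (RingInt p N) c •
      D (RingInt p K) (RingInt p N) (algebraMap (RingInt p L) (RingInt p N) d) := by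
  have := congrArg (KaehlerDifferential.map ℤ_[p] (RingInt p K) (RingInt p L) (RingInt p N)) h
  rwa [map_smul, map_smul, map_D, map_D, ← algebraMap_smul (RingInt p N) a,
    ← algebraMap_smul (RingInt p N) c] at this

section

variable (ε : Zp1 p N)

/-- The map `Kbar → Ω¹` with `a / p ^ r ↦ a dlog ε_r` for `a` integral. -/
def dlogHom : N →ₗ[RingInt p N] Omega p N K where
  toFun x := dlogTensor p N K (divisPairing p N x ε)
  map_add' x y := by rw [map_add, LinearMap.add_apply, map_add]
  map_smul' a x := by rw [map_smul, LinearMap.smul_apply, map_smul, RingHom.id_apply]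

theorem dlogHom_apply {x : N} {r : ℕ} {a : RingInt p N} (h : (a : N) = (p : N) ^ r * x) :
    dlogHom K ε x = a • dlogMu p N K (ε.1 r) := by
  change dlogTensor p N K (divisFun p x ε) = _
  rw [divisFun_eq p ε h]
  exact LinearMap.liftBaseChange_tmul _ _ _ _

/-- If `y` is a coefficient of `dx`, then `dx` is the image of `y` under `dlogHom`. -/
theorem D_eq_dlogHom {L : IntermediateField ℚ_[p] N} {r : ℕ} {x : RingInt p N} {y : N}
    (h : IsDlogCoeff (fun n => ((ε.1 n).unit : N)) L r x y) :
    D (RingInt p K) (RingInt p N) x = dlogHom K ε y := by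
  obtain ⟨x', z, c, hx, hz, hc, h⟩ := h
  obtain rfl : algebraMap (RingInt p L) (RingInt p N) x' = x := RingInt.ext hx
  have hz' : ((algebraMap (RingInt p L) (RingInt p N) z : RingInt p N) : N) = (ε.1 r).unit := hz
  have hc' : ((algebraMap (RingInt p L) (RingInt p N) c : RingInt p N) : N) = (p : N) ^ r * y := hc
  rw [dlogHom_apply K ε hc']
  refine eq_of_unit_smul_eq hz' ?_
  rw [smul_D_eq_of_level K h, smul_comm, smul_dlogMu K hz']

end

section

variable {ε : Zp1 p N} (hε : ∀ n, IsPrimitiveRoot ((ε.1 n).unit : N) (p ^ n))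

include hε

theorem range_dlogHom : LinearMap.range (dlogHom K ε) = ⊤ := by
  refine top_unique ?_
  rw [← KaehlerDifferential.span_range_derivation (RingInt p K) (RingInt p N)]
  refine Submodule.span_le.2 ?_
  rintro _ ⟨x, rfl⟩
  obtain ⟨L, -, -, r, y, -, h⟩ := IsDlogCoeff.exists_of_isIntegral hε x.isIntegral ⊥
  exact ⟨y, (D_eq_dlogHom K ε h).symm⟩

/-- `a dlog ε_r` vanishes for `v(a) ≥ r - 1 / (p - 1)`, already over `ℤ_p`. -/
theorem dlogHom_eq_zero_of_norm_le {y : N} (hy : ‖y‖ ≤ (p : ℝ) ^ (1 / ((p : ℝ) - 1))) :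
    dlogHom K ε y = 0 := by
  obtain ⟨r, a, ha⟩ : ∃ (r : ℕ) (a : RingInt p N), (a : N) = (p : N) ^ (r + 1) * y := by
    obtain ⟨⟨r, a⟩, ha⟩ := exists_ringInt_eq p y
    exact ⟨r, p * a, by rw [map_mul, map_natCast, ha, pow_succ', mul_assoc]⟩
  obtain ⟨L₁, _, -, haL⟩ := exists_level_ge (⊥ : IntermediateField ℚ_[p] N) (a : N)
  obtain ⟨L, _, hL, hzL⟩ := exists_level_ge L₁ ((ε.1 (r + 1)).unit : N)
  obtain ⟨a', ha'⟩ := exists_ringInt_level_eq L a.isIntegral (hL haL)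
  obtain ⟨z, hz⟩ := exists_ringInt_level_eq L
    (((hε (r + 1)).isIntegral (pow_pos hp.out.pos _)).tower_top (A := ℤ_[p])) hzL
  have h0 : a' • D ℤ_[p] (RingInt p L) z =
      (0 : RingInt p L) • D ℤ_[p] (RingInt p L) z := by
    rw [zero_smul, smul_D_primitiveRoot_eq_zero_iff (by rw [hz]; exact hε (r + 1)), ha', ha,
      ← Nat.cast_succ]
    exact (norm_pow_mul_le_iff p (r + 1) _ y).2 hy
  have h1 := smul_D_eq_of_level K h0
  obtain rfl : algebraMap (RingInt p L) (RingInt p N) a' = a := RingInt.ext ha'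
  have hz' : ((algebraMap (RingInt p L) (RingInt p N) z : RingInt p N) : N)
    = (ε.1 (r + 1)).unit := hz
  rw [dlogHom_apply K ε ha]
  refine eq_of_unit_smul_eq hz' ?_
  rw [smul_comm, smul_dlogMu K hz', h1, map_zero, zero_smul, smul_zero]

end

variable {K} {ζ : ℕ → N}

/-- If `y` is a coefficient of `dβ`, where `𝒪_K = ℤ_p[β]` and `k` is the minimal polynomial of `β`,
then `t dβ = 0` over `ℤ_p` can be tested on `ty`, and on the other hand means that `k'(β)` divides
`t`. -/
theorem IsDlogCoeff.norm_mul_le_iff (hprim : ∀ n, IsPrimitiveRoot (ζ n) (p ^ n))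
    {β : RingInt p K} (hβ : Algebra.adjoin ℤ_[p] {β} = ⊤) {L : IntermediateField ℚ_[p] N}
    [FiniteDimensional ℚ_[p] L] (hL : ∀ x : K, algebraMap K N x ∈ L) {r : ℕ} (hr : r ≠ 0) {y : N}
    (h : IsDlogCoeff ζ L r (algebraMap K N β) y) (t : RingInt p N) :
    ‖(t : N) * y‖ ≤ (p : ℝ) ^ (1 / ((p : ℝ) - 1)) ↔ ‖(t : N)‖ ≤
      ‖algebraMap K N (aeval β (derivative (minpoly ℤ_[p] β)) : RingInt p K)‖ := by
  obtain ⟨L', _, hLL', htL⟩ := exists_level_ge L (t : N)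
  obtain ⟨t', ht'⟩ := exists_ringInt_level_eq L' t.isIntegral htL
  obtain ⟨b, z, c, hb, hz, hc, hbc⟩ := h.mono_field hLL'
  obtain ⟨n, rfl⟩ := Nat.exists_eq_succ_of_ne_zero hr
  have hζ1 : ‖ζ (n + 1)‖ = 1 := by
    have := congrArg norm (hprim (n + 1)).pow_eq_one
    rw [norm_pow, norm_one] at this
    exact (pow_eq_one_iff_of_nonneg (norm_nonneg _) (pow_pos hp.out.pos _).ne').1 this
  have h1 := smul_D_primitiveRoot_eq_zero_iff (by rw [hz]; exact hprim (n + 1)) (t' * c)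
  have h2 := smul_D_eq_zero_iff_norm_le K (fun x => hLL' (hL x)) hβ hb (t' * z)
  rw [mul_smul, hbc, smul_smul, h1] at h2
  have e1 : (((t' * c : RingInt p L') : L') : N) = (p : N) ^ (n + 1) * (t * y) := by
    have : (((t' * c : RingInt p L') : L') : N) = ((t' : L') : N) * ((c : L') : N) := by
      rw [map_mul]; rfl
    rw [this, ht', hc, Nat.succ_eq_add_one]; ring
  have e2 : (((t' * z : RingInt p L') : L') : N) = t * ζ (n + 1) := by
    have : (((t' * z : RingInt p L') : L') : N) = ((t' : L') : N) * ((z : L') : N) := by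
      rw [map_mul]; rfl
    rw [this, ht', hz]
  rw [e1, e2, norm_mul _ (ζ (n + 1)), hζ1, mul_one] at h2
  rw [← h2, ← Nat.cast_succ]
  exact (norm_pow_mul_le_iff p (n + 1) _ _).symm

/-- The coefficient of `dβ` lies in `I_K`. -/
theorem IsDlogCoeff.mem_fracIdeal (hprim : ∀ n, IsPrimitiveRoot (ζ n) (p ^ n))
    {β : RingInt p K} (hβ : Algebra.adjoin ℤ_[p] {β} = ⊤) {L : IntermediateField ℚ_[p] N}
    [FiniteDimensional ℚ_[p] L] (hL : ∀ x : K, algebraMap K N x ∈ L) {r : ℕ} (hr : r ≠ 0) {y : N}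
    (h : IsDlogCoeff ζ L r (algebraMap K N β) y) : y ∈ fracIdeal p N K := by
  rw [mem_fracIdeal_iff hβ, mul_comm, ← norm_mul]
  exact (h.norm_mul_le_iff hprim hβ hL hr
    (algebraMap (RingInt p K) (RingInt p N) (aeval β (derivative (minpoly ℤ_[p] β))))).2 le_rfl

/-- `I_K` is generated by the coefficient `y` of `dβ` and the elements of valuation at least
`-1 / (p - 1)`. -/
theorem IsDlogCoeff.exists_mul_or_norm_le (hprim : ∀ n, IsPrimitiveRoot (ζ n) (p ^ n))
    {β : RingInt p K} (hβ : Algebra.adjoin ℤ_[p] {β} = ⊤) {L : IntermediateField ℚ_[p] N}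
    [FiniteDimensional ℚ_[p] L] (hL : ∀ x : K, algebraMap K N x ∈ L) {r : ℕ} (hr : r ≠ 0) {y : N}
    (h : IsDlogCoeff ζ L r (algebraMap K N β) y) {x : N} (hx : x ∈ fracIdeal p N K) :
    (∃ t : RingInt p N, x = t * y) ∨ ‖x‖ ≤ (p : ℝ) ^ (1 / ((p : ℝ) - 1)) := by
  have key := h.norm_mul_le_iff hprim hβ hL hr
  rw [mem_fracIdeal_iff hβ] at hx
  have h0 := norm_algebraMap_aeval_derivative_pos N β
  set δ := algebraMap K N (aeval β (derivative (minpoly ℤ_[p] β)) : RingInt p K)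
  have hδ1 : ‖δ‖ ≤ 1 := norm_ringInt_le_one p (algebraMap (RingInt p K) (RingInt p N)
    (aeval β (derivative (minpoly ℤ_[p] β))))
  rcases hδ1.lt_or_eq with hδ | hδ
  swap
  · exact Or.inr (by rwa [hδ, mul_one] at hx)
  -- since `dβ ≠ 0`, the coefficient `y` is large
  have hy : (p : ℝ) ^ (1 / ((p : ℝ) - 1)) < ‖y‖ := by
    by_contra! hle
    have := (key 1).1 (by rwa [map_one, one_mul])
    rw [map_one, norm_one] at this
    exact this.not_gt hδ
  have hy0 : 0 < ‖y‖ := (Real.rpow_pos_of_pos (Nat.cast_pos.2 hp.out.pos) _).trans hy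
  have hy0' : y ≠ 0 := norm_pos_iff.1 hy0
  left
  have hxy : ‖x / y‖ ≤ 1 := by
    by_contra! hlt
    have hle : ‖δ * (x / y)‖ ≤ 1 := by
      rw [norm_mul, norm_div, mul_div_assoc', div_le_one hy0, mul_comm]
      exact hx.trans hy.le
    have := (key (RingInt.mk _ (isIntegral_of_norm_le_one hle))).1 (by
      rw [RingInt.coe_mk, mul_assoc, div_mul_cancel₀ _ hy0', norm_mul, mul_comm]
      exact hx)
    rw [RingInt.coe_mk, norm_mul] at this
    exact (lt_mul_of_one_lt_right h0 hlt).not_ge this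
  exact ⟨RingInt.mk _ (isIntegral_of_norm_le_one hxy), by
    rw [RingInt.coe_mk, div_mul_cancel₀ _ hy0']⟩

/-- At a sufficiently large level `dβ` has a coefficient. -/
theorem IsDlogCoeff.exists_generator_coeff (N : Type*) [NormedField N] [NormedAlgebra ℚ_[p] N]
    [Algebra.IsAlgebraic ℚ_[p] N] [Algebra ℤ_[p] N] [IsScalarTower ℤ_[p] ℚ_[p] N]
    [Algebra K N] [IsScalarTower ℚ_[p] K N]
    {ζ : ℕ → N} (hprim : ∀ n, IsPrimitiveRoot (ζ n) (p ^ n)) (β : RingInt p K) :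
    ∃ L : IntermediateField ℚ_[p] N, FiniteDimensional ℚ_[p] L ∧
      (∀ x : K, algebraMap K N x ∈ L) ∧ ∃ r y, r ≠ 0 ∧ IsDlogCoeff ζ L r (algebraMap K N β) y := by
  let L₀ : IntermediateField ℚ_[p] N := (IsScalarTower.toAlgHom ℚ_[p] K N).fieldRange
  have : FiniteDimensional ℚ_[p] L₀ := (IsScalarTower.toAlgHom ℚ_[p] K N).toLinearMap.finiteDimensional_range
  obtain ⟨L, hfin, hL, h⟩ := IsDlogCoeff.exists_of_isIntegral hprim
    ((algebraMap (RingInt p K) (RingInt p N) β).isIntegral) L₀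
  exact ⟨L, hfin, fun x => hL ⟨x, rfl⟩, h⟩

end Omega

/-! ### The structure of `Ω¹` -/

section Structure

variable {p : ℕ} [hp : Fact p.Prime] {N : Type*} [NormedField N] [NormedAlgebra ℚ_[p] N]
  [Algebra.IsAlgebraic ℚ_[p] N] [Algebra ℤ_[p] N] [IsScalarTower ℤ_[p] ℚ_[p] N]
  (K : Type*) [Field K] [Algebra ℚ_[p] K] [FiniteDimensional ℚ_[p] K]
  [Algebra ℤ_[p] K] [IsScalarTower ℤ_[p] ℚ_[p] K] [Algebra K N] [IsScalarTower ℚ_[p] K N]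
  {ε : Zp1 p N} (hε : ∀ n, IsPrimitiveRoot ((ε.1 n).unit : N) (p ^ n))

include hε

theorem fracIdeal_le_ker_dlogHom : fracIdeal p N K ≤ LinearMap.ker (dlogHom K ε) := fun x hx => by
  obtain ⟨β, hβ⟩ := exists_adjoin_ringInt_eq_top p K
  obtain ⟨L, _, hL, r, y, hr, h⟩ := IsDlogCoeff.exists_generator_coeff N hε β
  rw [LinearMap.mem_ker]
  rcases h.exists_mul_or_norm_le hε hβ hL hr hx with ⟨t, rfl⟩ | hx
  · have h0 : dlogHom K ε y = 0 := by
      rw [← D_eq_dlogHom K ε (x := algebraMap (RingInt p K) (RingInt p N) β) h]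
      exact Derivation.map_algebraMap _ _
    rw [← Algebra.smul_def, map_smul, h0, smul_zero]
  · exact dlogHom_eq_zero_of_norm_le K hε hx

/-- The inverse of the map `Kbar / I_K → Ω¹`: the derivation taking `x` to the coefficient of `dx`
vanishes on `𝒪_K` modulo `I_K`. -/
theorem exists_leftInverse_dlogHom : ∃ Ψ : Omega p N K →ₗ[RingInt p N] N ⧸ fracIdeal p N K,
    ∀ x, Ψ (dlogHom K ε x) = (fracIdeal p N K).mkQ x := by
  obtain ⟨β, hβ⟩ := exists_adjoin_ringInt_eq_top p K
  obtain ⟨L, _, hL, r, y, hr, h⟩ := IsDlogCoeff.exists_generator_coeff N hε β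
  obtain ⟨d, hd⟩ := exists_dlogDerivation (unit_pow_eq ε) hε (fracIdeal p N K) fun x hx => by
    rw [mem_fracIdeal_iff hβ]
    exact (mul_le_of_le_one_right (norm_nonneg _) (norm_ringInt_le_one p
      (algebraMap (RingInt p K) (RingInt p N) _))).trans hx
  have hdK : ∀ x : RingInt p K, d (algebraMap (RingInt p K) (RingInt p N) x) = 0 := fun x => by
    have hx : x ∈ Algebra.adjoin ℤ_[p] {β} := hβ ▸ Algebra.mem_top
    induction hx using Algebra.adjoin_induction with
    | mem x hx =>
      obtain rfl := hx
      rw [hd L inferInstance r _ y h, Submodule.mkQ_apply, Submodule.Quotient.mk_eq_zero]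
      exact h.mem_fracIdeal hε hβ hL hr
    | algebraMap c =>
      rw [← IsScalarTower.algebraMap_apply]
      exact d.map_algebraMap c
    | add x y _ _ hx hy => rw [map_add, map_add, hx, hy, add_zero]
    | mul x y _ _ hx hy => rw [map_mul, d.leibniz, hx, hy, smul_zero, smul_zero, add_zero]
  -- `d` is linear over `𝒪_K` for the action of `𝒪_K` through `𝒪_Kbar`
  let : Module (RingInt p K) (N ⧸ fracIdeal p N K) :=
    Module.compHom _ (algebraMap (RingInt p K) (RingInt p N))
  have : IsScalarTower (RingInt p K) (RingInt p N) (N ⧸ fracIdeal p N K) :=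
    IsScalarTower.of_algebraMap_smul fun _ _ => rfl
  let d' : Derivation (RingInt p K) (RingInt p N) (N ⧸ fracIdeal p N K) :=
    Derivation.mk'
      { toFun := d
        map_add' := d.map_add
        map_smul' := fun a x => by
          rw [Algebra.smul_def, d.leibniz, hdK, smul_zero, add_zero, RingHom.id_apply,
            algebraMap_smul] } d.leibniz
  refine ⟨d'.liftKaehlerDifferential, fun x => ?_⟩
  obtain ⟨⟨r, a⟩, ha⟩ := exists_ringInt_eq p x
  let z : RingInt p N := RingInt.mk ((ε.1 r).unit : N)
    (((hε r).isIntegral (pow_pos hp.out.pos _)).tower_top (A := ℤ_[p]))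
  have hz : (z : N) = (ε.1 r).unit := rfl
  have hp0 : (p : N) ^ r ≠ 0 := pow_ne_zero _ (norm_pos_iff.1 (by
    rw [norm_natCast_self]; exact inv_pos.2 (Nat.cast_pos.2 hp.out.pos)))
  have hlog : d'.liftKaehlerDifferential (dlogMu p N K (ε.1 r)) =
      (fracIdeal p N K).mkQ ((p : N) ^ r)⁻¹ := by
    refine eq_of_unit_smul_eq hz ?_
    rw [← map_smul, smul_dlogMu K hz, Derivation.liftKaehlerDifferential_comp_D, ← map_smul,
      Algebra.smul_def, ← div_eq_mul_inv]
    obtain ⟨L', _, -, hzL⟩ := exists_level_ge (⊥ : IntermediateField ℚ_[p] N) (z : N)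
    exact hd L' inferInstance r z _ (IsDlogCoeff.self (ζ := fun n => ((ε.1 n).unit : N))
      (exists_ringInt_level_eq L' z.isIntegral hzL))
  rw [dlogHom_apply K ε ha, map_smul, hlog, ← map_smul, Algebra.smul_def, ha,
    mul_comm ((p : N) ^ r) x, mul_inv_cancel_right₀ hp0]

/-- The isomorphism `Kbar / I_K ≅ Ω¹` given by a generator of `ℤ_p(1)`. -/
def omegaEquiv : (N ⧸ fracIdeal p N K) ≃ₗ[RingInt p N] Omega p N K :=
  LinearEquiv.ofBijective ((fracIdeal p N K).liftQ (dlogHom K ε) (fracIdeal_le_ker_dlogHom K hε))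
    ⟨by
      obtain ⟨Ψ, hΨ⟩ := exists_leftInverse_dlogHom K hε
      refine Function.LeftInverse.injective (g := Ψ) fun x => ?_
      obtain ⟨x, rfl⟩ := Submodule.mkQ_surjective _ x
      exact hΨ x,
    by
      rw [← LinearMap.range_eq_top, Submodule.range_liftQ, range_dlogHom K hε]⟩

theorem omegaEquiv_mkQ (x : N) : omegaEquiv K hε ((fracIdeal p N K).mkQ x) = dlogHom K ε x := rfl

theorem dlogHom_eq_zero_iff (x : N) : dlogHom K ε x = 0 ↔ x ∈ fracIdeal p N K := by
  rw [← omegaEquiv_mkQ K hε, LinearEquiv.map_eq_zero_iff, Submodule.mkQ_apply,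
    Submodule.Quotient.mk_eq_zero]

theorem exists_dlogHom_eq (ω : Omega p N K) : ∃ x, dlogHom K ε x = ω :=
  LinearMap.range_eq_top.1 (range_dlogHom K hε) ω

theorem exists_smul_dlogMu_eq (ω : Omega p N K) :
    ∃ (r : ℕ) (a : RingInt p N), a • dlogMu p N K (ε.1 r) = ω := by
  obtain ⟨x, rfl⟩ := exists_dlogHom_eq K hε ω
  obtain ⟨⟨r, a⟩, ha⟩ := exists_ringInt_eq p x
  exact ⟨r, a, (dlogHom_apply K ε ha).symm⟩

omit hε in
theorem pow_smul_dlogMu (x : Zp1 p N) (r : ℕ) : p ^ r • dlogMu p N K (x.1 r) = 0 := by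
  rw [← map_nsmul, nsmul_self_eq_zero, map_zero]

omit hε in
theorem smul_dlogMu_succ (x : Zp1 p N) (r : ℕ) :
    p • dlogMu p N K (x.1 (r + 1)) = dlogMu p N K (x.1 r) := by
  rw [← map_nsmul, ← Nat.cast_smul_eq_nsmul ℤ_[p], x.2.2 r]

theorem exists_pow_smul_eq_zero (ω : Omega p N K) : ∃ r : ℕ, p ^ r • ω = 0 := by
  obtain ⟨r, a, rfl⟩ := exists_smul_dlogMu_eq K hε ω
  exact ⟨r, by rw [smul_comm, pow_smul_dlogMu, smul_zero]⟩

theorem exists_smul_eq (ω : Omega p N K) : ∃ η : Omega p N K, p • η = ω := by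
  obtain ⟨r, a, rfl⟩ := exists_smul_dlogMu_eq K hε ω
  exact ⟨a • dlogMu p N K (ε.1 (r + 1)), by rw [smul_comm, smul_dlogMu_succ]⟩

omit hε in
theorem dlog_tmul_mkQ [IsAlgClosure K N] (x : N) (e : Zp1 p N) :
    dlog p N K ((intSubmodule p N).mkQ x ⊗ₜ e) = dlogTensor p N K (divisPairing p N x e) := rfl

theorem exists_equiv_dlog [IsAlgClosure K N] :
    ∃ e : (N ⧸ fracIdeal p N K) ⊗[ℤ_[p]] Zp1 p N ≃ₗ[RingInt p N] Omega p N K,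
      ∀ x, e (projFracIdeal p N K x) = dlog p N K x := by
  refine ⟨TensorProduct.AlgebraTensorModule.congr (LinearEquiv.refl (RingInt p N) _)
    (generatorEquiv hε).symm ≪≫ₗ TensorProduct.AlgebraTensorModule.rid ℤ_[p] (RingInt p N) _ ≪≫ₗ
      omegaEquiv K hε, fun x => ?_⟩
  induction x using TensorProduct.induction_on with
  | zero => simp only [map_zero]
  | add x y hx hy => rw [map_add, map_add, hx, hy, map_add]
  | tmul x e =>
    obtain ⟨x, rfl⟩ := Submodule.mkQ_surjective _ x
    obtain ⟨z, rfl⟩ := (generatorEquiv hε).surjective e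
    have h : projFracIdeal p N K ((intSubmodule p N).mkQ x ⊗ₜ generatorEquiv hε z) =
      (fracIdeal p N K).mkQ x ⊗ₜ generatorEquiv hε z := rfl
    have h' : divisPairing p N x (generatorEquiv hε z) =
        algebraMap ℤ_[p] (RingInt p N) z • divisPairing p N x ε := by
      rw [generatorEquiv_apply, map_smul, algebraMap_smul]
    rw [dlog_tmul_mkQ, h, h', map_smul, LinearEquiv.trans_apply, LinearEquiv.trans_apply,
      TensorProduct.AlgebraTensorModule.congr_tmul, LinearEquiv.symm_apply_apply,
      TensorProduct.AlgebraTensorModule.rid_tmul, LinearEquiv.refl_apply,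
      ← algebraMap_smul (RingInt p N) z, map_smul, omegaEquiv_mkQ]
    rfl

end Structure

section Surjective

variable {p : ℕ} [hp : Fact p.Prime] {N : Type*} [NormedField N] [NormedAlgebra ℚ_[p] N]
  [Algebra.IsAlgebraic ℚ_[p] N] [Algebra ℤ_[p] N] [IsScalarTower ℤ_[p] ℚ_[p] N] [IsAlgClosed N]
  (K : Type*) [Field K] [Algebra ℚ_[p] K] [FiniteDimensional ℚ_[p] K]
  [Algebra ℤ_[p] K] [IsScalarTower ℤ_[p] ℚ_[p] K] [Algebra K N] [IsScalarTower ℚ_[p] K N]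
  {ε : Zp1 p N} (hε : ∀ n, IsPrimitiveRoot ((ε.1 n).unit : N) (p ^ n))

theorem exists_pow_add_mul_eq {q : ℕ} (hq : 1 < q) (c α : RingInt p N) :
    ∃ β : RingInt p N, β ^ q + c * β = α := by
  let f : (RingInt p N)[X] := X ^ q + (C c * X - C α)
  have hdeg : (C c * X - C α : (RingInt p N)[X]).degree < q :=
    (degree_sub_le _ _).trans_lt (max_lt ((degree_C_mul_X_le c).trans_lt (by exact_mod_cast hq))
      (degree_C_le.trans_lt (by exact_mod_cast (zero_lt_one.trans hq))))
  have hf : f.Monic := monic_X_pow_add hdeg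
  have hfdeg : (f.map (algebraMap (RingInt p N) N)).degree ≠ 0 := by
    rw [hf.degree_map, degree_add_eq_left_of_degree_lt (by rwa [degree_X_pow]), degree_X_pow]
    exact_mod_cast (zero_lt_one.trans hq).ne'
  obtain ⟨b, hb⟩ := IsAlgClosed.exists_root _ hfdeg
  have hint : IsIntegral ℤ_[p] b := by
    have : Algebra.IsIntegral ℤ_[p] (RingInt p N) := inferInstance
    exact isIntegral_trans (A := RingInt p N) b ⟨f, hf, by rwa [IsRoot, eval_map] at hb⟩
  refine ⟨RingInt.mk b hint, RingInt.ext ?_⟩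
  rw [IsRoot, eval_map] at hb
  simp only [f, eval₂_add, eval₂_sub, eval₂_pow, eval₂_mul, eval₂_X, eval₂_C] at hb
  rw [map_add, map_pow, map_mul, RingInt.coe_mk]
  linear_combination hb

omit [IsAlgClosed N] in
theorem isUnit_one_add_mul {M : ℕ} (hM : M ≠ 0) (b : RingInt p N) :
    IsUnit (1 + (p : RingInt p N) ^ M * b) := by
  have : IsUltrametricDist N := IsUltrametricDist.of_normedAlgebra ℚ_[p]
  have hlt : ‖(((p : RingInt p N) ^ M * b : RingInt p N) : N)‖ < 1 := by
    rw [map_mul, map_pow, map_natCast, norm_mul, norm_pow, norm_natCast_self]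
    refine mul_lt_one_of_nonneg_of_lt_one_left (by positivity) ?_ (norm_ringInt_le_one p b)
    exact pow_lt_one₀ (by positivity) (inv_lt_one_of_one_lt₀ (Nat.one_lt_cast.2 hp.out.one_lt)) hM
  have h1 : ‖((1 + (p : RingInt p N) ^ M * b : RingInt p N) : N)‖ = 1 := by
    rw [map_add, map_one]
    refine (IsUltrametricDist.norm_add_eq_max_of_norm_ne_norm ?_).trans ?_
    · rw [norm_one]; exact hlt.ne'
    · rw [norm_one]; exact max_eq_left hlt.le
  refine .of_mul_eq_one (RingInt.mk ((1 + (p : RingInt p N) ^ M * b : RingInt p N) : N)⁻¹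
    (isIntegral_of_norm_le_one (by rw [norm_inv, h1, inv_one]))) (RingInt.ext ?_)
  rw [map_mul, RingInt.coe_mk, map_one, mul_inv_cancel₀]
  rw [← norm_pos_iff, h1]
  exact one_pos

/-- The kernel of `d` is dense for the `p`-adic topology of `𝒪_Kbar`: if `p ^ M dα = 0` and
`β ^ q + p ^ n β = α` with `q = p ^ (n + M)`, then `d(β ^ q) = 0`. -/
theorem exists_D_eq_zero_add_pow_mul {M : ℕ} {α : RingInt p N}
    (hα : p ^ M • D (RingInt p K) (RingInt p N) α = 0) (n : ℕ) :
    ∃ u b : RingInt p N, α = u + (p : RingInt p N) ^ n * b ∧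
      D (RingInt p K) (RingInt p N) u = 0 := by
  wlog hM : M ≠ 0 generalizing M
  · refine this (M := M + 1) ?_ M.succ_ne_zero
    rw [pow_succ', mul_smul, hα, smul_zero]
  obtain ⟨β, hβ⟩ := exists_pow_add_mul_eq (q := p ^ (n + M))
    (Nat.one_lt_pow (by omega) hp.out.one_lt) ((p : RingInt p N) ^ n) α
  refine ⟨β ^ p ^ (n + M), β, hβ.symm, ?_⟩
  -- applying `d` gives `p ^ n w dβ = dα` with the unit `w = 1 + p ^ M β ^ (q - 1)`, so that
  -- `w d(β ^ q) = p ^ M β ^ (q - 1) dα = 0`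
  have hw := isUnit_one_add_mul (p := p) (N := N) hM (β ^ (p ^ (n + M) - 1))
  rw [← hw.smul_eq_zero]
  have h1 := congrArg (D (RingInt p K) (RingInt p N)) hβ
  rw [map_add, Derivation.leibniz_pow, Derivation.leibniz, ← Nat.cast_pow, Derivation.map_natCast,
    smul_zero, add_zero] at h1
  have h2 : (p ^ M : ℕ) • β ^ (p ^ (n + M) - 1) • D (RingInt p K) (RingInt p N) α = 0 := by
    rw [smul_comm, hα, smul_zero]
  rw [← h1] at h2
  rw [Derivation.leibniz_pow, ← h2]
  simp only [← Nat.cast_smul_eq_nsmul (RingInt p N), smul_smul, ← add_smul]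
  congr 1
  push_cast
  ring

include hε in
theorem surjective_D : Function.Surjective (D (RingInt p K) (RingInt p N)) := fun ω => by
  obtain ⟨r, a, rfl⟩ := exists_smul_dlogMu_eq K hε ω
  let t : RingInt p N := RingInt.mk ((ε.1 r).unit : N)
    (((hε r).isIntegral (pow_pos hp.out.pos _)).tower_top (A := ℤ_[p]))
  have ht : (t : N) = (ε.1 r).unit := rfl
  -- `a dlog ε_r` is of the form `v dt`
  obtain ⟨v, hv⟩ : ∃ v : RingInt p N, a • dlogMu p N K (ε.1 r) =
      v • D (RingInt p K) (RingInt p N) t := by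
    refine ⟨a * ((muToUnits p N (Additive.toMul (ε.1 r)))⁻¹ : (RingInt p N)ˣ).1, ?_⟩
    rw [mul_smul]
    rfl
  obtain ⟨n, hn⟩ := exists_pow_smul_eq_zero K hε (D (RingInt p K) (RingInt p N) t)
  obtain ⟨M, hM⟩ := exists_pow_smul_eq_zero K hε (D (RingInt p K) (RingInt p N) v)
  obtain ⟨u, b, rfl, hu⟩ := exists_D_eq_zero_add_pow_mul K hM n
  -- `p ^ n b dt = 0`, so that `v dt = u dt = d(ut)`
  refine ⟨u * t, ?_⟩
  rw [hv, Derivation.leibniz, hu, smul_zero, add_zero, add_smul, mul_comm, mul_smul,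
    ← Nat.cast_pow, Nat.cast_smul_eq_nsmul, hn, smul_zero, add_zero]

end Surjective

/-! ### The Tate module of `Ω¹` -/

theorem norm_sub_le_max {E : Type*} [SeminormedAddCommGroup E] [IsUltrametricDist E] (x y : E) :
    ‖x - y‖ ≤ max ‖x‖ ‖y‖ := by
  rw [sub_eq_add_neg, ← norm_neg y]
  exact IsUltrametricDist.norm_add_le_max x (-y)

section TateLimit

open Filter

variable {p : ℕ} [hp : Fact p.Prime] {N : Type*} [NormedField N] [NormedAlgebra ℚ_[p] N]
  [Algebra.IsAlgebraic ℚ_[p] N] [Algebra ℤ_[p] N] [IsScalarTower ℤ_[p] ℚ_[p] N]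
  {K : Type*} [Field K] [Algebra ℚ_[p] K] [FiniteDimensional ℚ_[p] K]
  [Algebra ℤ_[p] K] [IsScalarTower ℤ_[p] ℚ_[p] K] [Algebra K N] [IsScalarTower ℚ_[p] K N]
  {ε : Zp1 p N} {B : ℝ}

variable (p N K) in
/-- `I_K` is a closed ball. -/
theorem exists_fracIdeal_radius :
    ∃ B : ℝ, 1 ≤ B ∧ ∀ x : N, x ∈ fracIdeal p N K ↔ ‖x‖ ≤ B := by
  obtain ⟨β, hβ⟩ := exists_adjoin_ringInt_eq_top p K
  have h : ∀ x : N, x ∈ fracIdeal p N K ↔ ‖x‖ ≤ (p : ℝ) ^ (1 / ((p : ℝ) - 1)) /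
      ‖algebraMap K N (aeval β (derivative (minpoly ℤ_[p] β)) : RingInt p K)‖ := fun x => by
    rw [mem_fracIdeal_iff hβ, le_div_iff₀ (norm_algebraMap_aeval_derivative_pos N β)]
  refine ⟨_, ?_, h⟩
  exact (norm_one (α := N)).ge.trans
    ((h 1).1 (intSubmodule_le_fracIdeal p N K ⟨1, map_one (algebraMap (RingInt p N) N)⟩))

theorem smul_completion_eq (z : ℤ_[p]) (c : CK N) : z • c = (z : ℚ_[p]) • c := by
  rw [← algebraMap_smul ℚ_[p] z c]; rfl

theorem norm_smul_completion_le (z : ℤ_[p]) (c : CK N) : ‖z • c‖ ≤ ‖c‖ := by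
  rw [smul_completion_eq, norm_smul]
  exact mul_le_of_le_one_left (norm_nonneg _) z.2

/-- The sequences `(a_r)` that represent a point `c` of the completion of `𝒪_Kbar`. -/
def IsIntApprox (p : ℕ) [Fact p.Prime] {N : Type*} [NormedField N] [Algebra ℤ_[p] N]
    (c : CK N) (a : ℕ → RingInt p N) : Prop :=
  ∀ r : ℕ, ‖c - ((a r : N) : CK N)‖ ≤ (p : ℝ) ^ (-(r : ℤ))

theorem exists_isIntApprox {c : CK N} (hc : ‖c‖ ≤ 1) : ∃ a, IsIntApprox p c a := by
  have : IsUltrametricDist (CK N) := IsUltrametricDist.of_normedAlgebra ℚ_[p]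
  have h : ∀ r : ℕ, ∃ a : RingInt p N, ‖c - ((a : N) : CK N)‖ ≤ (p : ℝ) ^ (-(r : ℤ)) := fun r => by
    have hpos : (0 : ℝ) < (p : ℝ) ^ (-(r : ℤ)) := zpow_pos (Nat.cast_pos.2 hp.out.pos) _
    obtain ⟨x, hx⟩ := UniformSpace.Completion.denseRange_coe.exists_dist_lt c hpos
    rw [dist_eq_norm] at hx
    have hle : (p : ℝ) ^ (-(r : ℤ)) ≤ 1 :=
      zpow_le_one_of_nonpos₀ (Nat.one_le_cast.2 hp.out.pos) (by simp)
    have hx1 : ‖x‖ ≤ 1 := by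
      rw [← UniformSpace.Completion.norm_coe, ← sub_sub_cancel c (x : CK N)]
      exact (norm_sub_le_max _ _).trans (max_le hc (hx.le.trans hle))
    exact ⟨RingInt.mk x (isIntegral_of_norm_le_one hx1), hx.le⟩
  choose a ha using h
  exact ⟨a, ha⟩

variable (K) in
theorem IsIntApprox.mem_tateModule {c : CK N} {a : ℕ → RingInt p N} (h : IsIntApprox p c a)
    (e : Zp1 p N) : (fun r => a r • dlogMu p N K (e.1 r)) ∈ TateModule p (Omega p N K) := by
  have : IsUltrametricDist (CK N) := IsUltrametricDist.of_normedAlgebra ℚ_[p]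
  refine ⟨fun r => ?_, fun r => ?_⟩
  · rw [smul_comm, ← Nat.cast_pow, Nat.cast_smul_eq_nsmul, pow_smul_dlogMu, smul_zero]
  · rw [smul_comm, Nat.cast_smul_eq_nsmul, smul_dlogMu_succ, ← sub_eq_zero, ← sub_smul]
    have hle : (p : ℝ) ^ (-((r + 1 : ℕ) : ℤ)) ≤ (p : ℝ) ^ (-(r : ℤ)) :=
      zpow_le_zpow_right₀ (Nat.one_le_cast.2 hp.out.pos) (by push_cast; linarith)
    obtain ⟨b, hb⟩ : (p : RingInt p N) ^ r ∣ a (r + 1) - a r := by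
      rw [dvd_iff_norm_le, map_sub, map_pow, map_natCast, norm_pow, norm_natCast_self,
        ← UniformSpace.Completion.norm_coe, UniformSpace.Completion.coe_sub,
        ← sub_sub_sub_cancel_left _ _ c, inv_pow, ← zpow_natCast, ← zpow_neg]
      exact (norm_sub_le_max _ _).trans (max_le (h r) ((h (r + 1)).trans hle))
    rw [hb, mul_comm, mul_smul, ← Nat.cast_pow, Nat.cast_smul_eq_nsmul, pow_smul_dlogMu, smul_zero]

variable (ε B) in
/-- For `t` in the Tate module with `t_r = (p ^ r y_r) dlog ε_r`, the limit `c` of the numbers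
`p ^ r y_r`. The radius `B` of `I_K` measures the ambiguity of `y_r`. -/
def IsTateLimit (t : TateModule p (Omega p N K)) (c : CK N) : Prop :=
  ∀ (r : ℕ) (y : N), dlogHom K ε y = t.1 r → ‖c - (((p : N) ^ r * y : N) : CK N)‖ ≤ B * (p : ℝ)⁻¹ ^ r

theorem norm_pow_mul_sub_le (r : ℕ) {y y' : N} (h : ‖y - y'‖ ≤ B) :
    ‖(((p : N) ^ r * y : N) : CK N) - (((p : N) ^ r * y' : N) : CK N)‖ ≤ B * (p : ℝ)⁻¹ ^ r := by
  rw [← UniformSpace.Completion.coe_sub, UniformSpace.Completion.norm_coe, ← mul_sub, norm_mul,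
    norm_pow, norm_natCast_self, mul_comm]
  exact mul_le_mul_of_nonneg_right h (by positivity)

theorem tendsto_radius : Tendsto (fun r : ℕ => B * (p : ℝ)⁻¹ ^ r) atTop (nhds 0) := by
  rw [← mul_zero B]
  exact (tendsto_pow_atTop_nhds_zero_of_lt_one (by positivity)
    (inv_lt_one_of_one_lt₀ (Nat.one_lt_cast.2 hp.out.one_lt))).const_mul B

section

variable (hε : ∀ n, IsPrimitiveRoot ((ε.1 n).unit : N) (p ^ n))
  (hB : ∀ x : N, x ∈ fracIdeal p N K ↔ ‖x‖ ≤ B)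

include hε hB

theorem norm_sub_le_of_dlogHom_eq {y y' : N} (h : dlogHom K ε y = dlogHom K ε y') :
    ‖y - y'‖ ≤ B := by
  rw [← hB, ← dlogHom_eq_zero_iff K hε, map_sub, h, sub_self]

/-- It suffices to test one `y_r` for each `r`. -/
theorem IsTateLimit.of_exists {t : TateModule p (Omega p N K)} {c : CK N}
    (h : ∀ r, ∃ y : N, dlogHom K ε y = t.1 r ∧
      ‖c - (((p : N) ^ r * y : N) : CK N)‖ ≤ B * (p : ℝ)⁻¹ ^ r) : IsTateLimit ε B t c := by
  have : IsUltrametricDist (CK N) := IsUltrametricDist.of_normedAlgebra ℚ_[p]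
  intro r y hy
  obtain ⟨y', hy', hc⟩ := h r
  rw [← sub_add_sub_cancel _ (((p : N) ^ r * y' : N) : CK N)]
  exact (IsUltrametricDist.norm_add_le_max _ _).trans (max_le hc
    (norm_pow_mul_sub_le r (norm_sub_le_of_dlogHom_eq hε hB (hy'.trans hy.symm))))

/-- The numbers `p ^ r y_r` form a Cauchy sequence, since `p y_(r+1) - y_r` lies in `I_K`. -/
theorem exists_isTateLimit (t : TateModule p (Omega p N K)) : ∃ c, IsTateLimit ε B t c := by
  have : IsUltrametricDist (CK N) := IsUltrametricDist.of_normedAlgebra ℚ_[p]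
  choose y hy using fun r => exists_dlogHom_eq K hε (t.1 r)
  let s : ℕ → CK N := fun r => (((p : N) ^ r * y r : N) : CK N)
  have hstep : ∀ r, ‖s r - s (r + 1)‖ ≤ B * (p : ℝ)⁻¹ ^ r := fun r => by
    have h1 : s (r + 1) = (((p : N) ^ r * (p * y (r + 1)) : N) : CK N) := by
      rw [← mul_assoc, ← pow_succ]
    rw [h1]
    refine norm_pow_mul_sub_le r (norm_sub_le_of_dlogHom_eq hε hB ?_)
    rw [hy, ← t.2.2 r, ← hy (r + 1), ← nsmul_eq_mul, map_nsmul, Nat.cast_smul_eq_nsmul]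
  have hp1 : (p : ℝ)⁻¹ < 1 := inv_lt_one_of_one_lt₀ (Nat.one_lt_cast.2 hp.out.one_lt)
  have hB0 : 0 ≤ B := by simpa using (hB 0).1 (zero_mem _)
  obtain ⟨c, hc⟩ := cauchySeq_tendsto_of_complete
    (cauchySeq_of_le_geometric (f := s) _ B hp1 fun r => by rw [dist_eq_norm]; exact hstep r)
  refine ⟨c, IsTateLimit.of_exists hε hB fun r => ⟨y r, hy r, ?_⟩⟩
  have htail : ∀ n, r ≤ n → ‖s n - s r‖ ≤ B * (p : ℝ)⁻¹ ^ r := fun n hn => by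
    induction n, hn using Nat.le_induction with
    | base => rw [sub_self, norm_zero]; positivity
    | succ n hn ih =>
      rw [← sub_add_sub_cancel _ (s n)]
      refine (IsUltrametricDist.norm_add_le_max _ _).trans (max_le ?_ ih)
      rw [norm_sub_rev]
      exact (hstep n).trans (mul_le_mul_of_nonneg_left
        (pow_le_pow_of_le_one (by positivity) hp1.le hn) hB0)
  exact le_of_tendsto ((hc.sub_const _).norm) (eventually_atTop.2 ⟨r, htail⟩)

theorem IsTateLimit.unique {t : TateModule p (Omega p N K)} {c c' : CK N}
    (h : IsTateLimit ε B t c) (h' : IsTateLimit ε B t c') : c = c' := by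
  have : IsUltrametricDist (CK N) := IsUltrametricDist.of_normedAlgebra ℚ_[p]
  rw [← sub_eq_zero, ← norm_le_zero_iff]
  refine ge_of_tendsto' (tendsto_radius (p := p) (B := B)) fun r => ?_
  obtain ⟨y, hy⟩ := exists_dlogHom_eq K hε (t.1 r)
  rw [← sub_sub_sub_cancel_right c c' (((p : N) ^ r * y : N) : CK N)]
  exact (norm_sub_le_max _ _).trans (max_le (h r y hy) (h' r y hy))

theorem IsTateLimit.add {t t' : TateModule p (Omega p N K)} {c c' : CK N}
    (h : IsTateLimit ε B t c) (h' : IsTateLimit ε B t' c') :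
    IsTateLimit ε B (t + t') (c + c') := by
  have : IsUltrametricDist (CK N) := IsUltrametricDist.of_normedAlgebra ℚ_[p]
  refine IsTateLimit.of_exists hε hB fun r => ?_
  obtain ⟨y, hy⟩ := exists_dlogHom_eq K hε (t.1 r)
  obtain ⟨y', hy'⟩ := exists_dlogHom_eq K hε (t'.1 r)
  refine ⟨y + y', by rw [map_add, hy, hy']; rfl, ?_⟩
  rw [mul_add, UniformSpace.Completion.coe_add, add_sub_add_comm]
  exact (IsUltrametricDist.norm_add_le_max _ _).trans (max_le (h r y hy) (h' r y' hy'))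

omit hε hB in
theorem dlogHom_smul (z : ℤ_[p]) (y : N) : dlogHom K ε (z • y) = z • dlogHom K ε y := by
  rw [← algebraMap_smul (RingInt p N) z, map_smul, algebraMap_smul]

theorem IsTateLimit.smul {t : TateModule p (Omega p N K)} {c : CK N}
    (h : IsTateLimit ε B t c) (z : ℤ_[p]) : IsTateLimit ε B (z • t) (z • c) := by
  refine IsTateLimit.of_exists hε hB fun r => ?_
  obtain ⟨y, hy⟩ := exists_dlogHom_eq K hε (t.1 r)
  refine ⟨z • y, by rw [dlogHom_smul, hy]; rfl, ?_⟩
  rw [mul_smul_comm, UniformSpace.Completion.coe_smul, ← smul_sub]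
  exact (norm_smul_completion_le _ _).trans (h r y hy)

/-- If the limit is zero, then `p ^ r y_r` has norm at most `B p ^ (-r)`, that is, `y_r ∈ I_K`. -/
theorem IsTateLimit.eq_zero {t : TateModule p (Omega p N K)} (h : IsTateLimit ε B t 0) : t = 0 := by
  refine Subtype.ext (funext fun r => ?_)
  obtain ⟨y, hy⟩ := exists_dlogHom_eq K hε (t.1 r)
  have h1 := h r y hy
  rw [zero_sub, norm_neg, UniformSpace.Completion.norm_coe, norm_mul, norm_pow, norm_natCast_self,
    mul_comm, mul_le_mul_iff_left₀ (pow_pos (inv_pos.2 (Nat.cast_pos.2 hp.out.pos)) r), ← hB,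
    ← dlogHom_eq_zero_iff K hε, hy] at h1
  exact h1

/-- The system `(a_r dlog ε'_r)_r` with `ε' = z ε` has the limit `z c`, where `c` is the limit of the
`a_r`. -/
theorem IsIntApprox.isTateLimit (hB1 : 1 ≤ B) {c : CK N} {a : ℕ → RingInt p N}
    (h : IsIntApprox p c a) (z : ℤ_[p]) :
    IsTateLimit ε B (⟨_, h.mem_tateModule K (z • ε)⟩ : TateModule p (Omega p N K)) (z • c) := by
  refine IsTateLimit.of_exists hε hB fun r => ?_
  have hp0 : (p : N) ^ r ≠ 0 := pow_ne_zero _ (norm_pos_iff.1 (by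
    rw [norm_natCast_self]; exact inv_pos.2 (Nat.cast_pos.2 hp.out.pos)))
  have ha : (a r : N) = (p : N) ^ r * (a r / (p : N) ^ r) := (mul_div_cancel₀ _ hp0).symm
  refine ⟨z • ((a r : N) / (p : N) ^ r), ?_, ?_⟩
  · rw [dlogHom_smul, dlogHom_apply K ε ha, smul_comm, ← map_smul]
    rfl
  · rw [mul_smul_comm, UniformSpace.Completion.coe_smul, ← smul_sub, ← ha]
    refine (norm_smul_completion_le _ _).trans ((h r).trans ?_)
    rw [zpow_neg, zpow_natCast, inv_pow]
    exact le_mul_of_one_le_left (by positivity) hB1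

/-- The map `T_p(Ω¹) → ℂ_K` given by a generator of `ℤ_p(1)`. -/
def tateLimit : TateModule p (Omega p N K) →ₗ[ℤ_[p]] CK N where
  toFun t := (exists_isTateLimit hε hB t).choose
  map_add' t t' := (exists_isTateLimit hε hB (t + t')).choose_spec.unique hε hB
    ((exists_isTateLimit hε hB t).choose_spec.add hε hB (exists_isTateLimit hε hB t').choose_spec)
  map_smul' z t := (exists_isTateLimit hε hB (z • t)).choose_spec.unique hε hB
    ((exists_isTateLimit hε hB t).choose_spec.smul hε hB z)

theorem tateLimit_spec (t : TateModule p (Omega p N K)) : IsTateLimit ε B t (tateLimit hε hB t) :=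
  (exists_isTateLimit hε hB t).choose_spec

theorem tateLimit_eq {t : TateModule p (Omega p N K)} {c : CK N} (h : IsTateLimit ε B t c) :
    tateLimit hε hB t = c :=
  (tateLimit_spec hε hB t).unique hε hB h

omit hε hB in
theorem exists_norm_pow_smul_le_one (c : CK N) : ∃ n : ℕ, ‖(p : ℤ_[p]) ^ n • c‖ ≤ 1 := by
  obtain ⟨n, hn⟩ := pow_unbounded_of_one_lt ‖c‖
    (Nat.one_lt_cast.2 hp.out.one_lt : (1 : ℝ) < p)
  refine ⟨n, ?_⟩
  rw [smul_completion_eq, norm_smul, PadicInt.padic_norm_e_of_padicInt, PadicInt.norm_p_pow, zpow_neg,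
    zpow_natCast, inv_mul_le_iff₀ (pow_pos (Nat.cast_pos.2 hp.out.pos) _), mul_one]
  exact hn.le

/-- `ℂ_K` is the localization of `T_p(Ω¹)`: the map is injective, and `p ^ n c` is a limit of
integral elements for large `n`. -/
theorem isLocalizedModule_tateLimit (hB1 : 1 ≤ B) :
    IsLocalizedModule (nonZeroDivisors ℤ_[p]) (tateLimit (K := K) hε hB) where
  map_units z := by
    have hz : ((z : ℤ_[p]) : ℚ_[p]) ≠ 0 := by
      rw [Ne, PadicInt.coe_eq_zero]; exact nonZeroDivisors.ne_zero z.2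
    rw [Module.End.isUnit_iff]
    refine ⟨fun c c' h => ?_, fun c => ⟨((z : ℤ_[p]) : ℚ_[p])⁻¹ • c, ?_⟩⟩
    · simp only [Module.algebraMap_end_apply, smul_completion_eq] at h
      exact smul_right_injective _ hz h
    · rw [Module.algebraMap_end_apply, smul_completion_eq, smul_inv_smul₀ hz]
  surj c := by
    obtain ⟨n, hn⟩ := exists_norm_pow_smul_le_one (p := p) c
    obtain ⟨a, ha⟩ := exists_isIntApprox (p := p) hn
    refine ⟨⟨⟨_, ha.mem_tateModule K ((1 : ℤ_[p]) • ε)⟩, ⟨(p : ℤ_[p]) ^ n, ?_⟩⟩, ?_⟩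
    · rw [mem_nonZeroDivisors_iff_ne_zero]
      exact pow_ne_zero _ (Nat.cast_ne_zero.2 hp.out.ne_zero)
    · rw [tateLimit_eq hε hB (ha.isTateLimit hε hB hB1 1)]
      exact (one_smul _ _).symm
  exists_of_eq {t t'} h := by
    refine ⟨1, ?_⟩
    rw [one_smul, one_smul, ← sub_eq_zero]
    refine IsTateLimit.eq_zero hε hB (ε := ε) (B := B) ?_
    have := tateLimit_spec hε hB (t - t')
    rwa [map_sub, h, sub_self] at this

theorem isBaseChange_tateLimit (hB1 : 1 ≤ B) : IsBaseChange ℚ_[p] (tateLimit (K := K) hε hB) :=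
  (isLocalizedModule_iff_isBaseChange (nonZeroDivisors ℤ_[p]) ℚ_[p] _).1
    (isLocalizedModule_tateLimit hε hB hB1)

/-- The isomorphism `V_p(Ω¹) ≅ ℂ_K` given by a generator of `ℤ_p(1)`. -/
def vTateEquiv (hB1 : 1 ≤ B) : VTate p (Omega p N K) ≃ₗ[ℤ_[p]] CK N :=
  TensorProduct.comm ℤ_[p] _ _ ≪≫ₗ
    (isBaseChange_tateLimit hε hB hB1).equiv.restrictScalars ℤ_[p]

theorem vTateEquiv_tmul_one (hB1 : 1 ≤ B) (t : TateModule p (Omega p N K)) :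
    vTateEquiv hε hB hB1 (t ⊗ₜ 1) = tateLimit hε hB t := by
  change (isBaseChange_tateLimit hε hB hB1).equiv (1 ⊗ₜ t) = _
  rw [IsBaseChange.equiv_tmul, one_smul]

end

end TateLimit

/-! ### Galois equivariance -/

section Galois

variable {p : ℕ} [hp : Fact p.Prime] {N : Type*} [NormedField N] [NormedAlgebra ℚ_[p] N]
  [Algebra.IsAlgebraic ℚ_[p] N] [Algebra ℤ_[p] N] [IsScalarTower ℤ_[p] ℚ_[p] N]
  {K : Type*} [Field K] [Algebra ℚ_[p] K] [FiniteDimensional ℚ_[p] K]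
  [Algebra ℤ_[p] K] [IsScalarTower ℤ_[p] ℚ_[p] K] [Algebra K N] [IsScalarTower ℚ_[p] K N]
  (σ : N ≃ₐ[K] N)

variable (p) in
include p in
/-- Galois automorphisms preserve the norm, which is the spectral norm. -/
theorem isometry_algEquiv : Isometry σ := by
  refine AddMonoidHomClass.isometry_of_norm σ fun x => ?_
  rw [NormedAlgebra.norm_eq_spectralNorm ℚ_[p], NormedAlgebra.norm_eq_spectralNorm ℚ_[p] x]
  exact (spectralNorm_eq_of_equiv (σ.restrictScalars ℚ_[p]) x).symm

theorem completion_map_smul (z : ℤ_[p]) (c : CK N) :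
    UniformSpace.Completion.map σ (z • c) = z • UniformSpace.Completion.map σ c := by
  have hσ := (isometry_algEquiv p σ).uniformContinuous
  induction c using UniformSpace.Completion.induction_on with
  | hp =>
    exact isClosed_eq (UniformSpace.Completion.continuous_map.comp (continuous_const_smul z))
      ((continuous_const_smul z).comp UniformSpace.Completion.continuous_map)
  | ih x =>
    rw [← UniformSpace.Completion.coe_smul, UniformSpace.Completion.map_coe hσ,
      UniformSpace.Completion.map_coe hσ, ← UniformSpace.Completion.coe_smul]
    exact congrArg _ ((σ.toAlgHom.restrictScalars ℤ_[p]).toLinearMap.map_smul z x)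

theorem IsIntApprox.map {c : CK N} {a : ℕ → RingInt p N} (h : IsIntApprox p c a) :
    IsIntApprox p (UniformSpace.Completion.map σ c) fun r => galInt p σ (a r) := fun r => by
  have hσ := isometry_algEquiv p σ
  have h1 : ((galInt p σ (a r) : RingInt p N) : N) = σ (a r) := rfl
  rw [h1, ← UniformSpace.Completion.map_coe hσ.uniformContinuous, ← dist_eq_norm,
    hσ.completion_map.dist_eq, dist_eq_norm]
  exact h r

/-- `σ (a dlog ζ) = σ a dlog (σ ζ)`. -/
theorem galOmega_smul_dlogMu (a : RingInt p N) (x : Mu p N) :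
    galOmega p σ (a • dlogMu p N K x) = galInt p σ a • dlogMu p N K (galMu p σ x) := by
  set u := muToUnits p N (Additive.toMul x) with hu
  have h1 : dlogMu p N K x = (u⁻¹ : (RingInt p N)ˣ).1 • D (RingInt p K) (RingInt p N) u.1 := rfl
  have h2 : ((galInt p σ u.1 : RingInt p N) : N) = (galMu p σ x).unit := rfl
  refine eq_of_unit_smul_eq h2 ?_
  rw [h1, smul_smul, galOmega_smul_D, smul_smul, ← map_mul, mul_comm a, Units.mul_inv_cancel_left,
    smul_comm, smul_dlogMu K h2]

end Galois

/-! ### The isomorphism `ℂ_K(1) ≅ V_p(Ω¹)` -/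

section TateEquiv

variable {p : ℕ} [hp : Fact p.Prime] {N : Type*} [NormedField N] [NormedAlgebra ℚ_[p] N]
  [Algebra.IsAlgebraic ℚ_[p] N] [Algebra ℤ_[p] N] [IsScalarTower ℤ_[p] ℚ_[p] N]
  (K : Type*) [Field K] [Algebra ℚ_[p] K] [FiniteDimensional ℚ_[p] K]
  [Algebra ℤ_[p] K] [IsScalarTower ℤ_[p] ℚ_[p] K] [Algebra K N] [IsScalarTower ℚ_[p] K N]
  {ε : Zp1 p N} (hε : ∀ n, IsPrimitiveRoot ((ε.1 n).unit : N) (p ^ n))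

include hε in
theorem exists_equiv_vTate : ∃ e : CK1 p N ≃ₗ[ℤ_[p]] VTate p (Omega p N K),
    ∀ (c : CK N) (e' : Zp1 p N) (a : ℕ → RingInt p N) (h : IsIntApprox p c a),
      e (c ⊗ₜ e') = (⟨_, h.mem_tateModule K e'⟩ : TateModule p (Omega p N K)) ⊗ₜ 1 := by
  obtain ⟨B, hB1, hB⟩ := exists_fracIdeal_radius p N K
  refine ⟨TensorProduct.congr (LinearEquiv.refl ℤ_[p] (CK N)) (generatorEquiv hε).symm ≪≫ₗ
    TensorProduct.rid ℤ_[p] (CK N) ≪≫ₗ (vTateEquiv hε hB hB1).symm, fun c e' a h => ?_⟩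
  obtain ⟨z, rfl⟩ := (generatorEquiv hε).surjective e'
  rw [LinearEquiv.trans_apply, LinearEquiv.trans_apply, TensorProduct.congr_tmul,
    LinearEquiv.symm_apply_apply, TensorProduct.rid_tmul, LinearEquiv.symm_apply_eq,
    vTateEquiv_tmul_one]
  exact (tateLimit_eq hε hB (h.isTateLimit hε hB hB1 z)).symm

include hε in
theorem CK1.pow_smul_injective (n : ℕ) :
    Function.Injective fun x : CK1 p N => (p : ℤ_[p]) ^ n • x := fun x y h => by
  let f : CK1 p N ≃ₗ[ℤ_[p]] CK N :=
    TensorProduct.congr (LinearEquiv.refl ℤ_[p] (CK N)) (generatorEquiv hε).symm ≪≫ₗ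
      TensorProduct.rid ℤ_[p] (CK N)
  have hp0 : (((p : ℤ_[p]) ^ n : ℤ_[p]) : ℚ_[p]) ≠ 0 := by
    rw [Ne, PadicInt.coe_eq_zero]
    exact pow_ne_zero _ (Nat.cast_ne_zero.2 hp.out.ne_zero)
  have h1 := congrArg f h
  simp only [map_smul, smul_completion_eq] at h1
  exact f.injective (smul_right_injective _ hp0 h1)

include hε in
theorem exists_galois_equiv_vTate : ∃ e : CK1 p N ≃ₗ[ℤ_[p]] VTate p (Omega p N K),
    (∀ (c : CK N) (e' : Zp1 p N) (a : ℕ → RingInt p N),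
      (∀ r : ℕ, ‖c - ((a r : N) : CK N)‖ ≤ (p : ℝ) ^ (-(r : ℤ))) →
      ∃ h : (fun r => a r • dlogMu p N K (e'.1 r)) ∈ TateModule p (Omega p N K),
        e (c ⊗ₜ e') = (⟨_, h⟩ : TateModule p (Omega p N K)) ⊗ₜ 1) ∧
    ∀ (σ : N ≃ₐ[K] N) (c : CK N) (e' : Zp1 p N),
      e (UniformSpace.Completion.map σ c ⊗ₜ galZp1 p σ e') = galVOmega p σ (e (c ⊗ₜ e')) := by
  obtain ⟨e, he⟩ := exists_equiv_vTate K hε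
  refine ⟨e, fun c e' a h => ⟨_, he c e' a h⟩, fun σ c e' => ?_⟩
  -- after multiplication by a power of `p`, the formula for `e` applies
  obtain ⟨n, hn⟩ := exists_norm_pow_smul_le_one (p := p) c
  obtain ⟨a, ha⟩ := exists_isIntApprox (p := p) hn
  refine e.symm.injective (CK1.pow_smul_injective hε n ?_)
  refine e.injective ?_
  simp only [map_smul, LinearEquiv.apply_symm_apply]
  rw [← map_smul, ← map_smul, ← map_smul, TensorProduct.smul_tmul', TensorProduct.smul_tmul',
    ← completion_map_smul, he _ _ _ ha, he _ _ _ (ha.map σ)]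
  change _ = (TateModule.map (galOmega p σ) _) ⊗ₜ 1
  congr 1
  exact Subtype.ext (funext fun r => (galOmega_smul_dlogMu σ (a r) (e'.1 r)).symm)

end TateEquiv

end FontaineDifferentials

end

theorem mainTheorem5 (p : ℕ) [Fact p.Prime]
    -- a finite extension `K` of `ℚ_p`
    (K : Type*) [Field K] [Algebra ℚ_[p] K] [FiniteDimensional ℚ_[p] K]
    [Algebra ℤ_[p] K] [IsScalarTower ℤ_[p] ℚ_[p] K]
    -- an algebraic closure `Kbar` of `K`, with the norm that extends the `p`-adic norm of `ℚ_p`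
    (Kbar : Type*) [NormedField Kbar] [NormedAlgebra ℚ_[p] Kbar]
    [Algebra ℤ_[p] Kbar] [IsScalarTower ℤ_[p] ℚ_[p] Kbar]
    [Algebra K Kbar] [IsScalarTower ℚ_[p] K Kbar] [IsAlgClosure K Kbar] :
    -- `dlog` induces an isomorphism `(Kbar / I_K) ⊗ ℤ_p(1) ≅ Ω¹`
    (∃ e : (Kbar ⧸ fracIdeal p Kbar K) ⊗[ℤ_[p]] Zp1 p Kbar ≃ₗ[RingInt p Kbar] Omega p Kbar K,
      ∀ x, e (projFracIdeal p Kbar K x) = dlog p Kbar K x) ∧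
    -- `dlog` induces a Galois-equivariant isomorphism `ℂ_K(1) ≅ V_p(Ω¹)`, which sends `c ⊗ ε`
    -- with `c = lim a_r` in the completion of `𝒪_Kbar` to `(a_r • dlog ε_r)_r`
    (∃ e : CK1 p Kbar ≃ₗ[ℤ_[p]] VTate p (Omega p Kbar K),
      (∀ (c : CK Kbar) (ε : Zp1 p Kbar) (a : ℕ → RingInt p Kbar),
        (∀ r : ℕ, ‖c - ((a r : Kbar) : CK Kbar)‖ ≤ (p : ℝ) ^ (-(r : ℤ))) →
        ∃ h : (fun r => a r • dlogMu p Kbar K (ε.1 r)) ∈ TateModule p (Omega p Kbar K),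
          e (c ⊗ₜ ε) = (⟨_, h⟩ : TateModule p (Omega p Kbar K)) ⊗ₜ 1) ∧
      ∀ (σ : Kbar ≃ₐ[K] Kbar) (c : CK Kbar) (ε : Zp1 p Kbar),
        e (UniformSpace.Completion.map σ c ⊗ₜ galZp1 p σ ε) = galVOmega p σ (e (c ⊗ₜ ε))) ∧
    -- `Ω¹` is `p`-primary torsion
    (∀ ω : Omega p Kbar K, ∃ r : ℕ, p ^ r • ω = 0) ∧
    -- `Ω¹` is `p`-divisible
    (∀ ω : Omega p Kbar K, ∃ η : Omega p Kbar K, p • η = ω) ∧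
    -- the universal derivation `d : 𝒪_Kbar → Ω¹` is surjective
    Function.Surjective (KaehlerDifferential.D (RingInt p K) (RingInt p Kbar)) := by
  have : Algebra.IsAlgebraic K Kbar := IsAlgClosure.isAlgebraic
  have : Algebra.IsAlgebraic ℚ_[p] Kbar := Algebra.IsAlgebraic.trans ℚ_[p] K Kbar
  have : IsAlgClosed Kbar := IsAlgClosure.isAlgClosed K
  have : CharZero Kbar := charZero_of_injective_algebraMap (algebraMap ℚ_[p] Kbar).injective
  obtain ⟨ε, hε⟩ := exists_generator (p := p) (N := Kbar)
  exact ⟨exists_equiv_dlog K hε, exists_galois_equiv_vTate K hε,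
    exists_pow_smul_eq_zero K hε, exists_smul_eq K hε, surjective_D K hε⟩
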